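/- A \emph{marked BY tree} $(T,S,F,*)$ is a finite graph-theoretic tree $T$ with positive integer edge lengths, a non-empty set $S$ of vertices of degree $1$, an isometric automorphism $F$ of $(T,S)$, and an $F$-fixed vertex $*\notin S$. Put $\Lambda=\mathrm H_1(T,S\cup\{*\},\mathbb Z)\supseteq\Sigma=\mathrm H_1(T,S,\mathbb Z)$, with the intersection length pairing, and let the \emph{pipe} be $\Pi=\Lambda^\vee/\Sigma$, where $\Lambda^\vee=\mathrm{Hom}(\Lambda,\mathbb Z)$, with its $F$-action. Let $y\in\Pi$ be the image of the class in $\Lambda$ of a path from $*$ to a vertex of $S$, and let $\eta\in\Pi$ be the image of the sum-of-coordinates map $\Lambda\cong\mathbb Z[S]\to\mathbb Z$; both are $F$-fixed. For $\gamma\in\Pi^F$ let $\gamma_*\in\mathrm H^1(-F,\Pi)$ (continuous cohomology of $\hat{\mathbb Z}$, a generator acting by $-F$) be the image of the non-trivial element of $\mathrm H^1(-F,\mathbb Z)\cong\mathbb Z/2$ under $\gamma\colon\mathbb Z\to\Pi$ (where $F$ acts trivially on $\mathbb Z$). For a sign $\epsilon$ and $A=S$ or $A=S\cup\{*\}$,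 the \emph{Néron component group} of $(T,A,\epsilon F)$ is $\Phi_{(T,A,\epsilon F)}=(M^\vee/M)^{\epsilon F}$ with $M=\mathrm H_1(T,A,\mathbb Z)$. For an abelian group $B$ and $b\in B$ write $B\langle\frac12b\rangle=(B\oplus\mathbb Z)/(b,-2)$; for a class in $B/2B$ this is formed from any representative and is well defined up to isomorphism. \textbf{Theorem.} Let $(T,S,F,*)$ be a marked BY tree. (1) Exactly one of $y_*$, $\eta_*$, $(y+\eta)_*=y_*+\eta_*$ is zero. Define $\tau=0$ if $y_*=0\ne\eta_*$, $\tau=1$ if $\eta_*=0\neq y_*$, $\tau=2$ if $y_*=\eta_*\ne0$, and put $\gamma=y,\eta,y+\eta$ accordingly. Then there is $\beta\in\Pi$ with $(1+F)\beta=\gamma$; for every such $\beta$ the element $(1-F)\beta$ lies in $\Pi^{-F}$, and its class $\alpha\in\Pi^{-F}/2\Pi^{-F}$ does not depend on $\beta$. The group $\Pi^{-F}$ is finite. (2) $\Phi_{(T,S,-F)}\cong\Pi^{-F}$ if $\tau\ne1$ and $\Phi_{(T,S,-F)}\cong\Pi^{-F}\langle\frac12\alpha\rangle$ if $\tau=1$;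 $\Phi_{(T,S\cup\{*\},-F)}\cong\Pi^{-F}$ if $\tau\neq0$ and $\Phi_{(T,S\cup\{*\},-F)}\cong\Pi^{-F}\langle\frac12\alpha\rangle$ if $\tau=0$. (3) Every marked BY tree is obtained, up to isomorphism, from single edges by finitely many applications of the constructions below, and the triple $(\Pi^{-F},\alpha,\tau)$ is given, up to isomorphism, by the following rules, where $(\Pi_i^{-F},\alpha_i,\tau_i)$ is the triple of $T_i$: \begin{itemize} \item if $T$ is a single edge of length $l$ with one endpoint $*$ and the other in $S$, the triple is $(0,0,2)$ for $l$ odd and $(0,0,0)$ for $l$ even; \item if $T=T_0^{(l)}$ (an edge of length $l$ is grafted onto $T_0$ at its marked vertex, and the mark is moved to the other end of this edge), then $(\Pi^{-F},\alpha)=(\Pi_0^{-F},\alpha_0)$, with $\tau=2-\tau_0$ for $l$ odd and $\tau=\tau_0$ for $l$ even; \item if $T=T_0\vee T_1$ (the trees are joined at their marked vertices), then $\Pi^{-F}=(\Pi_0^{-F}\oplus\Pi_1^{-F})\langle\frac12(\alpha_0,-\alpha_1)\rangle$ if $\tau_0=\tau_1=0$ and $\Pi^{-F}=\Pi_0^{-F}\oplus\Pi_1^{-F}$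 otherwise; $\tau=\tau_0\tau_1$ mod $3$; and $\alpha=(\alpha_0,0)$ if $\tau_0=0$, $\alpha=(0,\alpha_1)$ if $\tau_1=0$ (these agree if $\tau_0=\tau_1=0$), $\alpha=(\alpha_0,\alpha_1)$ otherwise; \item if $T=\bigvee\mathrm{Ind}_{F^q}^FT_0$ ($q\ge1$ copies of $T_0$ joined at their marked vertices and permuted cyclically by $F$, so that $F^q$ acts on each copy as the automorphism of $T_0$, which is denoted $F^q$) and $q$ is odd, the triple is $(\Pi_0^{-F^q},\alpha_0,\tau_0)$; if $q$ is even, it is $(\Pi_0^{F^q}/y_0,\eta_0,1)$, where $y_0,\eta_0$ are the elements $y,\eta$ of the pipe $\Pi_0$ of $T_0$; \item if $T$ contains a marked BY subtree $T_0=(T_0,S_0,F,*)$ with $S_0=S$, the triple is $(\Pi_0^{-F},\alpha_0,\tau_0)$. \end{itemize} -/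

import Mathlib

universe u

namespace BYTrees

/-! ### Relative homology of a finite metrised graph -/

/-- The relative homology lattice `H₁(G, A; ℤ)` of a finite graph `G` relative to a set `A` of
vertices. A simplicial 1-chain is an antisymmetric function `c` supported on the adjacent pairs,
`c u v` being the multiplicity of the oriented edge `u → v`; the coefficient of its boundary at `v`
is `∑ u, c u v`. As there are no 2-cells and no edges in `A`, the first relative homology group is
the group of 1-chains whose boundary is supported on `A`. -/
def relH1 {V : Type u} [Fintype V] (G : SimpleGraph V) (A : Set V) :
    Submodule ℤ (V → V → ℤ) where
  carrier := {c | (∀ u v, c v u = -c u v) ∧ (∀ u v, ¬ G.Adj u v → c u v = 0) ∧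
    ∀ v, v ∉ A → ∑ u, c u v = 0}
  add_mem' := by
    rintro a b ⟨ha, ha', ha''⟩ ⟨hb, hb', hb''⟩
    refine ⟨fun u v => ?_, fun u v h => ?_, fun v h => ?_⟩
    · simp [ha u v, hb u v]; ring
    · simp [ha' u v h, hb' u v h]
    · simp [Finset.sum_add_distrib, ha'' v h, hb'' v h]
  zero_mem' := by simp
  smul_mem' := by
    rintro r a ⟨ha, ha', ha''⟩
    refine ⟨fun u v => ?_, fun u v h => ?_, fun v h => ?_⟩
    · simp [ha u v]
    · simp [ha' u v h]
    · simp [← Finset.mul_sum, ha'' v h]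

open Classical in
/-- The intersection length pairing: the sum over all edges `e` of `len e` times the product of the
multiplicities of `e`, with respect to some orientation of `e`, in the two chains. On antisymmetric
functions the choice of the orientation does not matter. -/
noncomputable def lengthPairing {V : Type u} [Fintype V] (G : SimpleGraph V) (len : Sym2 V → ℕ) :
    (V → V → ℤ) →ₗ[ℤ] (V → V → ℤ) →ₗ[ℤ] ℤ :=
  LinearMap.mk₂ ℤ
    (fun c d => ∑ e ∈ G.edgeFinset,
      (len e : ℤ) * (c (Quot.out e).1 (Quot.out e).2 * d (Quot.out e).1 (Quot.out e).2))
    (by intro a b c; simp [add_mul, mul_add, Finset.sum_add_distrib])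
    (by intro r a c; simp only [Pi.smul_apply, smul_eq_mul, Finset.mul_sum]
        exact Finset.sum_congr rfl fun e _ => by ring)
    (by intro a b c; simp [mul_add, Finset.sum_add_distrib])
    (by intro r a c; simp only [Pi.smul_apply, smul_eq_mul, Finset.mul_sum]
        exact Finset.sum_congr rfl fun e _ => by ring)

/-- The map from the relative homology lattice to its abstract dual induced by the pairing. -/
noncomputable def toDual {V : Type u} [Fintype V] (G : SimpleGraph V) (len : Sym2 V → ℕ)
    (A : Set V) : relH1 G A →ₗ[ℤ] Module.Dual ℤ (relH1 G A) :=
  (lengthPairing G len).domRestrict₁₂ (relH1 G A) (relH1 G A)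

theorem out_mul {V : Type u} {c d : V → V → ℤ} (hc : ∀ u v, c v u = -c u v)
    (hd : ∀ u v, d v u = -d u v) (u v : V) :
    c (Quot.out s(u, v)).1 (Quot.out s(u, v)).2 * d (Quot.out s(u, v)).1 (Quot.out s(u, v)).2
      = c u v * d u v := by
  have h : s((Quot.out s(u, v)).1, (Quot.out s(u, v)).2) = s(u, v) := Quot.out_eq s(u, v)
  rcases Sym2.eq_iff.1 h with ⟨h1, h2⟩ | ⟨h1, h2⟩
  · rw [h1, h2]
  · rw [h1, h2, hc u v, hd u v]; ring

/-- The signed automorphism `εF` acting on 1-chains. -/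
def signedChain {V : Type u} (F : Equiv.Perm V) (ε : ℤˣ) : (V → V → ℤ) →ₗ[ℤ] (V → V → ℤ) where
  toFun c := fun u v => (ε : ℤ) * c (F.symm u) (F.symm v)
  map_add' a b := by ext u v; simp [mul_add]
  map_smul' r a := by ext u v; simp; ring

theorem signedChain_mem {V : Type u} [Fintype V] {G : SimpleGraph V} {A : Set V} (F : G ≃g G)
    (hA : ∀ v, F v ∈ A ↔ v ∈ A) (ε : ℤˣ) {c : V → V → ℤ} (hc : c ∈ relH1 G A) :
    signedChain F.toEquiv ε c ∈ relH1 G A := by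
  obtain ⟨h1, h2, h3⟩ := hc
  refine ⟨fun u v => ?_, fun u v h => ?_, fun v h => ?_⟩
  · simp only [signedChain, LinearMap.coe_mk, AddHom.coe_mk]
    rw [h1 (F.toEquiv.symm u)]; ring
  · simp only [signedChain, LinearMap.coe_mk, AddHom.coe_mk]
    rw [h2, mul_zero]
    intro h'
    apply h
    have := F.map_adj_iff.2 h'
    rwa [show F (F.toEquiv.symm u) = u from F.toEquiv.apply_symm_apply u,
      show F (F.toEquiv.symm v) = v from F.toEquiv.apply_symm_apply v] at this
  · simp only [signedChain, LinearMap.coe_mk, AddHom.coe_mk]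
    rw [← Finset.mul_sum, Equiv.sum_comp F.toEquiv.symm (fun u => c u (F.toEquiv.symm v)), h3,
      mul_zero]
    intro h'
    apply h
    have := (hA _).2 h'
    rwa [show F (F.toEquiv.symm v) = v from F.toEquiv.apply_symm_apply v] at this

theorem signedChain_comp {V : Type u} (F F' : Equiv.Perm V) (ε : ℤˣ)
    (h : ∀ v, F.symm (F'.symm v) = v) (c : V → V → ℤ) :
    signedChain F' ε (signedChain F ε c) = c := by
  ext u v
  simp only [signedChain, LinearMap.coe_mk, AddHom.coe_mk, h]
  rw [← mul_assoc, ← Units.val_mul, Int.units_mul_self]; simp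

/-- The action of the signed automorphism `εF` on the relative homology lattice. -/
noncomputable def latticeAut {V : Type u} [Fintype V] {G : SimpleGraph V} {A : Set V} (F : G ≃g G)
    (hA : ∀ v, F v ∈ A ↔ v ∈ A) (ε : ℤˣ) : relH1 G A ≃ₗ[ℤ] relH1 G A :=
  LinearEquiv.ofLinearMap
    ((signedChain F.toEquiv ε).restrict fun _ hc => signedChain_mem F hA ε hc)
    ((signedChain F.symm.toEquiv ε).restrict fun _ hc =>
      signedChain_mem F.symm (fun v => by rw [← hA]; simp) ε hc)
    (by ext c : 2
        exact signedChain_comp F.symm.toEquiv F.toEquiv ε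
          (fun v => F.toEquiv.apply_symm_apply v) c.1)
    (by ext c : 2
        exact signedChain_comp F.toEquiv F.symm.toEquiv ε
          (fun v => F.toEquiv.symm_apply_apply v) c.1)

theorem toDual_latticeAut {V : Type u} [Fintype V] {G : SimpleGraph V} {len : Sym2 V → ℕ}
    {A : Set V} (F : G ≃g G) (hlen : ∀ e ∈ G.edgeSet, len (e.map F) = len e)
    (hA : ∀ v, F v ∈ A ↔ v ∈ A) (ε : ℤˣ) (c d : relH1 G A) :
    toDual G len A (latticeAut F hA ε c) (latticeAut F hA ε d) = toDual G len A c d := by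
  classical
  change ∑ e ∈ G.edgeFinset, (len e : ℤ) *
      (signedChain F.toEquiv ε c.1 (Quot.out e).1 (Quot.out e).2 *
        signedChain F.toEquiv ε d.1 (Quot.out e).1 (Quot.out e).2) =
    ∑ e ∈ G.edgeFinset, (len e : ℤ) * (c.1 (Quot.out e).1 (Quot.out e).2 *
        d.1 (Quot.out e).1 (Quot.out e).2)
  symm
  refine Finset.sum_bij (fun e _ => e.map F) ?_ ?_ ?_ ?_
  · intro e he
    induction e with
    | _ u v => simpa [F.map_adj_iff] using he
  · intro e _ e' _ h
    exact Sym2.map.injective F.injective h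
  · intro e he
    refine ⟨e.map F.symm, ?_, ?_⟩
    · induction e with
      | _ u v => simpa [F.symm.map_adj_iff] using he
    · rw [Sym2.map_map]
      have h : (F ∘ F.symm : V → V) = id := by ext v; simp
      rw [h, Sym2.map_id]; rfl
  · intro e he
    rw [hlen e (by simpa using he)]
    induction e with
    | _ u v =>
      rw [out_mul c.2.1 d.2.1, Sym2.map_mk,
        out_mul (signedChain_mem F hA ε c.2).1 (signedChain_mem F hA ε d.2).1]
      simp only [signedChain, LinearMap.coe_mk, AddHom.coe_mk]
      have h : ∀ w, F.toEquiv.symm (F w) = w := fun w => F.toEquiv.symm_apply_apply w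
      have h' : (ε : ℤ) * ε = 1 := by rw [← Units.val_mul, Int.units_mul_self]; rfl
      rw [h, h]
      linear_combination (-(len s(u, v) : ℤ) * c.1 u v * d.1 u v) * h'

/-- The contragredient action on the dual of a module with automorphism `e`: `φ ↦ φ ∘ e⁻¹`. -/
noncomputable def dualAut {M : Type u} [AddCommGroup M] (e : M ≃ₗ[ℤ] M) :
    Module.Dual ℤ M ≃ₗ[ℤ] Module.Dual ℤ M :=
  e.symm.dualMap

theorem dualAut_toDual {V : Type u} [Fintype V] {G : SimpleGraph V} {len : Sym2 V → ℕ}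
    {A : Set V} (F : G ≃g G) (hlen : ∀ e ∈ G.edgeSet, len (e.map F) = len e)
    (hA : ∀ v, F v ∈ A ↔ v ∈ A) (ε : ℤˣ) (c : relH1 G A) :
    dualAut (latticeAut F hA ε) (toDual G len A c) = toDual G len A (latticeAut F hA ε c) := by
  ext1 d
  obtain ⟨d, rfl⟩ := (latticeAut F hA ε).surjective d
  rw [toDual_latticeAut F hlen hA]
  simp [dualAut]

/-! ### BY trees and their Néron component groups -/

/-- A BY tree `(T, S, εF)` whose subgraph `S` has no edges and whose sign function is constant:
a finite tree with positive integral edge lengths, a set `S` of vertices, an isometric automorphism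
`F` preserving `S`, and a sign `ε`. -/
structure BYTree where
  V : Type u
  [fintypeV : Fintype V]
  graph : SimpleGraph V
  isTree : graph.IsTree
  len : Sym2 V → ℕ
  len_pos : ∀ e ∈ graph.edgeSet, 0 < len e
  S : Set V
  F : graph ≃g graph
  F_len : ∀ e ∈ graph.edgeSet, len (e.map F) = len e
  F_S : ∀ v, F v ∈ S ↔ v ∈ S
  ε : ℤˣ

attribute [instance] BYTree.fintypeV

/-- The relative homology lattice `Λ = H₁(T, S; ℤ)`. -/
abbrev BYTree.lattice (B : BYTree.{u}) : Submodule ℤ (B.V → B.V → ℤ) := relH1 B.graph B.S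

/-- The geometric Néron component group `Λ^∨ / Λ`. -/
abbrev BYTree.GeomNeron (B : BYTree.{u}) : Type u :=
  Module.Dual ℤ B.lattice ⧸ LinearMap.range (toDual B.graph B.len B.S)

/-- The action of `εF` on the geometric Néron component group. -/
noncomputable def BYTree.geomAut (B : BYTree.{u}) : B.GeomNeron ≃ₗ[ℤ] B.GeomNeron :=
  Submodule.Quotient.equiv _ _ (dualAut (latticeAut B.F B.F_S B.ε)) (by
    ext φ
    constructor
    · rintro ⟨_, ⟨c, rfl⟩, rfl⟩
      exact ⟨_, (dualAut_toDual B.F B.F_len B.F_S B.ε c).symm⟩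
    · rintro ⟨c, rfl⟩
      obtain ⟨c, rfl⟩ := (latticeAut B.F B.F_S B.ε).surjective c
      exact ⟨_, ⟨c, rfl⟩, dualAut_toDual B.F B.F_len B.F_S B.ε c⟩)

/-- The submodule of elements fixed by an automorphism. -/
def fixedBy {M : Type u} [AddCommGroup M] (f : M ≃ₗ[ℤ] M) : Submodule ℤ M where
  carrier := {x | f x = x}
  add_mem' := by intro a b ha hb; simp_all
  zero_mem' := by simp
  smul_mem' := by intro r a ha; simp_all

/-- The Néron component group `Φ = (Λ^∨ / Λ)^{εF}`. -/
abbrev BYTree.Neron (B : BYTree.{u}) : Type u := fixedBy B.geomAut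

/-- A marked (unsigned simple) BY tree `(T, S, F, *)`. -/
structure MarkedBYTree where
  V : Type u
  [fintypeV : Fintype V]
  graph : SimpleGraph V
  isTree : graph.IsTree
  len : Sym2 V → ℕ
  len_pos : ∀ e ∈ graph.edgeSet, 0 < len e
  S : Set V
  S_nonempty : S.Nonempty
  S_degree_one : ∀ s ∈ S, ∃! w, graph.Adj s w
  F : graph ≃g graph
  F_len : ∀ e ∈ graph.edgeSet, len (e.map F) = len e
  F_S : ∀ v, F v ∈ S ↔ v ∈ S
  pt : V
  pt_notMem : pt ∉ S
  F_pt : F pt = pt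

attribute [instance] MarkedBYTree.fintypeV

/-! ### First cohomology of an automorphism of finite order -/

/-- Continuous 1-cocycles of `ℤ̂` with values in the discrete module `M` on which a topological
generator acts by `f`. By density of `ℤ` in `ℤ̂` these are the crossed homomorphisms `ℤ → M` that
are periodic. -/
def cocycles {M : Type u} [AddCommGroup M] (f : M ≃ₗ[ℤ] M) : AddSubgroup (ℤ → M) where
  carrier := {a | (∀ i j, a (i + j) = a i + (f ^ i) (a j)) ∧ ∃ n : ℤ, 0 < n ∧ ∀ i, a (i + n) = a i}
  add_mem' := by
    rintro a b ⟨ha, n, hn, hna⟩ ⟨hb, m, hm, hmb⟩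
    refine ⟨fun i j => ?_, n * m, by positivity, fun i => ?_⟩
    · simp only [Pi.add_apply, ha i j, hb i j, map_add]; abel
    · have h1 : Function.Periodic a (m * n) := Function.Periodic.int_mul hna m
      have h2 : Function.Periodic b (n * m) := Function.Periodic.int_mul hmb n
      simp only [Pi.add_apply]
      rw [h2 i, mul_comm n m, h1 i]
  zero_mem' := ⟨by simp, 1, by simp, by simp⟩
  neg_mem' := by
    rintro a ⟨ha, n, hn, hna⟩
    refine ⟨fun i j => ?_, n, hn, fun i => ?_⟩
    · simp only [Pi.neg_apply, ha i j, map_neg]; abel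
    · simp [hna i]

/-- 1-coboundaries `i ↦ f ^ i m - m`. -/
def coboundaries {M : Type u} [AddCommGroup M] (f : M ≃ₗ[ℤ] M) : AddSubgroup (ℤ → M) where
  carrier := {a | ∃ m : M, ∀ i : ℤ, a i = (f ^ i) m - m}
  add_mem' := by
    rintro a b ⟨m, hm⟩ ⟨n, hn⟩
    exact ⟨m + n, fun i => by simp only [Pi.add_apply, hm, hn, map_add]; abel⟩
  zero_mem' := ⟨0, by simp⟩
  neg_mem' := by
    rintro a ⟨m, hm⟩
    exact ⟨-m, fun i => by simp only [Pi.neg_apply, hm, map_neg]; abel⟩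

/-- The cohomology group `H¹(f, M)`. -/
abbrev H1 {M : Type u} [AddCommGroup M] (f : M ≃ₗ[ℤ] M) : Type u :=
  cocycles f ⧸ (coboundaries f).addSubgroupOf (cocycles f)

/-- The automorphism `-F`. -/
def negAut {M : Type u} [AddCommGroup M] (f : M ≃ₗ[ℤ] M) : M ≃ₗ[ℤ] M :=
  f.trans (LinearEquiv.neg ℤ)

theorem negAut_zpow_apply {M : Type u} [AddCommGroup M] (f : M ≃ₗ[ℤ] M) {x : M} (hx : f x = x)
    (i : ℤ) : ((negAut f) ^ i) x = if Even i then x else -x := by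
  have h1 : negAut f x = -x := by simp [negAut, hx]
  have h2 : (negAut f)⁻¹ x = -x := by
    change (negAut f).symm x = -x
    rw [LinearEquiv.symm_apply_eq, map_neg, h1, neg_neg]
  induction i using Int.induction_on with
  | zero => simp
  | succ n ih =>
    rw [add_comm, zpow_add, zpow_one, LinearEquiv.mul_apply, ih]
    by_cases h : Even (n : ℤ)
    · rw [if_pos h, if_neg (by rw [add_comm, Int.even_add_one]; simpa using h), h1]
    · rw [if_neg h, if_pos (by rw [add_comm, Int.even_add_one]; exact h), map_neg, h1, neg_neg]
  | pred n ih =>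
    rw [sub_eq_neg_add, zpow_add, zpow_neg_one, LinearEquiv.mul_apply, ih]
    by_cases h : Even (-(n : ℤ))
    · simp only [h, if_true, h2]
      rw [if_neg]
      rw [neg_add_eq_sub, Int.even_sub_one]; simpa using h
    · simp only [h, if_false, map_neg, h2, neg_neg]
      rw [if_pos]
      rw [neg_add_eq_sub, Int.even_sub_one]; simpa using h

/-- For `γ` fixed by `f`, the class `γ_*` in `H¹(-f, M)`: the image, under the map induced by
`γ : ℤ → M`, of the non-trivial element of `H¹(-1, ℤ) ≃ ℤ/2`, which is the class of the cocycle
taking the value `1` at odd and `0` at even integers. -/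
def starClass {M : Type u} [AddCommGroup M] (f : M ≃ₗ[ℤ] M) (γ : fixedBy f) : H1 (negAut f) :=
  QuotientAddGroup.mk ⟨fun i => if Even i then 0 else (γ : M), by
    refine ⟨fun i j => ?_, 2, by norm_num, fun i => ?_⟩
    · by_cases hi : Even i <;> by_cases hj : Even j <;>
        simp [hi, hj, Int.even_add, negAut_zpow_apply f γ.2]
    · simp⟩

/-! ### Quotients by 2 and the adjunction of a half -/

/-- The group `A / 2A`. -/
abbrev ModTwo (A : Type u) [AddCommGroup A] : Type u := A ⧸ (zsmulAddGroupHom (2 : ℤ) : A →+ A).range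

/-- The class of `a` in `A / 2A`. -/
def modTwo {A : Type u} [AddCommGroup A] (a : A) : ModTwo A := QuotientAddGroup.mk a

/-- The overgroup `A⟨a/2⟩ = (A ⊕ ℤ) / (a, -2)` of `A`. -/
abbrev AdjoinHalf {A : Type u} [AddCommGroup A] (a : A) : Type u :=
  (A × ℤ) ⧸ AddSubgroup.zmultiples ((a, -2) : A × ℤ)

/-- The inclusion of `A` in `A⟨a/2⟩`. -/
def AdjoinHalf.of {A : Type u} [AddCommGroup A] (a x : A) : AdjoinHalf a :=
  QuotientAddGroup.mk (x, 0)

/-! ### The chain of a walk -/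

open Classical in
/-- The 1-chain of a walk. -/
noncomputable def walkChain {V : Type u} {G : SimpleGraph V} :
    ∀ {u v : V}, G.Walk u v → V → V → ℤ
  | _, _, .nil => 0
  | u, _, .cons (v := w) _ p => fun a b =>
      (if a = u ∧ b = w then 1 else 0) - (if a = w ∧ b = u then 1 else 0) + walkChain p a b

open Classical in
theorem walkChain_spec {V : Type u} [Fintype V] {G : SimpleGraph V} {u v : V} (p : G.Walk u v) :
    (∀ a b, walkChain p b a = -walkChain p a b) ∧ (∀ a b, ¬ G.Adj a b → walkChain p a b = 0) ∧
    ∀ b, ∑ a, walkChain p a b = (if b = v then 1 else 0) - (if b = u then 1 else 0) := by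
  induction p with
  | nil => simp [walkChain]
  | @cons u w v h p ih =>
    obtain ⟨h1, h2, h3⟩ := ih
    refine ⟨fun a b => ?_, fun a b hab => ?_, fun b => ?_⟩
    · simp only [walkChain, h1 a b, and_comm]; ring
    · have e1 : ¬ (a = u ∧ b = w) := by rintro ⟨rfl, rfl⟩; exact hab h
      have e2 : ¬ (a = w ∧ b = u) := by rintro ⟨rfl, rfl⟩; exact hab h.symm
      simp [walkChain, h2 a b hab, e1, e2]
    · simp only [walkChain, Finset.sum_add_distrib, Finset.sum_sub_distrib, h3 b, ite_and]
      simp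

namespace MarkedBYTree

/-- The BY tree `(T, S, εF)`. -/
def unmarked (T : MarkedBYTree.{u}) (ε : ℤˣ) : BYTree.{u} where
  V := T.V
  graph := T.graph
  isTree := T.isTree
  len := T.len
  len_pos := T.len_pos
  S := T.S
  F := T.F
  F_len := T.F_len
  F_S := T.F_S
  ε := ε

theorem F_insert (T : MarkedBYTree.{u}) (v : T.V) :
    T.F v ∈ insert T.pt T.S ↔ v ∈ insert T.pt T.S := by
  have h : T.F v = T.pt ↔ v = T.pt := by
    conv_lhs => rw [← T.F_pt]
    exact T.F.injective.eq_iff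
  simp [Set.mem_insert_iff, T.F_S, h]

/-- The BY tree `(T, S ∪ {*}, εF)`. -/
def withMark (T : MarkedBYTree.{u}) (ε : ℤˣ) : BYTree.{u} where
  V := T.V
  graph := T.graph
  isTree := T.isTree
  len := T.len
  len_pos := T.len_pos
  S := insert T.pt T.S
  F := T.F
  F_len := T.F_len
  F_S := T.F_insert
  ε := ε

/-! ### The pipe -/

/-- The lattice `Λ = H₁(T, S ∪ {*}; ℤ)`. -/
abbrev Lam (T : MarkedBYTree.{u}) : Submodule ℤ (T.V → T.V → ℤ) := relH1 T.graph (insert T.pt T.S)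

/-- The sublattice `Σ = H₁(T, S; ℤ)` of `Λ`. -/
def Sig (T : MarkedBYTree.{u}) : Submodule ℤ T.Lam := (relH1 T.graph T.S).submoduleOf T.Lam

/-- The pairing map `Λ → Λ^∨`. -/
noncomputable abbrev pairing (T : MarkedBYTree.{u}) : T.Lam →ₗ[ℤ] Module.Dual ℤ T.Lam :=
  toDual T.graph T.len (insert T.pt T.S)

/-- The action of `F` on `Λ`. -/
noncomputable abbrev lamAut (T : MarkedBYTree.{u}) : T.Lam ≃ₗ[ℤ] T.Lam := latticeAut T.F T.F_insert 1

/-- The pipe `Π = Λ^∨ / Σ`. -/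
noncomputable abbrev Pipe (T : MarkedBYTree.{u}) : Type u := Module.Dual ℤ T.Lam ⧸ T.Sig.map T.pairing

/-- The action of `F` on the pipe. -/
noncomputable def pipeAut (T : MarkedBYTree.{u}) : T.Pipe ≃ₗ[ℤ] T.Pipe :=
  Submodule.Quotient.equiv _ _ (dualAut T.lamAut) (by
    ext φ
    constructor
    · rintro ⟨_, ⟨c, hc, rfl⟩, rfl⟩
      exact ⟨T.lamAut c, signedChain_mem T.F T.F_S 1 hc,
        (dualAut_toDual T.F T.F_len T.F_insert 1 c).symm⟩
    · rintro ⟨c, hc, rfl⟩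
      refine ⟨_, ⟨T.lamAut.symm c, ?_, rfl⟩, ?_⟩
      · exact signedChain_mem T.F.symm (fun v => by rw [← T.F_S]; simp) 1 hc
      · erw [dualAut_toDual T.F T.F_len T.F_insert 1]
        rw [LinearEquiv.apply_symm_apply])

theorem walkChain_mem (T : MarkedBYTree.{u}) {x : T.V} (hx : x ∈ T.S)
    (p : T.graph.Walk T.pt x) : walkChain p ∈ T.Lam := by
  classical
  obtain ⟨h1, h2, h3⟩ := walkChain_spec p
  refine ⟨h1, h2, fun v hv => ?_⟩
  rw [h3 v]
  have e1 : v ≠ x := by rintro rfl; exact hv (Or.inr hx)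
  have e2 : v ≠ T.pt := by rintro rfl; exact hv (Or.inl rfl)
  simp [e1, e2]

/-- The class in `Λ` of a walk from `*` to some vertex of `S`. -/
noncomputable def pathClass (T : MarkedBYTree.{u}) : T.Lam :=
  ⟨walkChain (T.isTree.1.preconnected T.pt T.S_nonempty.some).some,
    T.walkChain_mem T.S_nonempty.some_mem _⟩

/-- The sum-of-coordinates map on `Λ`. Under the identification `ℤ[S] ≃ Λ` sending `x ∈ S` to the
class of a path from `*` to `x`, the coordinate of a cycle at `x` is the coefficient at `x` of its
boundary. -/
noncomputable def coordSum (T : MarkedBYTree.{u}) : Module.Dual ℤ T.Lam where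
  toFun c := ∑ v, T.S.indicator (fun v => ∑ u, c.1 u v) v
  map_add' a b := by
    rw [← Finset.sum_add_distrib]
    refine Finset.sum_congr rfl fun v _ => ?_
    by_cases h : v ∈ T.S <;> simp [h, Finset.sum_add_distrib]
  map_smul' r a := by
    simp only [RingHom.id_apply, smul_eq_mul, Finset.mul_sum]
    refine Finset.sum_congr rfl fun v _ => ?_
    by_cases h : v ∈ T.S <;> simp [h, Finset.mul_sum]

/-- The element `y` of the pipe, the image of a class in `Λ` of a path from `*` to `S`. -/
noncomputable def yPipe (T : MarkedBYTree.{u}) : T.Pipe :=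
  Submodule.Quotient.mk (T.pairing T.pathClass)

/-- The element `η` of the pipe, the image of the sum-of-coordinates map. -/
noncomputable def etaPipe (T : MarkedBYTree.{u}) : T.Pipe := Submodule.Quotient.mk T.coordSum

theorem pipeAut_yPipe (T : MarkedBYTree.{u}) : T.pipeAut T.yPipe = T.yPipe := by
  classical
  change (Submodule.Quotient.mk (dualAut T.lamAut (T.pairing T.pathClass)) : T.Pipe) = _
  rw [yPipe, dualAut_toDual T.F T.F_len T.F_insert 1, Submodule.Quotient.eq, ← map_sub]
  refine ⟨_, ?_, rfl⟩
  set p := (T.isTree.1.preconnected T.pt T.S_nonempty.some).some with hp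
  have hc : ∀ b, ∑ a, T.pathClass.1 a b =
      (if b = T.S_nonempty.some then 1 else 0) - (if b = T.pt then 1 else 0) :=
    (walkChain_spec p).2.2
  have hmem := (T.lamAut T.pathClass - T.pathClass).2
  refine ⟨hmem.1, hmem.2.1, fun v hv => ?_⟩
  by_cases hv' : v = T.pt
  · subst hv'
    change ∑ u, (((1 : ℤˣ) : ℤ) * T.pathClass.1 (T.F.toEquiv.symm u) (T.F.toEquiv.symm T.pt)
      - T.pathClass.1 u T.pt) = 0
    have e : T.F.toEquiv.symm T.pt = T.pt := by
      rw [Equiv.symm_apply_eq]; exact T.F_pt.symm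
    rw [e, Finset.sum_sub_distrib, ← Finset.mul_sum,
      Equiv.sum_comp T.F.toEquiv.symm (fun u => T.pathClass.1 u T.pt)]
    simp
  · exact hmem.2.2 v (by rintro (h | h); exacts [hv' h, hv h])

theorem pipeAut_etaPipe (T : MarkedBYTree.{u}) : T.pipeAut T.etaPipe = T.etaPipe := by
  change (Submodule.Quotient.mk (dualAut T.lamAut T.coordSum) : T.Pipe) = _
  rw [etaPipe]
  congr 1
  ext1 c
  obtain ⟨c, rfl⟩ := T.lamAut.surjective c
  change T.coordSum (T.lamAut.symm (T.lamAut c)) = _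
  rw [LinearEquiv.symm_apply_apply]
  change ∑ v, T.S.indicator (fun v => ∑ u, c.1 u v) v =
    ∑ v, T.S.indicator (fun v => ∑ u, ((1 : ℤˣ) : ℤ) *
      c.1 (T.F.toEquiv.symm u) (T.F.toEquiv.symm v)) v
  refine Fintype.sum_equiv T.F.toEquiv _ _ fun v => ?_
  have h : T.F.toEquiv v ∈ T.S ↔ v ∈ T.S := T.F_S v
  by_cases hv : v ∈ T.S
  · rw [Set.indicator_of_mem hv, Set.indicator_of_mem (h.2 hv)]
    simp only [Units.val_one, one_mul, Equiv.symm_apply_apply]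
    exact (Equiv.sum_comp T.F.toEquiv.symm (fun u => c.1 u v)).symm
  · rw [Set.indicator_of_notMem hv, Set.indicator_of_notMem (fun h' => hv (h.1 h'))]

/-- The group `Π^F` of `F`-invariants of the pipe. -/
noncomputable abbrev piPlus (T : MarkedBYTree.{u}) : Submodule ℤ T.Pipe := fixedBy T.pipeAut

/-- The element `y` of `Π^F`. -/
noncomputable def y (T : MarkedBYTree.{u}) : T.piPlus := ⟨T.yPipe, T.pipeAut_yPipe⟩

/-- The element `η` of `Π^F`. -/
noncomputable def eta (T : MarkedBYTree.{u}) : T.piPlus := ⟨T.etaPipe, T.pipeAut_etaPipe⟩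

/-! ### The triple `(Π^{-F}, α, τ)` -/

/-- The group `Π^{-F}` of `-F`-invariants of the pipe. -/
noncomputable abbrev piMinus (T : MarkedBYTree.{u}) : Submodule ℤ T.Pipe := fixedBy (negAut T.pipeAut)

/-- The class `γ_*` in `H¹(-F, Π)` of an element `γ` of `Π^F`. -/
noncomputable abbrev cls (T : MarkedBYTree.{u}) (γ : T.piPlus) : H1 (negAut T.pipeAut) :=
  starClass T.pipeAut γ

open Classical in
/-- The type `τ`: it is `0` if `y_* = 0 ≠ η_*`, it is `1` if `η_* = 0 ≠ y_*`, and `2` otherwise. -/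
noncomputable def type (T : MarkedBYTree.{u}) : Fin 3 :=
  if T.cls T.y = 0 ∧ T.cls T.eta ≠ 0 then 0
  else if T.cls T.eta = 0 ∧ T.cls T.y ≠ 0 then 1
  else 2

/-- The element `γ = y`, `η`, `y + η` of `Π^F` according as `τ = 0`, `1`, `2`. -/
noncomputable def gam (T : MarkedBYTree.{u}) : T.piPlus :=
  if T.type = 0 then T.y else if T.type = 1 then T.eta else T.y + T.eta

theorem sub_mem_piMinus (T : MarkedBYTree.{u}) {β : T.Pipe} {γ : T.piPlus}
    (h : β + T.pipeAut β = γ) : β - T.pipeAut β ∈ T.piMinus := by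
  have h2 : T.pipeAut (γ : T.Pipe) = γ := γ.2
  rw [← h, map_add, add_comm β] at h2
  have h3 : T.pipeAut (T.pipeAut β) = β := add_left_cancel h2
  change -(T.pipeAut (β - T.pipeAut β)) = _
  rw [map_sub, h3]; abel

open Classical in
/-- The class `α ∈ Π^{-F} / 2Π^{-F}` of `(1 - F)β`, where `β` in the pipe is such that
`(1 + F)β = γ` (and `0` if there were no such `β`). -/
noncomputable def alpha (T : MarkedBYTree.{u}) : ModTwo T.piMinus :=
  if h : ∃ β : T.Pipe, β + T.pipeAut β = T.gam then
    modTwo ⟨h.choose - T.pipeAut h.choose, T.sub_mem_piMinus h.choose_spec⟩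
  else 0

/-- The triple `(Π^{-F}, α, τ)` of `T` is isomorphic to the triple consisting of the group `A`, the
class of `a` in `A / 2A`, and `t`. -/
def HasTriple (T : MarkedBYTree.{u}) (A : Type u) [AddCommGroup A] (a : A) (t : Fin 3) : Prop :=
  (∃ e : T.piMinus ≃+ A, ∀ x : T.piMinus, modTwo x = T.alpha → modTwo (e x) = modTwo a) ∧
    T.type = t

/-! ### Constructions of marked BY trees, up to isomorphism -/

/-- An embedding of metrised graphs that identifies `T₀` with a subtree of `T`. -/
structure Emb (T₀ T : MarkedBYTree.{u}) where
  toEmb : T₀.graph ↪g T.graph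
  len_eq : ∀ e ∈ T₀.graph.edgeSet, T.len (e.map toEmb) = T₀.len e

/-- `T` is a single edge of length `l` with endpoints `*` and the only element of `S`. -/
def IsEdge (T : MarkedBYTree.{u}) (l : ℕ) : Prop :=
  ∃ s ∈ T.S, T.graph.Adj T.pt s ∧ T.len s(T.pt, s) = l ∧ ∀ v, v = T.pt ∨ v = s

/-- `T = T₀^{(l)}`: an edge of length `l` is grafted onto `T₀` at its marked vertex, and the marked
vertex is shifted to the other end of this edge. -/
def IsGraft (T T₀ : MarkedBYTree.{u}) (l : ℕ) : Prop :=
  ∃ i : Emb T₀ T,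
    (∀ v, v = T.pt ∨ v ∈ Set.range i.toEmb) ∧ T.pt ∉ Set.range i.toEmb ∧
    (∀ w, T.graph.Adj T.pt w ↔ w = i.toEmb T₀.pt) ∧ T.len s(T.pt, i.toEmb T₀.pt) = l ∧
    T.S = i.toEmb '' T₀.S ∧ ∀ v, T.F (i.toEmb v) = i.toEmb (T₀.F v)

/-- `T = T₀ ∨ T₁`: the trees are joined at their marked vertices. -/
def IsWedge (T T₀ T₁ : MarkedBYTree.{u}) : Prop :=
  ∃ (i : Emb T₀ T) (j : Emb T₁ T),
    i.toEmb T₀.pt = T.pt ∧ j.toEmb T₁.pt = T.pt ∧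
    Set.range i.toEmb ∪ Set.range j.toEmb = Set.univ ∧
    Set.range i.toEmb ∩ Set.range j.toEmb = {T.pt} ∧
    (∀ v w, T.graph.Adj v w →
      (v ∈ Set.range i.toEmb ∧ w ∈ Set.range i.toEmb) ∨
      (v ∈ Set.range j.toEmb ∧ w ∈ Set.range j.toEmb)) ∧
    T.S = i.toEmb '' T₀.S ∪ j.toEmb '' T₁.S ∧
    (∀ v, T.F (i.toEmb v) = i.toEmb (T₀.F v)) ∧ ∀ v, T.F (j.toEmb v) = j.toEmb (T₁.F v)

/-- `T = ⋁ Ind T₀`, formed from `q` copies of `T₀` joined at their marked vertices, where `F` takes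
each copy to the next one (cyclically) and its `q`-fold composite acts on each copy as the
automorphism of `T₀`. If `i` is the inclusion of the copy with index `0`, then the inclusion of the
copy with index `k < q` is `F^k ∘ i`. -/
def IsInd (T T₀ : MarkedBYTree.{u}) (q : ℕ) : Prop :=
  0 < q ∧ ∃ i : Emb T₀ T,
    i.toEmb T₀.pt = T.pt ∧
    (∀ v, ∃ k < q, ∃ w, v = (T.F)^[k] (i.toEmb w)) ∧
    (∀ k, 0 < k → k < q → ∀ v w, (T.F)^[k] (i.toEmb v) = i.toEmb w → w = T₀.pt) ∧
    (∀ v w, T.graph.Adj v w →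
      ∃ k < q, ∃ v' w', v = (T.F)^[k] (i.toEmb v') ∧ w = (T.F)^[k] (i.toEmb w')) ∧
    (∀ v, i.toEmb v ∈ T.S ↔ v ∈ T₀.S) ∧
    ∀ v, (T.F)^[q] (i.toEmb v) = i.toEmb (T₀.F v)

/-- `T₀` is (isomorphic to) a marked BY subtree of `T` with `S₀ = S`. -/
def IsEnlargement (T T₀ : MarkedBYTree.{u}) : Prop :=
  ∃ i : Emb T₀ T, i.toEmb T₀.pt = T.pt ∧ T.S = i.toEmb '' T₀.S ∧
    ∀ v, T.F (i.toEmb v) = i.toEmb (T₀.F v)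

/-- The class of marked BY trees generated from single edges by the four constructions. -/
inductive Generated : MarkedBYTree.{u} → Prop
  | edge (T : MarkedBYTree.{u}) (l : ℕ) : T.IsEdge l → Generated T
  | graft (T T₀ : MarkedBYTree.{u}) (l : ℕ) : T.IsGraft T₀ l → Generated T₀ → Generated T
  | wedge (T T₀ T₁ : MarkedBYTree.{u}) :
      T.IsWedge T₀ T₁ → Generated T₀ → Generated T₁ → Generated T
  | ind (T T₀ : MarkedBYTree.{u}) (q : ℕ) : T.IsInd T₀ q → Generated T₀ → Generated T
  | enlarge (T T₀ : MarkedBYTree.{u}) : T.IsEnlargement T₀ → Generated T₀ → Generated T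

end MarkedBYTree

end BYTrees

namespace BYTrees

/-! ### The classes `γ_*` -/

/-! A class `γ_*` vanishes exactly when `γ` lies in the image of `1 + F`, so everything is about
solving `(1 + F)β = a y + b η` in the pipe and about anti-invariants, that is, elements with `F x =
-x`.

The pipe has a concrete presentation: it consists of the integral functions on `S` modulo the
vectors `G v` with `∑ v = 0`, where `G` is the matrix of Gromov products (lengths of common parts of
paths from the mark). In it `η` is the constant function `1` and `y` is any column of `G`
(`toPipe_gromov`, `exists_of_toPipe_eq_zero`). Hence the pipe with its automorphism depends only on
`G` and on the permutation of `S`. Grafting an edge of length `l` adds the constant `l` to `G`; this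
leaves the relations alone and turns `y` into `y + l η` (`exists_pipeMap_shift`). An enlargement
changes nothing. Joining trees at their marks makes `G` block diagonal, so the pipes are amalgamated
along their elements `y` (`exists_pipeMap_family`).

Anti-invariants of a quotient by an invariant element `γ` of infinite order are computed once and
for all. If `x + f x = n γ` with `n` even, then `x` can be corrected to an anti-invariant; an odd
`n` is possible only if `γ = (1 + f)β`. In that case `β` gives a new class in the quotient, twice
which is the class of `(1 - f)β`. Thus the anti-invariants of the quotient are the old ones,
possibly with one half adjoined (`exists_equiv_fixedBy_quotient`,
`exists_equiv_fixedBy_quotient_adjoinHalf`). The two Néron component groups are the cases of the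
pipe modulo `y` and modulo `η`; the wedge is the case of a direct sum modulo `(y₀, -y₁)`. For the
induced tree the anti-invariants are reached by the alternating sum `IsInducedPipe.theta`, on which
`1 + F` telescopes.

Every tree is generated from edges by induction on the number of vertices, by looking at the
branches at the mark and how `F` permutes them (`generated`). The trichotomy is then proved by
structural induction in the stronger form `IsType`, which describes all solvable pairs `(a, b)`
modulo 2. The class of `(1 - F)β` modulo 2 does not depend on `β`, because two solutions differ by
an anti-invariant `c`, for which `(1 - F)c = 2c`. So each rule for the triple is verified by one
isomorphism and one explicit solution `β` (`hasTriple_of`). -/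

theorem starClass_eq_zero_iff {M : Type u} [AddCommGroup M] (f : M ≃ₗ[ℤ] M) (γ : fixedBy f) :
    starClass f γ = 0 ↔ ∃ β : M, β + f β = γ := by
  rw [starClass, QuotientAddGroup.eq_zero_iff, AddSubgroup.mem_addSubgroupOf]
  constructor
  · rintro ⟨m, hm⟩
    have h := hm 1
    simp only [Int.not_even_one, if_false, zpow_one, negAut, LinearEquiv.trans_apply,
      LinearEquiv.neg_apply] at h
    exact ⟨-m, by rw [h, map_neg]; abel⟩
  · rintro ⟨β, hβ⟩
    refine ⟨-β, fun i => ?_⟩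
    have h1 : negAut f (-β) = -β + γ := by
      simp [negAut, ← hβ]
    have h2 : negAut f (γ : M) = -γ := by
      have : f (γ : M) = γ := γ.2
      simp [negAut, this]
    -- The square of `-f` fixes `-β`, so the coboundary of `-β` takes one value at all even integers
    -- and one at all odd ones, as the cocycle does.
    have h3 : ∀ k : ℤ, ((negAut f) ^ (2 * k)) (-β) = -β := by
      have h4 : ((negAut f) ^ (2 : ℤ)) (-β) = -β := by
        rw [show (2 : ℤ) = 1 + 1 by norm_num, zpow_add, zpow_one, LinearEquiv.mul_apply, h1,
          map_add, h1, h2]; abel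
      intro k
      rw [zpow_mul]
      induction k using Int.induction_on with
      | zero => simp
      | succ n ih => rw [zpow_add, zpow_one, LinearEquiv.mul_apply, h4, ih]
      | pred n ih =>
        rw [zpow_sub, zpow_one, LinearEquiv.mul_apply]
        have : ((negAut f ^ (2 : ℤ))⁻¹) (-β) = -β := by
          change (negAut f ^ (2 : ℤ)).symm (-β) = -β
          rw [LinearEquiv.symm_apply_eq, h4]
        rw [this, ih]
    rcases Int.even_or_odd i with hi | hi
    · obtain ⟨k, rfl⟩ := hi.two_dvd
      change (if Even (2 * k) then (0 : M) else γ) = _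
      rw [if_pos (even_two_mul k), h3, sub_self]
    · obtain ⟨k, rfl⟩ := hi
      change (if Even (2 * k + 1) then (0 : M) else γ) = _
      rw [if_neg (by simp), add_comm (2 * k), zpow_add, zpow_one, LinearEquiv.mul_apply, h3, h1]
      abel

theorem starClass_add {M : Type u} [AddCommGroup M] (f : M ≃ₗ[ℤ] M) (γ δ : fixedBy f) :
    starClass f (γ + δ) = starClass f γ + starClass f δ := by
  rw [starClass, starClass, starClass, ← QuotientAddGroup.mk_add]
  congr 1
  ext i
  change (if Even i then (0 : M) else γ + δ) =
    (if Even i then (0 : M) else γ) + (if Even i then (0 : M) else δ)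
  split <;> simp

theorem mem_fixedBy_negAut {M : Type u} [AddCommGroup M] (f : M ≃ₗ[ℤ] M) (x : M) :
    x ∈ fixedBy (negAut f) ↔ f x = -x := by
  change -(f x) = x ↔ _
  exact neg_eq_iff_eq_neg

theorem modTwo_eq_iff {A : Type u} [AddCommGroup A] {a b : A} :
    modTwo a = modTwo b ↔ ∃ c, b = a + (c + c) := by
  rw [modTwo, modTwo, QuotientAddGroup.eq]
  constructor
  · rintro ⟨c, hc⟩
    refine ⟨c, ?_⟩
    have : (2 : ℤ) • c = -a + b := hc
    rw [two_smul] at this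
    rw [this]; abel
  · rintro ⟨c, rfl⟩
    refine ⟨c, ?_⟩
    change (2 : ℤ) • c = _
    rw [two_smul]; abel

/-! ### Anti-invariants of a quotient by a cyclic subgroup -/

section Quotient

variable {M N A : Type u} [AddCommGroup M] [AddCommGroup N] [AddCommGroup A]
  {f : M ≃ₗ[ℤ] M} {γ : M} {ρ : M →ₗ[ℤ] N} {g : N ≃ₗ[ℤ] N} {j : A →+ M}

/-- If `γ` is not of the form `(1 + f)β`, then the invariants of `-f` on the quotient by the
infinite cyclic group generated by the `f`-invariant element `γ` are the invariants of `-f`. -/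
theorem exists_equiv_fixedBy_quotient (hγ : f γ = γ) (hinf : ∀ n : ℤ, n • γ = 0 → n = 0)
    (hρ : Function.Surjective ρ) (hργ : ρ γ = 0) (hker : ∀ x, ρ x = 0 → ∃ n : ℤ, x = n • γ)
    (hg : ∀ x, g (ρ x) = -ρ (f x)) (hj : Function.Injective j)
    (hjr : ∀ x, f x = -x ↔ ∃ a, j a = x) (hno : ¬ ∃ β, β + f β = γ) :
    ∃ e : A ≃+ fixedBy g, ∀ a, (e a : N) = ρ (j a) := by
  have hmem : ∀ a, ρ (j a) ∈ fixedBy g := fun a => by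
    change g _ = _
    rw [hg, (hjr (j a)).2 ⟨a, rfl⟩, map_neg, neg_neg]
  let h : A →+ fixedBy g := (ρ.toAddMonoidHom.comp j).codRestrict (fixedBy g) hmem
  have hh : ∀ a, (h a : N) = ρ (j a) := fun a => rfl
  refine ⟨AddEquiv.ofBijective h ⟨?_, ?_⟩, fun a => rfl⟩
  · refine (injective_iff_map_eq_zero h).2 fun a ha => ?_
    have ha' : ρ (j a) = 0 := by rw [← hh, ha]; rfl
    obtain ⟨n, hn⟩ := hker _ ha'
    have h1 := (hjr (j a)).2 ⟨a, rfl⟩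
    -- A multiple of `γ` is both invariant and, being in the image of `j`, anti-invariant; infinite
    -- order makes it zero.
    rw [hn, map_zsmul, hγ, ← sub_eq_zero, sub_neg_eq_add, ← add_smul] at h1
    have := hinf _ h1
    obtain rfl : n = 0 := by omega
    exact hj (by rw [hn, zero_smul, map_zero])
  · rintro ⟨z, hz⟩
    obtain ⟨x, rfl⟩ := hρ z
    have hz' : g (ρ x) = ρ x := hz
    rw [hg] at hz'
    obtain ⟨n, hn⟩ := hker (x + f x) (by rw [map_add]; nth_rewrite 1 [← hz']; abel)
    -- Subtracting `k γ` changes `x + f x` by `2k γ`: it leaves `0`, hence an anti-invariant, for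
    -- even `n`, and `γ`, hence a forbidden solution, for odd `n`.
    rcases Int.even_or_odd' n with ⟨k, rfl | rfl⟩
    · obtain ⟨a, ha⟩ := (hjr (x - k • γ)).1 (by
        rw [map_sub, map_zsmul, hγ, eq_sub_of_add_eq' hn, mul_smul, two_smul]; abel)
      refine ⟨a, Subtype.ext ?_⟩
      rw [hh, ha, map_sub, map_zsmul, hργ]; simp
    · refine absurd ⟨x - k • γ, ?_⟩ hno
      rw [map_sub, map_zsmul, hγ, eq_sub_of_add_eq' hn, add_smul, mul_smul, two_smul, one_smul]
      abel

/-- If `γ = (1 + f)β`, then the invariants of `-f` on the quotient by the infinite cyclic group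
generated by `γ` arise from the invariants of `-f` by adjoining a half of `(1 - f)β`. -/
theorem exists_equiv_fixedBy_quotient_adjoinHalf (hγ : f γ = γ)
    (hinf : ∀ n : ℤ, n • γ = 0 → n = 0)
    (hρ : Function.Surjective ρ) (hργ : ρ γ = 0) (hker : ∀ x, ρ x = 0 → ∃ n : ℤ, x = n • γ)
    (hg : ∀ x, g (ρ x) = -ρ (f x)) (hj : Function.Injective j)
    (hjr : ∀ x, f x = -x ↔ ∃ a, j a = x) {β : M} (hβ : β + f β = γ) {a : A}
    (ha : j a = β - f β) :
    ∃ e : AdjoinHalf a ≃+ fixedBy g, ∀ x, (e (AdjoinHalf.of a x) : N) = ρ (j x) := by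
  -- The formal half of `a` is sent to `β`; the relation `(a, -2)` becomes `(1 - f)β - 2β = -γ`,
  -- which dies in the quotient.
  let h0 : A × ℤ →+ M := j.coprod ((smulAddHom ℤ M).flip β)
  have hh0 : ∀ x k, h0 (x, k) = j x + k • β := fun x k => rfl
  have hβρ : ρ (f β) = -ρ β := by
    rw [← hβ, map_add] at hργ
    exact eq_neg_of_add_eq_zero_right hργ
  have hmem : ∀ p, ρ (h0 p) ∈ fixedBy g := by
    rintro ⟨x, k⟩
    change g _ = _
    rw [hg, hh0, map_add, map_add, (hjr (j x)).2 ⟨x, rfl⟩, map_zsmul, map_zsmul, hβρ, map_add,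
      map_neg, map_zsmul, smul_neg]
    abel
  have hle : AddSubgroup.zmultiples ((a, -2) : A × ℤ) ≤
      ((ρ.toAddMonoidHom.comp h0).codRestrict (fixedBy g) hmem).ker := by
    rw [AddSubgroup.zmultiples_le, AddMonoidHom.mem_ker]
    refine Subtype.ext ?_
    change ρ (h0 (a, -2)) = 0
    rw [hh0, ha, neg_smul, two_smul, show β - f β + -(β + β) = -γ by rw [← hβ]; abel, map_neg, hργ,
      neg_zero]
  let h : AdjoinHalf a →+ fixedBy g := QuotientAddGroup.lift _ _ hle
  have hh : ∀ p : A × ℤ, (h (QuotientAddGroup.mk p) : N) = ρ (h0 p) := fun p => rfl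
  refine ⟨AddEquiv.ofBijective h ⟨?_, ?_⟩, fun x => ?_⟩
  · refine (injective_iff_map_eq_zero h).2 fun q hq => ?_
    obtain ⟨⟨x, k⟩, rfl⟩ := QuotientAddGroup.mk_surjective q
    have hq' : ρ (h0 (x, k)) = 0 := by rw [← hh, hq]; rfl
    obtain ⟨n, hn⟩ := hker _ hq'
    rw [hh0] at hn
    -- Applying `1 + f` kills the anti-invariant part and compares the coefficients of `γ`, forcing
    -- `k = 2n`; the kernel element is then `-n` times the relation.
    have h1 : j x + f (j x) + k • (β + f β) = (2 * n) • γ := by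
      rw [two_mul, add_smul]
      nth_rewrite 2 [← hγ]
      rw [← map_zsmul f, ← hn, map_add, map_zsmul, smul_add]; abel
    rw [(hjr (j x)).2 ⟨x, rfl⟩, hβ, add_neg_cancel, zero_add, ← sub_eq_zero, ← sub_smul] at h1
    have h2 := hinf _ h1
    obtain rfl : k = 2 * n := by omega
    rw [QuotientAddGroup.eq_zero_iff, AddSubgroup.mem_zmultiples_iff]
    refine ⟨-n, ?_⟩
    rw [Prod.smul_mk, Prod.mk.injEq]
    refine ⟨hj ?_, by simp; ring⟩
    rw [map_zsmul, ha, eq_sub_of_add_eq hn, ← hβ, mul_smul, two_smul]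
    simp only [neg_smul, smul_sub, smul_add]
    abel
  · rintro ⟨z, hz⟩
    obtain ⟨x, rfl⟩ := hρ z
    have hz' : g (ρ x) = ρ x := hz
    rw [hg] at hz'
    obtain ⟨n, hn⟩ := hker (x + f x) (by rw [map_add]; nth_rewrite 1 [← hz']; abel)
    obtain ⟨b, hb⟩ := (hjr (x - n • β)).1 (by
        rw [map_sub, map_zsmul, eq_sub_of_add_eq' hn, eq_sub_of_add_eq' hβ, smul_sub]; abel)
    refine ⟨QuotientAddGroup.mk (b, n), Subtype.ext ?_⟩
    rw [hh, hh0, hb]; simp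
  · change ρ (h0 (x, 0)) = _
    rw [hh0]; simp

end Quotient

/-! ### Chains on a tree -/

section Chains

variable {V : Type u} {G : SimpleGraph V}

theorem sum_sum_eq_zero {c : V → V → ℤ} (hc : ∀ u v, c v u = -c u v) (A : Finset V) :
    ∑ v ∈ A, ∑ u ∈ A, c u v = 0 := by
  have h : ∑ v ∈ A, ∑ u ∈ A, c u v = -∑ v ∈ A, ∑ u ∈ A, c u v := by
    conv_lhs => rw [Finset.sum_comm]
    simp only [← Finset.sum_neg_distrib]
    exact Finset.sum_congr rfl fun u _ => Finset.sum_congr rfl fun v _ => hc v u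
  omega

theorem walkChain_cons {u v w : V} (h : G.Adj u v) (p : G.Walk v w) :
    walkChain (.cons h p) = walkChain (.cons h (.nil : G.Walk v v)) + walkChain p := by
  classical
  funext a b
  simp [walkChain]
variable [Fintype V]

theorem relH1_mono {A B : Set V} (h : A ⊆ B) : relH1 G A ≤ relH1 G B :=
  fun _ hc => ⟨hc.1, hc.2.1, fun v hv => hc.2.2 v fun hA => hv (h hA)⟩

open Classical in
/-- On a tree, the multiplicity of an edge in a chain is the sum of the boundary coefficients over
one of the two sides of the edge. -/
theorem chain_eq_sum_boundary (hG : G.IsAcyclic) {c : V → V → ℤ} (hc : c ∈ relH1 G Set.univ)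
    {u v : V} (huv : G.Adj u v) :
    c u v = ∑ w ∈ Finset.univ.filter (fun w => (G.deleteEdges {s(u, v)}).Reachable v w),
      ∑ x, c x w := by
  set A := Finset.univ.filter (fun w => (G.deleteEdges {s(u, v)}).Reachable v w) with hA
  -- Every edge of an acyclic graph is a bridge, so `u` is on the other side, and the edge from `u`
  -- to `v` is the only one crossing between the sides.
  have hu : u ∉ A := fun h => (SimpleGraph.isAcyclic_iff_forall_adj_isBridge.1 hG huv)
    ((Finset.mem_filter.1 h).2.symm)
  have hv : v ∈ A := Finset.mem_filter.2 ⟨Finset.mem_univ _, SimpleGraph.Reachable.refl _⟩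
  have key : ∀ w ∈ A, ∀ x ∉ A, c x w ≠ 0 → x = u ∧ w = v := by
    intro w hw x hx hne
    have hadj : G.Adj x w := by_contra fun h => hne (hc.2.1 x w h)
    by_cases he : s(x, w) = s(u, v)
    · rcases Sym2.eq_iff.1 he with h | ⟨rfl, rfl⟩
      · exact h
      · exact absurd hw hu
    · refine absurd ?_ hx
      have h' : (G.deleteEdges {s(u, v)}).Adj w x := by
        rw [SimpleGraph.deleteEdges_adj]
        exact ⟨hadj.symm, by rwa [Set.mem_singleton_iff, Sym2.eq_swap]⟩
      exact Finset.mem_filter.2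
        ⟨Finset.mem_univ _, (Finset.mem_filter.1 hw).2.trans h'.reachable⟩
  have hsplit : ∀ w, ∑ x, c x w = ∑ x ∈ A, c x w + ∑ x ∈ Aᶜ, c x w := fun w =>
    (Finset.sum_add_sum_compl A _).symm
  -- Edges inside `A` cancel by antisymmetry, leaving only the crossing edge.
  rw [Finset.sum_congr rfl fun w _ => hsplit w, Finset.sum_add_distrib, sum_sum_eq_zero hc.1,
    zero_add, Finset.sum_eq_single v, Finset.sum_eq_single u]
  · intro x hx hxu
    by_contra h
    exact hxu (key v hv x (by simpa using hx) h).1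
  · intro h; exact absurd (by simpa using hu) h
  · intro w hw hwv
    refine Finset.sum_eq_zero fun x hx => ?_
    by_contra h
    exact hwv (key w hw x (by simpa using hx) h).2
  · intro h; exact absurd hv h

/-- A chain on a tree is determined by the coefficients of its boundary outside one vertex. -/
theorem chain_ext (hG : G.IsAcyclic) {c d : V → V → ℤ} (hc : c ∈ relH1 G Set.univ)
    (hd : d ∈ relH1 G Set.univ) (p : V) (h : ∀ v, v ≠ p → ∑ u, c u v = ∑ u, d u v) : c = d := by
  classical
  have hp : ∀ v, ∑ u, (c - d) u v = 0 := by
    have h0 : ∀ v, v ≠ p → ∑ u, (c - d) u v = 0 := fun v hv => by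
      simp only [Pi.sub_apply, Finset.sum_sub_distrib, h v hv, sub_self]
    intro v
    by_cases hv : v = p
    · subst hv
      -- The boundary coefficients add up to zero, so the one at `p` vanishes together with all the
      -- others.
      have := sum_sum_eq_zero ((relH1 G Set.univ).sub_mem hc hd).1 Finset.univ
      rwa [Finset.sum_eq_single v (fun w _ hw => h0 w hw) (by simp)] at this
    · exact h0 v hv
  have hcd := (relH1 G Set.univ).sub_mem hc hd
  rw [← sub_eq_zero]
  funext u v
  by_cases huv : G.Adj u v
  · rw [chain_eq_sum_boundary hG hcd huv]
    exact Finset.sum_eq_zero fun w _ => hp w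
  · exact hcd.2.1 u v huv

variable (G) in
theorem lengthPairing_comm (len : Sym2 V → ℕ) (c d : V → V → ℤ) :
    lengthPairing G len c d = lengthPairing G len d c :=
  Finset.sum_congr rfl fun e _ => by ring

/-- Positive definiteness: the self-pairing is a sum of squares weighted by positive lengths. -/
theorem eq_zero_of_lengthPairing_self {len : Sym2 V → ℕ} (hlen : ∀ e ∈ G.edgeSet, 0 < len e)
    {c : V → V → ℤ} (hc : c ∈ relH1 G Set.univ) (h : lengthPairing G len c c = 0) : c = 0 := by
  classical
  have h1 := (Finset.sum_eq_zero_iff_of_nonneg (fun e _ => mul_nonneg (Int.natCast_nonneg _)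
    (mul_self_nonneg _))).1 h
  funext u v
  by_cases huv : G.Adj u v
  · have h2 := h1 s(u, v) (by simpa using huv)
    have h3 := (hlen s(u, v) huv).ne'
    rw [out_mul hc.1 hc.1] at h2
    simpa [h3] using h2
  · exact hc.2.1 u v huv

/-- Twice the length pairing as a sum over oriented edges. -/
theorem two_mul_lengthPairing (len : Sym2 V → ℕ) {c d : V → V → ℤ} (hc : c ∈ relH1 G Set.univ)
    (hd : d ∈ relH1 G Set.univ) :
    2 * lengthPairing G len c d = ∑ u, ∑ v, (len s(u, v) : ℤ) * (c u v * d u v) := by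
  classical
  rw [← Fintype.sum_prod_type' (f := fun u v => (len s(u, v) : ℤ) * (c u v * d u v)),
    ← Finset.sum_filter_of_ne (p := fun q : V × V => G.Adj q.1 q.2)
      (by rintro ⟨u, v⟩ _ h; by_contra h'; exact h (by simp [hc.2.1 u v h'])),
    ← Finset.sum_fiberwise_of_maps_to (t := G.edgeFinset) (g := fun q : V × V => s(q.1, q.2))
      (by rintro ⟨u, v⟩ h; simpa using h)]
  change 2 * ∑ e ∈ G.edgeFinset, (len e : ℤ) *
    (c (Quot.out e).1 (Quot.out e).2 * d (Quot.out e).1 (Quot.out e).2) = _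
  rw [Finset.mul_sum]
  refine Finset.sum_congr rfl fun e he => ?_
  induction e with
  | _ u v =>
    have huv : G.Adj u v := by simpa using he
    have hset : (Finset.univ.filter (fun q : V × V => G.Adj q.1 q.2)).filter
        (fun q => s(q.1, q.2) = s(u, v)) = {(u, v), (v, u)} := by
      ext ⟨a, b⟩
      simp only [Finset.mem_filter, Finset.mem_univ, true_and, Finset.mem_insert,
        Finset.mem_singleton, Prod.mk.injEq, Sym2.eq_iff]
      constructor
      · exact fun h => h.2
      · rintro (⟨rfl, rfl⟩ | ⟨rfl, rfl⟩)
        · exact ⟨huv, Or.inl ⟨rfl, rfl⟩⟩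
        · exact ⟨huv.symm, Or.inr ⟨rfl, rfl⟩⟩
    rw [out_mul hc.1 hd.1, hset, Finset.sum_pair (by
      intro h; exact huv.ne (Prod.mk.inj h).1)]
    simp only [hc.1 u v, hd.1 u v, Sym2.eq_swap (a := v)]
    ring

theorem walkChain_mem_univ {u v : V} (p : G.Walk u v) : walkChain p ∈ relH1 G Set.univ :=
  ⟨(walkChain_spec p).1, (walkChain_spec p).2.1, fun v hv => absurd (Set.mem_univ v) hv⟩

/-- Both chains have the endpoint minus the starting point as boundary. This frees later arguments
from the arbitrary choice of a walk in `pathChain`. -/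
theorem walkChain_unique (hG : G.IsAcyclic) {u v : V} (p q : G.Walk u v) :
    walkChain p = walkChain q := by
  classical
  refine chain_ext hG (walkChain_mem_univ p) (walkChain_mem_univ q) u fun w _ => ?_
  rw [(walkChain_spec p).2.2, (walkChain_spec q).2.2]

/-- The pairing of the chain of a walk of length one with another chain. -/
theorem lengthPairing_walkChain_single (len : Sym2 V → ℕ) {u v : V} (h : G.Adj u v)
    {d : V → V → ℤ} (hd : d ∈ relH1 G Set.univ) :
    lengthPairing G len (walkChain (SimpleGraph.Walk.cons h .nil)) d = len s(u, v) * d u v := by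
  classical
  have hc := walkChain_mem_univ (SimpleGraph.Walk.cons h (.nil : G.Walk v v))
  change ∑ e ∈ G.edgeFinset, (len e : ℤ) * _ = _
  rw [Finset.sum_eq_single s(u, v)]
  · rw [out_mul hc.1 hd.1]
    simp [walkChain, h.ne]
  · intro e _ hne
    induction e with
    | _ a b =>
      rw [out_mul hc.1 hd.1]
      have h1 : ¬ (a = u ∧ b = v) := by rintro ⟨rfl, rfl⟩; exact hne rfl
      have h2 : ¬ (a = v ∧ b = u) := by rintro ⟨rfl, rfl⟩; exact hne Sym2.eq_swap
      simp [walkChain, h1, h2]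
  · intro h'; exact absurd (by simpa using h) h'

end Chains

/-! ### Chains of walks under embeddings -/

section Map

variable {V W : Type u} {G : SimpleGraph V} {H : SimpleGraph W} (i : G ↪g H)

theorem walkChain_map_apply {u v : V} (p : G.Walk u v) (a b : V) :
    walkChain (p.map i.toHom) (i a) (i b) = walkChain p a b := by
  classical
  induction p with
  | nil => rfl
  | cons h p ih =>
    change _ + walkChain (p.map i.toHom) (i a) (i b) = _ + walkChain p a b
    rw [ih]
    simp

theorem walkChain_map_eq_zero {u v : V} (p : G.Walk u v) {a b : W}
    (h : ¬ (a ∈ Set.range i ∧ b ∈ Set.range i)) : walkChain (p.map i.toHom) a b = 0 := by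
  classical
  induction p with
  | nil => rfl
  | @cons u v w hu p ih =>
    change _ + walkChain (p.map i.toHom) a b = 0
    rw [ih]
    have h1 : ¬ (a = i u ∧ b = i v) := by rintro ⟨rfl, rfl⟩; exact h ⟨⟨u, rfl⟩, ⟨v, rfl⟩⟩
    have h2 : ¬ (a = i v ∧ b = i u) := by rintro ⟨rfl, rfl⟩; exact h ⟨⟨v, rfl⟩, ⟨u, rfl⟩⟩
    simp [h1, h2]

theorem lengthPairing_map [Fintype V] [Fintype W] {len : Sym2 V → ℕ} {len' : Sym2 W → ℕ}
    (hlen : ∀ e ∈ G.edgeSet, len' (e.map i) = len e) {u v u' v' : V} (p : G.Walk u v)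
    (q : G.Walk u' v') :
    lengthPairing H len' (walkChain (p.map i.toHom)) (walkChain (q.map i.toHom)) =
      lengthPairing G len (walkChain p) (walkChain q) := by
  -- The doubled sums over ordered pairs are compared, because the chosen orientations of the edges
  -- need not correspond under the embedding.
  have h := two_mul_lengthPairing len' (walkChain_mem_univ (p.map i.toHom))
    (walkChain_mem_univ (q.map i.toHom))
  have h' := two_mul_lengthPairing len (walkChain_mem_univ p) (walkChain_mem_univ q)
  suffices hs : ∑ u, ∑ v, (len s(u, v) : ℤ) * (walkChain p u v * walkChain q u v) =
      ∑ u, ∑ v, (len' s(u, v) : ℤ) *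
        (walkChain (p.map i.toHom) u v * walkChain (q.map i.toHom) u v) by
    rw [← hs] at h; omega
  refine Fintype.sum_of_injective i i.injective _ _ (fun a ha => ?_) fun a => ?_
  · refine Finset.sum_eq_zero fun b _ => ?_
    rw [walkChain_map_eq_zero i p fun h => ha h.1]; ring
  · refine Fintype.sum_of_injective i i.injective _ _ (fun b hb => ?_) fun b => ?_
    · rw [walkChain_map_eq_zero i p fun h => hb h.2]; ring
    · rw [walkChain_map_apply, walkChain_map_apply]
      by_cases hab : G.Adj a b
      · rw [← hlen s(a, b) hab]; rfl
      · simp [(walkChain_spec p).2.1 a b hab]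

/-- An edge has two ends, so images sharing at most one vertex have no common edge. -/
theorem lengthPairing_map_map_eq_zero {V' : Type u} {G' : SimpleGraph V'} (j : G' ↪g H)
    [Fintype W] (len : Sym2 W → ℕ) {w : W} (hij : Set.range i ∩ Set.range j ⊆ {w}) {u v : V}
    {u' v' : V'} (p : G.Walk u v) (q : G'.Walk u' v') :
    lengthPairing H len (walkChain (p.map i.toHom)) (walkChain (q.map j.toHom)) = 0 := by
  have h := two_mul_lengthPairing len (walkChain_mem_univ (p.map i.toHom))
    (walkChain_mem_univ (q.map j.toHom))
  have : ∑ u, ∑ v, (len s(u, v) : ℤ) *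
      (walkChain (p.map i.toHom) u v * walkChain (q.map j.toHom) u v) = 0 := by
    refine Finset.sum_eq_zero fun a _ => Finset.sum_eq_zero fun b _ => ?_
    by_cases h1 : a ∈ Set.range i ∧ b ∈ Set.range i
    · by_cases h2 : a ∈ Set.range j ∧ b ∈ Set.range j
      · have e1 : a = w := hij ⟨h1.1, h2.1⟩
        have e2 : b = w := hij ⟨h1.2, h2.2⟩
        rw [e1, e2, (walkChain_spec (p.map i.toHom)).2.1 w w H.irrefl]; ring
      · rw [walkChain_map_eq_zero j q h2]; ring
    · rw [walkChain_map_eq_zero i p h1]; ring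
  rw [this] at h
  omega

end Map

namespace MarkedBYTree

/-! ### The pipe in coordinates -/

open Classical in
/-- The set `S` as a finset. -/
noncomputable def sfin (T : MarkedBYTree.{u}) : Finset T.V := Finset.univ.filter (· ∈ T.S)

theorem mem_sfin (T : MarkedBYTree.{u}) {v : T.V} : v ∈ T.sfin ↔ v ∈ T.S := by simp [sfin]

/-- The chain of a path from `*` to `v`. -/
noncomputable def pathChain (T : MarkedBYTree.{u}) (v : T.V) : T.V → T.V → ℤ :=
  walkChain (T.isTree.1.preconnected T.pt v).some

theorem pathChain_eq (T : MarkedBYTree.{u}) {v : T.V} (p : T.graph.Walk T.pt v) :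
    T.pathChain v = walkChain p := walkChain_unique T.isTree.2 _ _

open Classical in
/-- The class in `Λ` of a path from `*` to `v`, or zero if `v ∉ S`. -/
noncomputable def pathLam (T : MarkedBYTree.{u}) (v : T.V) : T.Lam :=
  if h : v ∈ T.S then ⟨T.pathChain v, T.walkChain_mem h _⟩ else 0

theorem pathLam_coe (T : MarkedBYTree.{u}) {v : T.V} (h : v ∈ T.S) :
    (T.pathLam v : T.V → T.V → ℤ) = T.pathChain v := by
  rw [pathLam, dif_pos h]

theorem lam_mem_univ (T : MarkedBYTree.{u}) (c : T.Lam) : c.1 ∈ relH1 T.graph Set.univ :=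
  relH1_mono (Set.subset_univ _) c.2

open Classical in
theorem pathLam_boundary (T : MarkedBYTree.{u}) {t v : T.V} (ht : t ∈ T.S) (hv : v ≠ T.pt) :
    ∑ u, (T.pathLam t).1 u v = if v = t then 1 else 0 := by
  rw [pathLam_coe T ht, pathChain, (walkChain_spec _).2.2, if_neg hv, sub_zero]

theorem ne_pt (T : MarkedBYTree.{u}) {s : T.V} (hs : s ∈ T.S) : s ≠ T.pt := by
  rintro rfl; exact T.pt_notMem hs

/-- This is the identification of `Λ` with `ℤ[S]`: both sides have the same boundary away from the
mark, which determines a chain on a tree. -/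
theorem eq_sum_pathLam (T : MarkedBYTree.{u}) (c : T.Lam) :
    c = ∑ t ∈ T.sfin, (∑ u, c.1 u t) • T.pathLam t := by
  classical
  refine Subtype.ext (chain_ext T.isTree.2 (T.lam_mem_univ _) (T.lam_mem_univ _) T.pt
    fun v hv => ?_)
  have h : ∀ u, (∑ t ∈ T.sfin, (∑ u, c.1 u t) • T.pathLam t).1 u v =
      ∑ t ∈ T.sfin, (∑ u, c.1 u t) * (T.pathLam t).1 u v := fun u => by
    simp [Finset.sum_apply]
  have h' : ∀ t ∈ T.sfin, ∑ u, (∑ u, c.1 u t) * (T.pathLam t).1 u v =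
      if v = t then ∑ u, c.1 u t else 0 := fun t ht => by
    rw [← Finset.mul_sum, T.pathLam_boundary (T.mem_sfin.1 ht) hv, mul_ite, mul_one, mul_zero]
  rw [Finset.sum_congr rfl fun u _ => h u, Finset.sum_comm, Finset.sum_congr rfl h',
    Finset.sum_ite_eq]
  split_ifs with hvS
  · rfl
  · refine c.2.2.2 v ?_
    rintro (h | h)
    exacts [hv h, hvS (T.mem_sfin.2 h)]

/-- Functionals on `Λ` are equal if they agree on the classes of paths. -/
theorem dual_ext (T : MarkedBYTree.{u}) {φ ψ : Module.Dual ℤ T.Lam}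
    (h : ∀ s ∈ T.S, φ (T.pathLam s) = ψ (T.pathLam s)) : φ = ψ := by
  ext c
  rw [T.eq_sum_pathLam c, map_sum, map_sum]
  exact Finset.sum_congr rfl fun t ht => by rw [map_smul, map_smul, h t (T.mem_sfin.1 ht)]

/-- The functional on `Λ` with given values on the classes of paths from `*` to elements of `S`. -/
noncomputable def coord (T : MarkedBYTree.{u}) : (T.V → ℤ) →ₗ[ℤ] Module.Dual ℤ T.Lam :=
  LinearMap.mk₂ ℤ (fun w c => ∑ t ∈ T.sfin, w t * ∑ u, c.1 u t)
    (fun a b c => by simp [add_mul, Finset.sum_add_distrib])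
    (fun r a c => by simp [Finset.mul_sum, mul_assoc])
    (fun a b c => by simp [mul_add, Finset.sum_add_distrib])
    (fun r a c => by
      simp only [smul_eq_mul, Finset.mul_sum]
      exact Finset.sum_congr rfl fun t _ => Finset.sum_congr rfl fun u _ => by
        change a t * (r * c.1 u t) = r * (a t * c.1 u t)
        ring)

theorem coord_apply (T : MarkedBYTree.{u}) (w : T.V → ℤ) (c : T.Lam) :
    T.coord w c = ∑ t ∈ T.sfin, w t * ∑ u, c.1 u t := rfl

theorem coord_pathLam (T : MarkedBYTree.{u}) (w : T.V → ℤ) {s : T.V} (hs : s ∈ T.S) :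
    T.coord w (T.pathLam s) = w s := by
  classical
  rw [coord_apply, Finset.sum_congr rfl fun t ht => by
    rw [T.pathLam_boundary hs (T.ne_pt (T.mem_sfin.1 ht)), mul_ite, mul_one, mul_zero]]
  rw [Finset.sum_ite_eq', if_pos (T.mem_sfin.2 hs)]

/-- The element of the pipe with given coordinates. -/
noncomputable def toPipe (T : MarkedBYTree.{u}) : (T.V → ℤ) →ₗ[ℤ] T.Pipe :=
  (T.Sig.map T.pairing).mkQ ∘ₗ T.coord

/-- The length of the common part of the paths from `*` to two vertices. -/
noncomputable def gromov (T : MarkedBYTree.{u}) (s t : T.V) : ℤ :=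
  lengthPairing T.graph T.len (T.pathChain s) (T.pathChain t)

theorem pairing_pathLam (T : MarkedBYTree.{u}) {s t : T.V} (hs : s ∈ T.S) (ht : t ∈ T.S) :
    T.pairing (T.pathLam s) (T.pathLam t) = T.gromov s t := by
  change lengthPairing _ _ (T.pathLam s).1 (T.pathLam t).1 = _
  rw [T.pathLam_coe hs, T.pathLam_coe ht]; rfl

theorem coordSum_eq (T : MarkedBYTree.{u}) : T.coordSum = T.coord 1 := by
  classical
  ext c
  rw [coord_apply, sfin, Finset.sum_filter]
  refine Finset.sum_congr rfl fun v _ => ?_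
  by_cases h : v ∈ T.S <;> simp [h]

theorem coordSum_pathLam (T : MarkedBYTree.{u}) {s : T.V} (hs : s ∈ T.S) :
    T.coordSum (T.pathLam s) = 1 := by
  rw [coordSum_eq, T.coord_pathLam _ hs, Pi.one_apply]

/-- The boundary coefficients of a chain sum to zero, so the one at the mark is minus the sum of
those on `S`. -/
theorem mem_sig (T : MarkedBYTree.{u}) (c : T.Lam) : c ∈ T.Sig ↔ T.coordSum c = 0 := by
  classical
  have h0 := sum_sum_eq_zero c.2.1 Finset.univ
  have h1 : ∑ v, ∑ u, c.1 u v = T.coordSum c + ∑ u, c.1 u T.pt := by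
    rw [coordSum_eq, coord_apply]
    simp only [Pi.one_apply, one_mul]
    have : ∑ v ∈ insert T.pt T.sfin, ∑ u, c.1 u v = ∑ v, ∑ u, c.1 u v := by
      refine Finset.sum_subset (Finset.subset_univ _) fun v _ hv => c.2.2.2 v ?_
      rintro (h | h)
      · exact hv (Finset.mem_insert.2 (Or.inl h))
      · exact hv (Finset.mem_insert_of_mem (T.mem_sfin.2 h))
    rw [← this, Finset.sum_insert (fun h => T.pt_notMem (T.mem_sfin.1 h)), add_comm]
  rw [h0] at h1
  constructor
  · intro h
    have := (show c.1 ∈ relH1 T.graph T.S from h).2.2 T.pt T.pt_notMem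
    omega
  · intro h
    refine ⟨c.2.1, c.2.2.1, fun v hv => ?_⟩
    by_cases hv' : v = T.pt
    · subst hv'
      change ∑ u, c.1 u T.pt = 0
      omega
    · exact c.2.2.2 v (by rintro (h | h); exacts [hv' h, hv h])

theorem pairing_eq_zero (T : MarkedBYTree.{u}) {c : T.Lam} (h : T.pairing c c = 0) : c = 0 :=
  Subtype.ext (eq_zero_of_lengthPairing_self T.len_pos (T.lam_mem_univ c) h)

theorem pairing_injective (T : MarkedBYTree.{u}) : Function.Injective T.pairing :=
  (injective_iff_map_eq_zero _).2 fun c h => T.pairing_eq_zero (by rw [h]; rfl)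

theorem toPipe_surjective (T : MarkedBYTree.{u}) : Function.Surjective T.toPipe := by
  intro z
  obtain ⟨φ, rfl⟩ := Submodule.Quotient.mk_surjective _ z
  refine ⟨fun v => φ (T.pathLam v), ?_⟩
  change Submodule.Quotient.mk (T.coord _) = _
  congr 1
  exact T.dual_ext fun s hs => T.coord_pathLam _ hs

theorem toPipe_congr (T : MarkedBYTree.{u}) {w w' : T.V → ℤ} (h : ∀ s ∈ T.S, w s = w' s) :
    T.toPipe w = T.toPipe w' := by
  change Submodule.Quotient.mk (T.coord _) = Submodule.Quotient.mk (T.coord _)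
  congr 1
  exact T.dual_ext fun s hs => by rw [T.coord_pathLam _ hs, T.coord_pathLam _ hs, h s hs]

theorem toPipe_one (T : MarkedBYTree.{u}) : T.toPipe 1 = T.etaPipe := by
  rw [etaPipe, coordSum_eq]; rfl

/-- After subtracting the right multiple of a path class, `c` has coordinate sum zero and lies in
`Σ`. So `Λ` has cyclic image in the pipe, generated by `y`. -/
theorem mk_pairing (T : MarkedBYTree.{u}) (c : T.Lam) :
    (Submodule.Quotient.mk (T.pairing c) : T.Pipe) = T.coordSum c • T.yPipe := by
  rw [yPipe, ← Submodule.Quotient.mk_smul, Submodule.Quotient.eq, ← map_smul, ← map_sub]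
  refine ⟨_, ?_, rfl⟩
  have h : T.pathClass = T.pathLam T.S_nonempty.some := by
    rw [pathLam, dif_pos T.S_nonempty.some_mem]; rfl
  rw [SetLike.mem_coe, mem_sig, map_sub, map_smul, h, T.coordSum_pathLam T.S_nonempty.some_mem]
  simp

theorem pairing_eq_coord (T : MarkedBYTree.{u}) (v : T.V → ℤ) :
    T.pairing (∑ t ∈ T.sfin, v t • T.pathLam t) =
      T.coord fun s => ∑ t ∈ T.sfin, T.gromov s t * v t := by
  refine T.dual_ext fun s hs => ?_
  rw [T.coord_pathLam _ hs, map_sum, LinearMap.sum_apply]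
  refine Finset.sum_congr rfl fun t ht => ?_
  rw [map_smul, LinearMap.smul_apply, T.pairing_pathLam (T.mem_sfin.1 ht) hs, gromov,
    lengthPairing_comm, smul_eq_mul, mul_comm]; rfl

theorem coordSum_sum_pathLam (T : MarkedBYTree.{u}) (v : T.V → ℤ) :
    T.coordSum (∑ t ∈ T.sfin, v t • T.pathLam t) = ∑ t ∈ T.sfin, v t := by
  rw [map_sum]
  exact Finset.sum_congr rfl fun t ht => by
    rw [map_smul, T.coordSum_pathLam (T.mem_sfin.1 ht), smul_eq_mul, mul_one]

theorem toPipe_gromov (T : MarkedBYTree.{u}) (v : T.V → ℤ) :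
    T.toPipe (fun s => ∑ t ∈ T.sfin, T.gromov s t * v t) = (∑ t ∈ T.sfin, v t) • T.yPipe := by
  rw [← T.coordSum_sum_pathLam, ← mk_pairing, pairing_eq_coord]; rfl

theorem toPipe_gromov_single (T : MarkedBYTree.{u}) {t : T.V} (ht : t ∈ T.S) :
    T.toPipe (fun s => T.gromov s t) = T.yPipe := by
  classical
  have h := T.toPipe_gromov (fun v => if v = t then 1 else 0)
  simpa [T.mem_sfin, ht] using h

/-- With `toPipe_gromov` this presents the pipe by the matrix of Gromov products alone, which is how
pipes of different trees are compared. -/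
theorem exists_of_toPipe_eq_zero (T : MarkedBYTree.{u}) {w : T.V → ℤ} (h : T.toPipe w = 0) :
    ∃ v : T.V → ℤ, ∑ t ∈ T.sfin, v t = 0 ∧
      ∀ s ∈ T.S, w s = ∑ t ∈ T.sfin, T.gromov s t * v t := by
  obtain ⟨c, hc, hcw⟩ := (Submodule.Quotient.mk_eq_zero _).1 h
  rw [SetLike.mem_coe, mem_sig, T.eq_sum_pathLam c, coordSum_sum_pathLam] at hc
  refine ⟨fun t => ∑ u, c.1 u t, hc, fun s hs => ?_⟩
  rw [T.eq_sum_pathLam c, pairing_eq_coord] at hcw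
  have := DFunLike.congr_fun hcw (T.pathLam s)
  rw [T.coord_pathLam _ hs, T.coord_pathLam _ hs] at this
  exact this.symm

theorem pipeAut_toPipe (T : MarkedBYTree.{u}) (w : T.V → ℤ) :
    T.pipeAut (T.toPipe w) = T.toPipe (w ∘ T.F.symm) := by
  classical
  change (Submodule.Quotient.mk (dualAut T.lamAut (T.coord w)) : T.Pipe) =
    Submodule.Quotient.mk (T.coord _)
  congr 1
  ext1 c
  obtain ⟨c, rfl⟩ := T.lamAut.surjective c
  change T.coord w (T.lamAut.symm (T.lamAut c)) = _
  rw [LinearEquiv.symm_apply_apply, coord_apply, coord_apply]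
  refine Finset.sum_equiv T.F.toEquiv (fun v => ?_) fun v _ => ?_
  · rw [mem_sfin, mem_sfin]; exact (T.F_S v).symm
  · change w v * _ = w (T.F.symm (T.F v)) * ∑ u, ((1 : ℤˣ) : ℤ) *
      c.1 (T.F.toEquiv.symm u) (T.F.toEquiv.symm (T.F.toEquiv v))
    rw [RelIso.symm_apply_apply]
    simp only [Units.val_one, one_mul, Equiv.symm_apply_apply]
    rw [Equiv.sum_comp T.F.toEquiv.symm (fun u => c.1 u v)]

/-! ### Elements of infinite order and finiteness -/

/-- A representative in `Λ` of `n y` has coordinate sum `n`; as the pairing is injective, it is a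
relation only if it lies in `Σ`. -/
theorem zsmul_yPipe_eq_zero (T : MarkedBYTree.{u}) {n : ℤ} (h : n • T.yPipe = 0) : n = 0 := by
  obtain ⟨s, hs⟩ := T.S_nonempty
  have h1 : T.coordSum (n • T.pathLam s) = n := by
    rw [map_smul, T.coordSum_pathLam hs, smul_eq_mul, mul_one]
  rw [← h1, ← mk_pairing] at h
  obtain ⟨c, hc, hcw⟩ := (Submodule.Quotient.mk_eq_zero _).1 h
  rw [SetLike.mem_coe, mem_sig, T.pairing_injective hcw, h1] at hc
  exact hc

/-- If `n η` is the pairing with some `c` in `Σ`, then `c` pairs with itself to `n` times its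
coordinate sum, which is zero; definiteness gives `c = 0`. -/
theorem zsmul_etaPipe_eq_zero (T : MarkedBYTree.{u}) {n : ℤ} (h : n • T.etaPipe = 0) : n = 0 := by
  obtain ⟨s, hs⟩ := T.S_nonempty
  rw [etaPipe, ← Submodule.Quotient.mk_smul, Submodule.Quotient.mk_eq_zero] at h
  obtain ⟨c, hc, hcw⟩ := h
  rw [SetLike.mem_coe, mem_sig] at hc
  have h1 : c = 0 := T.pairing_eq_zero (by rw [hcw, LinearMap.smul_apply, hc, smul_zero])
  rw [h1, map_zero] at hcw
  have := DFunLike.congr_fun hcw (T.pathLam s)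
  rw [LinearMap.smul_apply, T.coordSum_pathLam hs] at this
  simpa using this.symm

theorem finite_dual_quotient_range (T : MarkedBYTree.{u}) :
    Finite (Module.Dual ℤ T.Lam ⧸ LinearMap.range T.pairing) := by
  refine Submodule.finiteQuotientOfFreeOfRankEq _ ?_
  rw [LinearMap.finrank_range_of_inj T.pairing_injective]
  exact ((Module.Free.chooseBasis ℤ T.Lam).toDualEquiv).finrank_eq

/-! ### Maps between pipes -/

theorem exists_pipe_lift (T : MarkedBYTree.{u}) {N : Type u} [AddCommGroup N]
    (g : (T.V → ℤ) →ₗ[ℤ] N) (h : ∀ w, T.toPipe w = 0 → g w = 0) :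
    ∃ φ : T.Pipe →ₗ[ℤ] N, ∀ w, φ (T.toPipe w) = g w := by
  let e := LinearMap.quotKerEquivOfSurjective T.toPipe T.toPipe_surjective
  have hle : LinearMap.ker T.toPipe ≤ LinearMap.ker g := fun w hw =>
    LinearMap.mem_ker.2 (h w (LinearMap.mem_ker.1 hw))
  refine ⟨(LinearMap.ker T.toPipe).liftQ g hle ∘ₗ e.symm.toLinearMap, fun w => ?_⟩
  have : e.symm (T.toPipe w) = Submodule.Quotient.mk w := by
    rw [LinearEquiv.symm_apply_eq]; rfl
  rw [LinearMap.comp_apply, LinearEquiv.coe_coe, this, Submodule.liftQ_apply]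

/-- The action of `F` on the pipe as an endomorphism. -/
noncomputable def pipeEnd (T : MarkedBYTree.{u}) : Module.End ℤ T.Pipe := T.pipeAut.toLinearMap

theorem pipeEnd_pow_toPipe (T : MarkedBYTree.{u}) (k : ℕ) (w : T.V → ℤ) :
    (T.pipeEnd ^ k) (T.toPipe w) = T.toPipe (w ∘ T.F.symm^[k]) := by
  induction k generalizing w with
  | zero => rfl
  | succ k ih =>
    rw [pow_succ, Module.End.mul_apply]
    change (T.pipeEnd ^ k) (T.pipeAut (T.toPipe w)) = _
    rw [pipeAut_toPipe, ih, Function.iterate_succ']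
    rfl

theorem exists_pipeEnd_pow_eq_one (T : MarkedBYTree.{u}) : ∃ n, 0 < n ∧ T.pipeEnd ^ n = 1 := by
  classical
  obtain ⟨n, hn, hF⟩ := isOfFinOrder_iff_pow_eq_one.1 (isOfFinOrder_of_finite T.F.symm.toEquiv)
  refine ⟨n, hn, LinearMap.ext fun x => ?_⟩
  obtain ⟨w, rfl⟩ := T.toPipe_surjective x
  have h : T.F.symm^[n] = id := by
    funext v
    have := congrArg (fun e : Equiv.Perm T.V => e v) hF
    simp only [Equiv.Perm.coe_pow, Equiv.Perm.coe_one] at this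
    exact this
  rw [pipeEnd_pow_toPipe, h]; rfl

/-- An embedding into `T` of trees compatible with iterates of the automorphisms induces a
compatible map of pipes. -/
theorem pipeEnd_pow_comm {T T₀ : MarkedBYTree.{u}} {i : T₀.V → T.V} {φ : T₀.Pipe →ₗ[ℤ] T.Pipe}
    (hi : Function.Injective i)
    (hφ : ∀ (w₀ : T₀.V → ℤ) (w : T.V → ℤ), (∀ v ∈ T₀.S, w (i v) = w₀ v) →
      (∀ s ∈ T.S, s ∉ i '' T₀.S → w s = 0) → φ (T₀.toPipe w₀) = T.toPipe w)
    {q : ℕ} (hq : ∀ v, T.F^[q] (i v) = i (T₀.F v)) (x : T₀.Pipe) :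
    (T.pipeEnd ^ q) (φ x) = φ (T₀.pipeAut x) := by
  classical
  obtain ⟨w₀, rfl⟩ := T₀.toPipe_surjective x
  have hsymm : ∀ k, Function.LeftInverse (T.F.symm^[k]) (T.F^[k]) := fun k =>
    Function.LeftInverse.iterate (fun v => T.F.symm_apply_apply v) k
  have hsymm' : ∀ k, Function.RightInverse (T.F.symm^[k]) (T.F^[k]) := fun k =>
    Function.RightInverse.iterate (fun v => T.F.apply_symm_apply v) k
  have hq' : ∀ v, T.F.symm^[q] (i v) = i (T₀.F.symm v) := fun v => by
    have := hq (T₀.F.symm v)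
    rw [RelIso.apply_symm_apply] at this
    rw [← this, hsymm q]
  have hS : ∀ v, T₀.F.symm v ∈ T₀.S ↔ v ∈ T₀.S := fun v => by
    rw [← T₀.F_S, RelIso.apply_symm_apply]
  -- The indicator discards the values of `w₀` off `S₀`, since the hypotheses do not prevent `i`
  -- from sending such vertices into `S`.
  rw [hφ w₀ (Function.extend i (T₀.S.indicator w₀) 0), pipeAut_toPipe, pipeEnd_pow_toPipe]
  · refine (hφ _ _ (fun v hv => ?_) fun s hs hns => ?_).symm
    · simp only [Function.comp_apply]
      rw [hq', hi.extend_apply, Set.indicator_of_mem ((hS v).2 hv)]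
    · simp only [Function.comp_apply]
      by_cases h : ∃ a, i a = T.F.symm^[q] s
      · obtain ⟨a, ha⟩ := h
        rw [← ha, hi.extend_apply, Set.indicator_of_notMem]
        intro haS
        refine hns ⟨T₀.F a, (T₀.F_S a).2 haS, ?_⟩
        rw [← hq, ha, hsymm' q]
      · rw [Function.extend_apply' _ _ _ h]; rfl
  · intro v hv
    rw [hi.extend_apply, Set.indicator_of_mem hv]
  · intro s hs hns
    by_cases h : ∃ a, i a = s
    · obtain ⟨a, rfl⟩ := h
      rw [hi.extend_apply, Set.indicator_of_notMem]
      exact fun haS => hns ⟨a, haS, rfl⟩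
    · rw [Function.extend_apply' _ _ _ h]; rfl

section Family

variable {T : MarkedBYTree.{u}} {K : Type} [Fintype K] {T' : K → MarkedBYTree.{u}}
  {i : ∀ k, (T' k).V → T.V}

theorem sum_sfin_family (hi : ∀ k, Function.Injective (i k))
    (hS : ∀ k, ∀ v ∈ (T' k).S, i k v ∈ T.S)
    (hsurj : ∀ s ∈ T.S, ∃ k, ∃ v ∈ (T' k).S, i k v = s)
    (hdis : ∀ k l, k ≠ l → ∀ v ∈ (T' k).S, ∀ w ∈ (T' l).S, i k v ≠ i l w) (f : T.V → ℤ) :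
    ∑ t ∈ T.sfin, f t = ∑ k, ∑ v ∈ (T' k).sfin, f (i k v) := by
  rw [Finset.sum_sigma']
  symm
  refine Finset.sum_bij (fun x _ => i x.1 x.2) ?_ ?_ ?_ fun _ _ => rfl
  · rintro ⟨k, v⟩ h
    simp only [Finset.mem_sigma, mem_sfin] at h ⊢
    exact hS k v h.2
  · rintro ⟨k, v⟩ h ⟨l, w⟩ h' e
    simp only [Finset.mem_sigma, mem_sfin] at h h' e
    by_cases hkl : k = l
    · subst hkl
      rw [hi k e]
    · exact absurd e (hdis k l hkl v h.2 w h'.2)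
  · intro s hs
    obtain ⟨k, v, hv, rfl⟩ := hsurj s (T.mem_sfin.1 hs)
    exact ⟨⟨k, v⟩, by simp [mem_sfin, hv], rfl⟩

/-- The pipe of a tree formed by joining trees `T' k` at their marked vertices: it is the quotient
of the direct sum of the pipes of the `T' k` by the identification of the elements `y`. -/
theorem exists_pipeMap_family (hi : ∀ k, Function.Injective (i k))
    (hS : ∀ k, ∀ v ∈ (T' k).S, i k v ∈ T.S)
    (hsurj : ∀ s ∈ T.S, ∃ k, ∃ v ∈ (T' k).S, i k v = s)
    (hdis : ∀ k l, k ≠ l → ∀ v ∈ (T' k).S, ∀ w ∈ (T' l).S, i k v ≠ i l w)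
    (hG : ∀ k, ∀ v ∈ (T' k).S, ∀ w ∈ (T' k).S,
      T.gromov (i k v) (i k w) = (T' k).gromov v w)
    (hG' : ∀ k l, k ≠ l → ∀ v ∈ (T' k).S, ∀ w ∈ (T' l).S, T.gromov (i k v) (i l w) = 0) :
    ∃ φ : ∀ k, (T' k).Pipe →ₗ[ℤ] T.Pipe,
      (∀ k (w₀ : (T' k).V → ℤ) (w : T.V → ℤ), (∀ v ∈ (T' k).S, w (i k v) = w₀ v) →
        (∀ s ∈ T.S, s ∉ i k '' (T' k).S → w s = 0) → φ k ((T' k).toPipe w₀) = T.toPipe w) ∧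
      (∀ k, φ k (T' k).yPipe = T.yPipe) ∧ ∑ k, φ k (T' k).etaPipe = T.etaPipe ∧
      (∀ z, ∃ x : ∀ k, (T' k).Pipe, ∑ k, φ k (x k) = z) ∧
      ∀ x : ∀ k, (T' k).Pipe, ∑ k, φ k (x k) = 0 →
        ∃ n : K → ℤ, (∀ k, x k = n k • (T' k).yPipe) ∧ ∑ k, n k = 0 := by
  classical
  let E : ∀ k, ((T' k).V → ℤ) →ₗ[ℤ] (T.V → ℤ) := fun k =>
    { toFun := fun w s => ∑ v ∈ (T' k).sfin, if i k v = s then w v else 0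
      map_add' := fun a b => by
        funext s
        simp only [Pi.add_apply, ← Finset.sum_add_distrib]
        exact Finset.sum_congr rfl fun v _ => by split <;> simp
      map_smul' := fun r a => by
        funext s
        simp only [Pi.smul_apply, smul_eq_mul, RingHom.id_apply, Finset.mul_sum]
        exact Finset.sum_congr rfl fun v _ => by split <;> simp }
  have hE : ∀ k w s, E k w s = ∑ v ∈ (T' k).sfin, if i k v = s then w v else 0 :=
    fun _ _ _ => rfl
  have hE1 : ∀ k w, ∀ v ∈ (T' k).S, E k w (i k v) = w v := fun k w v hv => by
    rw [hE, Finset.sum_eq_single v]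
    · simp
    · intro b _ hb; rw [if_neg fun h => hb (hi k h)]
    · intro h; exact absurd ((mem_sfin _).2 hv) h
  have hE2 : ∀ k w s, s ∉ i k '' (T' k).S → E k w s = 0 := fun k w s hs => by
    rw [hE]
    refine Finset.sum_eq_zero fun v hv => if_neg ?_
    rintro rfl
    exact hs ⟨v, (mem_sfin _).1 hv, rfl⟩
  have hE3 : ∀ (w : ∀ k, (T' k).V → ℤ) k, ∀ v ∈ (T' k).S, ∑ l, E l (w l) (i k v) = w k v := by
    intro w k v hv
    rw [Finset.sum_eq_single k, hE1 k _ v hv]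
    · intro l _ hl
      refine hE2 l _ _ ?_
      rintro ⟨a, ha, e⟩
      exact hdis l k hl a ha v hv e
    · simp
  have hsum := sum_sfin_family hi hS hsurj hdis
  -- The matrix of Gromov products is block diagonal.
  have hGG : ∀ k, ∀ s ∈ (T' k).S, ∀ v : T.V → ℤ, ∑ t ∈ T.sfin, T.gromov (i k s) t * v t =
      ∑ t ∈ (T' k).sfin, (T' k).gromov s t * v (i k t) := by
    intro k s hs v
    rw [hsum, Finset.sum_eq_single k]
    · exact Finset.sum_congr rfl fun t ht => by rw [hG k s hs t ((mem_sfin _).1 ht)]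
    · intro l _ hl
      exact Finset.sum_eq_zero fun t ht => by
        rw [hG' k l hl.symm s hs t ((mem_sfin _).1 ht), zero_mul]
    · simp
  have hker : ∀ k w, (T' k).toPipe w = 0 → (T.toPipe ∘ₗ E k) w = 0 := by
    intro k w hw
    obtain ⟨v, hv0, hv⟩ := (T' k).exists_of_toPipe_eq_zero hw
    have h := T.toPipe_gromov (E k v)
    have h1 : ∀ f : T.V → ℤ, ∑ t ∈ T.sfin, f t * E k v t = ∑ t ∈ (T' k).sfin, f (i k t) * v t := by
      intro f
      rw [hsum, Finset.sum_eq_single k]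
      · exact Finset.sum_congr rfl fun t ht => by rw [hE1 k v t ((mem_sfin _).1 ht)]
      · intro l _ hl
        refine Finset.sum_eq_zero fun t ht => ?_
        rw [hE2 k v, mul_zero]
        rintro ⟨a, ha, e⟩
        exact hdis k l hl.symm a ha t ((mem_sfin _).1 ht) e
      · simp
    have h2 := h1 1
    simp only [Pi.one_apply, one_mul] at h2
    rw [h2, hv0, zero_smul] at h
    rw [← h]
    refine T.toPipe_congr fun s hs => ?_
    rw [h1 (T.gromov s)]
    obtain ⟨l, a, ha, rfl⟩ := hsurj s hs
    by_cases hl : l = k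
    · subst hl
      rw [hE1 l w a ha, hv a ha]
      exact Finset.sum_congr rfl fun t ht => by rw [hG l a ha t ((mem_sfin _).1 ht)]
    · rw [hE2 k w, Finset.sum_eq_zero]
      · intro t ht; rw [hG' l k hl a ha t ((mem_sfin _).1 ht), zero_mul]
      · rintro ⟨b, hb, e⟩
        exact hdis k l (Ne.symm hl) b hb a ha e
  choose φ hφ using fun k => (T' k).exists_pipe_lift (T.toPipe ∘ₗ E k) (hker k)
  have hφ' : ∀ k (w₀ : (T' k).V → ℤ) (w : T.V → ℤ), (∀ v ∈ (T' k).S, w (i k v) = w₀ v) →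
      (∀ s ∈ T.S, s ∉ i k '' (T' k).S → w s = 0) → φ k ((T' k).toPipe w₀) = T.toPipe w := by
    intro k w₀ w h1 h2
    rw [hφ]
    refine T.toPipe_congr fun s hs => ?_
    by_cases h : s ∈ i k '' (T' k).S
    · obtain ⟨v, hv, rfl⟩ := h
      rw [hE1 k _ v hv, h1 v hv]
    · rw [hE2 k _ s h, h2 s hs h]
  have hsumφ : ∀ w : ∀ k, (T' k).V → ℤ, ∑ k, φ k ((T' k).toPipe (w k)) =
      T.toPipe (∑ k, E k (w k)) := fun w => by
    rw [map_sum]; exact Finset.sum_congr rfl fun k _ => hφ k _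
  have hsurjφ : ∀ w : T.V → ℤ, ∑ k, φ k ((T' k).toPipe (w ∘ i k)) = T.toPipe w := fun w => by
    rw [hsumφ]
    refine T.toPipe_congr fun s hs => ?_
    obtain ⟨k, v, hv, rfl⟩ := hsurj s hs
    rw [Finset.sum_apply, hE3 (fun k => w ∘ i k) k v hv]; rfl
  refine ⟨φ, hφ', fun k => ?_, ?_, fun z => ?_, fun x hx => ?_⟩
  -- The element `y` is a column of the matrix, and a column through one block vanishes on the other
  -- blocks.
  · obtain ⟨s, hs⟩ := (T' k).S_nonempty
    rw [← (T' k).toPipe_gromov_single hs, ← T.toPipe_gromov_single (hS k s hs)]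
    refine hφ' k _ _ (fun v hv => hG k v hv s hs) fun t ht hn => ?_
    obtain ⟨l, v, hv, rfl⟩ := hsurj t ht
    refine hG' l k ?_ v hv s hs
    rintro rfl
    exact hn ⟨v, hv, rfl⟩
  · rw [← toPipe_one, ← hsurjφ 1]
    exact Finset.sum_congr rfl fun k _ => by rw [← toPipe_one]; rfl
  · obtain ⟨w, rfl⟩ := T.toPipe_surjective z
    exact ⟨_, hsurjφ w⟩
  · choose w hw using fun k => (T' k).toPipe_surjective (x k)
    obtain rfl : (fun k => (T' k).toPipe (w k)) = x := funext hw
    rw [hsumφ] at hx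
    obtain ⟨v, hv0, hv⟩ := T.exists_of_toPipe_eq_zero hx
    -- A relation vector `v` has total sum zero, but its restriction to a block has some sum `n k`,
    -- and so represents `n k` times the element `y` of that block.
    refine ⟨fun k => ∑ t ∈ (T' k).sfin, v (i k t), fun k => ?_, by rw [← hsum, hv0]⟩
    rw [← toPipe_gromov]
    refine (T' k).toPipe_congr fun s hs => ?_
    have := hv (i k s) (hS k s hs)
    rwa [Finset.sum_apply, hE3 w k s hs, hGG k s hs] at this

end Family

/-- The pipes of two trees with the same set `S` and Gromov products differing by a constant `l`
are isomorphic, and the elements `y` differ by `l • η`. -/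
theorem exists_pipeMap_shift {T T₀ : MarkedBYTree.{u}} {i : T₀.V → T.V}
    (hi : Function.Injective i) (hS : T.S = i '' T₀.S) {l : ℤ}
    (hG : ∀ v ∈ T₀.S, ∀ w ∈ T₀.S, T.gromov (i v) (i w) = T₀.gromov v w + l) :
    ∃ φ : T₀.Pipe →ₗ[ℤ] T.Pipe,
      (∀ (w₀ : T₀.V → ℤ) (w : T.V → ℤ), (∀ v ∈ T₀.S, w (i v) = w₀ v) →
        φ (T₀.toPipe w₀) = T.toPipe w) ∧
      Function.Bijective φ ∧ φ T₀.etaPipe = T.etaPipe ∧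
      φ T₀.yPipe + l • T.etaPipe = T.yPipe := by
  classical
  have hsum : ∀ f : T.V → ℤ, ∑ t ∈ T.sfin, f t = ∑ t ∈ T₀.sfin, f (i t) := fun f => by
    have : T.sfin = T₀.sfin.map ⟨i, hi⟩ := by
      ext v
      simp only [mem_sfin, Finset.mem_map, hS, Set.mem_image, Function.Embedding.coeFn_mk]
    rw [this, Finset.sum_map]; rfl
  have hmem : ∀ v ∈ T₀.S, i v ∈ T.S := fun v hv => by rw [hS]; exact ⟨v, hv, rfl⟩
  -- The shift by `l` contributes `l` times the sum of `v`, which is zero for relations.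
  have hGG : ∀ s ∈ T₀.S, ∀ v : T.V → ℤ, ∑ t ∈ T.sfin, T.gromov (i s) t * v t =
      ∑ t ∈ T₀.sfin, T₀.gromov s t * v (i t) + l * ∑ t ∈ T.sfin, v t := by
    intro s hs v
    rw [hsum, hsum v, Finset.mul_sum, ← Finset.sum_add_distrib]
    exact Finset.sum_congr rfl fun t ht => by rw [hG s hs t (T₀.mem_sfin.1 ht)]; ring
  have hext : ∀ (w : T₀.V → ℤ) v, Function.ExtendByZero.linearMap ℤ i w (i v) = w v :=
    fun w v => hi.extend_apply _ _ _
  obtain ⟨φ, hφ⟩ := T₀.exists_pipe_lift (T.toPipe ∘ₗ Function.ExtendByZero.linearMap ℤ i) (by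
    intro w hw
    obtain ⟨v, hv0, hv⟩ := T₀.exists_of_toPipe_eq_zero hw
    have h := T.toPipe_gromov (Function.ExtendByZero.linearMap ℤ i v)
    have h1 : ∑ t ∈ T.sfin, Function.ExtendByZero.linearMap ℤ i v t = 0 := by
      rw [hsum, ← hv0]
      exact Finset.sum_congr rfl fun t _ => hext v t
    rw [h1, zero_smul] at h
    rw [← h]
    refine T.toPipe_congr fun s hs => ?_
    rw [hS] at hs
    obtain ⟨a, ha, rfl⟩ := hs
    rw [hext, hGG a ha, h1, mul_zero, add_zero, hv a ha]
    exact Finset.sum_congr rfl fun t _ => by rw [hext])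
  have hφ' : ∀ (w₀ : T₀.V → ℤ) (w : T.V → ℤ), (∀ v ∈ T₀.S, w (i v) = w₀ v) →
      φ (T₀.toPipe w₀) = T.toPipe w := fun w₀ w h => by
    rw [hφ]
    refine T.toPipe_congr fun s hs => ?_
    rw [hS] at hs
    obtain ⟨a, ha, rfl⟩ := hs
    rw [hext, h a ha]
  have hη : φ T₀.etaPipe = T.etaPipe := by
    rw [← toPipe_one, ← toPipe_one]; exact hφ' _ _ fun _ _ => rfl
  refine ⟨φ, hφ', ⟨(injective_iff_map_eq_zero φ).2 fun x hx => ?_, fun z => ?_⟩, hη, ?_⟩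
  · obtain ⟨w₀, rfl⟩ := T₀.toPipe_surjective x
    rw [hφ] at hx
    obtain ⟨v, hv0, hv⟩ := T.exists_of_toPipe_eq_zero hx
    have h := T₀.toPipe_gromov (v ∘ i)
    simp only [Function.comp_apply] at h
    rw [← hsum, hv0, zero_smul] at h
    rw [← h]
    refine T₀.toPipe_congr fun s hs => ?_
    have := hv (i s) (hmem s hs)
    rwa [hext, hGG s hs, hv0, mul_zero, add_zero] at this
  · obtain ⟨w, rfl⟩ := T.toPipe_surjective z
    exact ⟨T₀.toPipe (w ∘ i), hφ' _ _ fun _ _ => rfl⟩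
  · obtain ⟨s, hs⟩ := T₀.S_nonempty
    rw [← T₀.toPipe_gromov_single hs, ← T.toPipe_gromov_single (hmem s hs), ← hη,
      ← T₀.toPipe_one, ← map_smul, ← map_add, ← map_smul, ← map_add]
    exact hφ' _ _ fun v hv => by simp [hG v hv s hs]

/-! ### Gromov products under embeddings -/

theorem pathChain_eq_of_eq (T : MarkedBYTree.{u}) {v a : T.V} (ha : a = T.pt)
    (p : T.graph.Walk a v) : T.pathChain v = walkChain p := by
  subst ha; exact T.pathChain_eq p

theorem pathChain_emb {T T₀ : MarkedBYTree.{u}} (i : Emb T₀ T) (hpt : i.toEmb T₀.pt = T.pt)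
    {v : T₀.V} (p : T₀.graph.Walk T₀.pt v) :
    T.pathChain (i.toEmb v) = walkChain (p.map i.toEmb.toHom) :=
  T.pathChain_eq_of_eq hpt (p.map i.toEmb.toHom)

theorem pathChain_graft {T T₀ : MarkedBYTree.{u}} (i : Emb T₀ T)
    (hadj : T.graph.Adj T.pt (i.toEmb T₀.pt)) {v : T₀.V} (p : T₀.graph.Walk T₀.pt v) :
    T.pathChain (i.toEmb v) =
      walkChain (.cons hadj (.nil : T.graph.Walk (i.toEmb T₀.pt) (i.toEmb T₀.pt))) +
        walkChain (p.map i.toEmb.toHom) := by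
  rw [← walkChain_cons hadj (p.map i.toEmb.toHom)]
  exact T.pathChain_eq (.cons hadj (p.map i.toEmb.toHom))

theorem gromov_emb {T T₀ : MarkedBYTree.{u}} (i : Emb T₀ T) (hpt : i.toEmb T₀.pt = T.pt)
    (v w : T₀.V) : T.gromov (i.toEmb v) (i.toEmb w) = T₀.gromov v w := by
  obtain ⟨p⟩ := T₀.isTree.1.preconnected T₀.pt v
  obtain ⟨q⟩ := T₀.isTree.1.preconnected T₀.pt w
  rw [gromov, gromov, T₀.pathChain_eq p, T₀.pathChain_eq q,
    pathChain_emb i hpt p, pathChain_emb i hpt q]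
  exact lengthPairing_map i.toEmb i.len_eq p q

theorem gromov_emb_emb {T T₀ T₁ : MarkedBYTree.{u}} (i : Emb T₀ T) (j : Emb T₁ T)
    (hpt : i.toEmb T₀.pt = T.pt) (hpt' : j.toEmb T₁.pt = T.pt)
    (hij : Set.range i.toEmb ∩ Set.range j.toEmb ⊆ {T.pt}) (v : T₀.V) (w : T₁.V) :
    T.gromov (i.toEmb v) (j.toEmb w) = 0 := by
  obtain ⟨p⟩ := T₀.isTree.1.preconnected T₀.pt v
  obtain ⟨q⟩ := T₁.isTree.1.preconnected T₁.pt w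
  rw [gromov, pathChain_emb i hpt p, pathChain_emb j hpt' q]
  exact lengthPairing_map_map_eq_zero i.toEmb j.toEmb T.len hij p q

/-- Both paths begin with the grafted edge, which contributes its length once; the rest of each path
avoids this edge, so the mixed terms vanish. -/
theorem gromov_graft {T T₀ : MarkedBYTree.{u}} (i : Emb T₀ T) (hpt : T.pt ∉ Set.range i.toEmb)
    (hadj : T.graph.Adj T.pt (i.toEmb T₀.pt)) (v w : T₀.V) :
    T.gromov (i.toEmb v) (i.toEmb w) = T₀.gromov v w + T.len s(T.pt, i.toEmb T₀.pt) := by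
  classical
  obtain ⟨p⟩ := T₀.isTree.1.preconnected T₀.pt v
  obtain ⟨q⟩ := T₀.isTree.1.preconnected T₀.pt w
  have h0 : ∀ {v} (p : T₀.graph.Walk T₀.pt v),
      walkChain (p.map i.toEmb.toHom) T.pt (i.toEmb T₀.pt) = 0 := fun p =>
    walkChain_map_eq_zero i.toEmb p fun h => hpt h.1
  rw [gromov, gromov, T₀.pathChain_eq p, T₀.pathChain_eq q,
    pathChain_graft i hadj p, pathChain_graft i hadj q, map_add, map_add,
    LinearMap.add_apply, LinearMap.add_apply, lengthPairing_map i.toEmb i.len_eq p q,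
    lengthPairing_comm _ _ (walkChain (p.map i.toEmb.toHom)),
    lengthPairing_walkChain_single _ _ (walkChain_mem_univ _),
    lengthPairing_walkChain_single _ _ (walkChain_mem_univ _),
    lengthPairing_walkChain_single _ _ (walkChain_mem_univ _)]
  have h1 : walkChain (.cons hadj (.nil : T.graph.Walk (i.toEmb T₀.pt) (i.toEmb T₀.pt)))
      T.pt (i.toEmb T₀.pt) = 1 := by
    simp [walkChain, hadj.ne]
  erw [h0 p, h0 q, h1]
  ring

/-! ### The pipes of the constructed trees -/

/-- Here `S` is a single point and the matrix of Gromov products is `(l)`. -/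
theorem pipe_edge {T : MarkedBYTree.{u}} {l : ℕ} (h : T.IsEdge l) :
    T.yPipe = (l : ℤ) • T.etaPipe ∧ ∀ z : T.Pipe, ∃ n : ℤ, z = n • T.etaPipe := by
  obtain ⟨s, hs, hadj, hl, hv⟩ := h
  have hS : ∀ t ∈ T.S, t = s := fun t ht => (hv t).resolve_left (T.ne_pt ht)
  refine ⟨?_, fun z => ?_⟩
  · rw [← T.toPipe_gromov_single hs, ← toPipe_one, ← map_smul]
    refine T.toPipe_congr fun t ht => ?_
    rw [hS t ht, gromov, T.pathChain_eq (.cons hadj .nil),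
      lengthPairing_walkChain_single _ _ (walkChain_mem_univ _), hl]
    simp [walkChain, hadj.ne]
  · obtain ⟨w, rfl⟩ := T.toPipe_surjective z
    refine ⟨w s, ?_⟩
    rw [← toPipe_one, ← map_smul]
    exact T.toPipe_congr fun t ht => by rw [hS t ht]; simp

theorem pipe_graft {T T₀ : MarkedBYTree.{u}} {l : ℕ} (h : T.IsGraft T₀ l) :
    ∃ φ : T₀.Pipe ≃ₗ[ℤ] T.Pipe, (∀ x, T.pipeAut (φ x) = φ (T₀.pipeAut x)) ∧
      φ T₀.etaPipe = T.etaPipe ∧ φ T₀.yPipe + (l : ℤ) • T.etaPipe = T.yPipe := by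
  obtain ⟨i, -, hpt, hadj, hl, hS, hF⟩ := h
  obtain ⟨φ, hφ, hb, hη, hy⟩ := exists_pipeMap_shift (l := l) i.toEmb.injective hS
    fun v _ w _ => by rw [gromov_graft i hpt ((hadj _).2 rfl), hl]
  exact ⟨LinearEquiv.ofBijective φ hb, fun x => pipeEnd_pow_comm (q := 1) i.toEmb.injective
    (fun w₀ w h _ => hφ w₀ w h) hF x, hη, hy⟩

theorem pipe_enlargement {T T₀ : MarkedBYTree.{u}} (h : T.IsEnlargement T₀) :
    ∃ φ : T₀.Pipe ≃ₗ[ℤ] T.Pipe, (∀ x, T.pipeAut (φ x) = φ (T₀.pipeAut x)) ∧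
      φ T₀.etaPipe = T.etaPipe ∧ φ T₀.yPipe + (0 : ℤ) • T.etaPipe = T.yPipe := by
  obtain ⟨i, hpt, hS, hF⟩ := h
  obtain ⟨φ, hφ, hb, hη, hy⟩ := exists_pipeMap_shift (l := 0) i.toEmb.injective hS
    fun v _ w _ => by rw [gromov_emb i hpt, add_zero]
  exact ⟨LinearEquiv.ofBijective φ hb, fun x => pipeEnd_pow_comm (q := 1) i.toEmb.injective
    (fun w₀ w h _ => hφ w₀ w h) hF x, hη, hy⟩

theorem pipe_wedge {T T₀ T₁ : MarkedBYTree.{u}} (h : T.IsWedge T₀ T₁) :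
    ∃ (φ₀ : T₀.Pipe →ₗ[ℤ] T.Pipe) (φ₁ : T₁.Pipe →ₗ[ℤ] T.Pipe),
      (∀ x, T.pipeAut (φ₀ x) = φ₀ (T₀.pipeAut x)) ∧
      (∀ x, T.pipeAut (φ₁ x) = φ₁ (T₁.pipeAut x)) ∧
      φ₀ T₀.yPipe = T.yPipe ∧ φ₁ T₁.yPipe = T.yPipe ∧
      φ₀ T₀.etaPipe + φ₁ T₁.etaPipe = T.etaPipe ∧
      (∀ z, ∃ x₀ x₁, φ₀ x₀ + φ₁ x₁ = z) ∧
      ∀ x₀ x₁, φ₀ x₀ + φ₁ x₁ = 0 → ∃ n : ℤ, x₀ = n • T₀.yPipe ∧ x₁ = -(n • T₁.yPipe) := by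
  obtain ⟨i, j, hi, hj, -, hij, -, hS, hFi, hFj⟩ := h
  let T' : Bool → MarkedBYTree.{u} := fun | false => T₀ | true => T₁
  let f : ∀ k, (T' k).V → T.V := fun | false => i.toEmb | true => j.toEmb
  have hij' : Set.range j.toEmb ∩ Set.range i.toEmb ⊆ {T.pt} := by rw [Set.inter_comm, hij]
  have hdis : ∀ v ∈ T₀.S, ∀ w ∈ T₁.S, i.toEmb v ≠ j.toEmb w := fun v hv w hw e => by
    have : i.toEmb v = T.pt := hij.subset ⟨⟨v, rfl⟩, ⟨w, e.symm⟩⟩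
    rw [← hi] at this
    exact T₀.ne_pt hv (i.toEmb.injective this)
  obtain ⟨φ, hφ, hy, hη, hs, hk⟩ := exists_pipeMap_family (T := T) (T' := T') (i := f)
    (by rintro (_ | _); exacts [i.toEmb.injective, j.toEmb.injective])
    (by rintro (_ | _) v hv <;> rw [hS]; exacts [Or.inl ⟨v, hv, rfl⟩, Or.inr ⟨v, hv, rfl⟩])
    (by
      intro s hs
      rw [hS] at hs
      rcases hs with ⟨v, hv, rfl⟩ | ⟨v, hv, rfl⟩
      exacts [⟨false, v, hv, rfl⟩, ⟨true, v, hv, rfl⟩])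
    (by
      rintro (_ | _) (_ | _) h v hv w hw
      exacts [absurd rfl h, hdis v hv w hw, (hdis w hw v hv).symm, absurd rfl h])
    (by rintro (_ | _) v _ w _; exacts [gromov_emb i hi v w, gromov_emb j hj v w])
    (by
      rintro (_ | _) (_ | _) h v _ w _
      exacts [absurd rfl h, gromov_emb_emb i j hi hj hij.subset v w,
        gromov_emb_emb j i hj hi hij' v w, absurd rfl h])
  refine ⟨φ false, φ true, fun x => pipeEnd_pow_comm (q := 1) i.toEmb.injective (hφ false) hFi x,
    fun x => pipeEnd_pow_comm (q := 1) j.toEmb.injective (hφ true) hFj x, hy false, hy true, ?_,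
    fun z => ?_, fun x₀ x₁ h => ?_⟩
  · rw [← hη, Fintype.sum_bool, add_comm]
  · obtain ⟨x, hx⟩ := hs z
    exact ⟨x false, x true, by rw [← hx, Fintype.sum_bool, add_comm]⟩
  · obtain ⟨n, hn, hn0⟩ := hk (fun | false => x₀ | true => x₁) (by
      rw [Fintype.sum_bool, add_comm]; exact h)
    rw [Fintype.sum_bool] at hn0
    refine ⟨n false, hn false, ?_⟩
    rw [← neg_smul, ← eq_neg_of_add_eq_zero_left hn0]
    exact hn true

theorem exists_emb_iterate {T T₀ : MarkedBYTree.{u}} (i : Emb T₀ T) (k : ℕ) :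
    ∃ e : Emb T₀ T, ∀ v, e.toEmb v = T.F^[k] (i.toEmb v) := by
  induction k with
  | zero => exact ⟨i, fun v => rfl⟩
  | succ k ih =>
    obtain ⟨e, he⟩ := ih
    refine ⟨⟨e.toEmb.trans T.F.toRelEmbedding, fun d hd => ?_⟩, fun v => ?_⟩
    · rw [← e.len_eq d hd, ← T.F_len (d.map e.toEmb), Sym2.map_map]
      · rfl
      · induction d with
        | _ a b => exact e.toEmb.map_adj_iff.2 hd
    · rw [Function.iterate_succ_apply', ← he]; rfl

/-- The copies are the translates of one copy by powers of `F`, so a single map `φ` and the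
endomorphism `pipeEnd` describe the maps from all the pipes. -/
theorem pipe_ind {T T₀ : MarkedBYTree.{u}} {q : ℕ} (h : T.IsInd T₀ q) :
    ∃ φ : T₀.Pipe →ₗ[ℤ] T.Pipe, (∀ x, (T.pipeEnd ^ q) (φ x) = φ (T₀.pipeAut x)) ∧
      φ T₀.yPipe = T.yPipe ∧
      ∑ k ∈ Finset.range q, (T.pipeEnd ^ k) (φ T₀.etaPipe) = T.etaPipe ∧
      (∀ z, ∃ x : ℕ → T₀.Pipe, ∑ k ∈ Finset.range q, (T.pipeEnd ^ k) (φ (x k)) = z) ∧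
      ∀ x : ℕ → T₀.Pipe, ∑ k ∈ Finset.range q, (T.pipeEnd ^ k) (φ (x k)) = 0 →
        ∃ n : ℕ → ℤ, (∀ k < q, x k = n k • T₀.yPipe) ∧ ∑ k ∈ Finset.range q, n k = 0 := by
  classical
  obtain ⟨hq, i, hi, hcov, hdis, -, hSi, hF⟩ := h
  choose e he using exists_emb_iterate i
  have hFS : ∀ k v, T.F^[k] v ∈ T.S ↔ v ∈ T.S := fun k => by
    induction k with
    | zero => exact fun v => Iff.rfl
    | succ k ih => intro v; rw [Function.iterate_succ_apply', T.F_S, ih]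
  have hFpt : ∀ k, T.F^[k] T.pt = T.pt := fun k => Function.iterate_fixed T.F_pt k
  have hept : ∀ k, (e k).toEmb T₀.pt = T.pt := fun k => by rw [he, hi, hFpt]
  have hdis' : ∀ k l, k < l → l < q → ∀ v w, T.F^[k] (i.toEmb v) = T.F^[l] (i.toEmb w) →
      v = T₀.pt := by
    intro k l hkl hl v w heq
    obtain ⟨m, rfl⟩ := Nat.exists_eq_add_of_lt hkl
    rw [show k + m + 1 = k + (m + 1) by ring, Function.iterate_add_apply] at heq
    have h1 := (T.F.injective.iterate k) heq
    exact hdis (m + 1) (by omega) (by omega) w v h1.symm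
  have hint : ∀ k l : Fin q, k ≠ l → Set.range (e k).toEmb ∩ Set.range (e l).toEmb ⊆ {T.pt} := by
    rintro k l hkl _ ⟨⟨v, rfl⟩, ⟨w, hw⟩⟩
    rw [Set.mem_singleton_iff]
    rw [he, he] at hw
    rcases lt_or_gt_of_ne hkl with h | h
    · rw [hdis' k l h l.2 v w hw.symm, hept]
    · rw [he, ← hw, hdis' l k h k.2 w v hw, hi, hFpt]
  have hSe : ∀ k v, (e k).toEmb v ∈ T.S ↔ v ∈ T₀.S := fun k v => by rw [he, hFS, hSi]
  obtain ⟨φ, hφ, hy, hη, hs, hk⟩ := exists_pipeMap_family (T := T) (K := Fin q)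
    (T' := fun _ => T₀) (i := fun k => (e k).toEmb) (fun k => (e k).toEmb.injective)
    (fun k v hv => (hSe k v).2 hv)
    (fun s hs => by
      obtain ⟨k, hk, v, rfl⟩ := hcov s
      refine ⟨⟨k, hk⟩, v, ?_, he k v⟩
      rwa [hFS, hSi] at hs)
    (fun k l hkl v hv w hw heq => by
      have h1 := hint k l hkl ⟨⟨v, rfl⟩, ⟨w, heq.symm⟩⟩
      exact T.ne_pt ((hSe k v).2 hv) h1)
    (fun k v _ w _ => gromov_emb (e k) (hept k) v w)
    (fun k l hkl v _ w _ => gromov_emb_emb (e k) (e l) (hept k) (hept l) (hint k l hkl) v w)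
  let o : Fin q := ⟨0, hq⟩
  have ho : ∀ v, (e o).toEmb v = i.toEmb v := he 0
  have hpow : ∀ (k : Fin q) x, φ k x = (T.pipeEnd ^ (k : ℕ)) (φ o x) := by
    intro k x
    obtain ⟨w₀, rfl⟩ := T₀.toPipe_surjective x
    have hs : Function.LeftInverse (T.F.symm^[k]) (T.F^[k]) :=
      Function.LeftInverse.iterate (fun v => T.F.symm_apply_apply v) k
    have hs' : Function.RightInverse (T.F.symm^[k]) (T.F^[k]) :=
      Function.RightInverse.iterate (fun v => T.F.apply_symm_apply v) k
    have hw1 : ∀ v, Function.extend (e o).toEmb (T₀.S.indicator w₀) 0 ((e o).toEmb v) =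
      T₀.S.indicator w₀ v := fun v => (e o).toEmb.injective.extend_apply _ _ _
    have hw2 : ∀ s, s ∉ (e o).toEmb '' T₀.S →
        Function.extend (e o).toEmb (T₀.S.indicator w₀) 0 s = 0 := by
      intro s hs
      by_cases h : ∃ a, (e o).toEmb a = s
      · obtain ⟨a, rfl⟩ := h
        rw [hw1, Set.indicator_of_notMem fun h => hs ⟨a, h, rfl⟩]
      · rw [Function.extend_apply' _ _ _ h]; rfl
    rw [hφ o w₀ (Function.extend (e o).toEmb (T₀.S.indicator w₀) 0)
      (fun v hv => by rw [hw1, Set.indicator_of_mem hv]) (fun s _ h => hw2 s h),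
      pipeEnd_pow_toPipe]
    refine hφ k _ _ (fun v hv => ?_) fun s _ hn => ?_
    · rw [Function.comp_apply, he, hs, ← ho, hw1, Set.indicator_of_mem hv]
    · rw [Function.comp_apply, hw2]
      rintro ⟨a, ha, hae⟩
      refine hn ⟨a, ha, ?_⟩
      rw [he, ← ho, hae, hs']
  have hsumφ : ∀ x : ℕ → T₀.Pipe, ∑ k ∈ Finset.range q, (T.pipeEnd ^ k) (φ o (x k)) =
      ∑ k : Fin q, φ k (x k) := fun x => by
    rw [Finset.sum_range]
    exact Finset.sum_congr rfl fun k _ => (hpow k _).symm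
  refine ⟨φ o, fun x => ?_, hy o, ?_, fun z => ?_, fun x hx => ?_⟩
  · refine pipeEnd_pow_comm (e o).toEmb.injective (hφ o) (fun v => ?_) x
    rw [ho, ho, hF]
  · rw [hsumφ fun _ => T₀.etaPipe, hη]
  · obtain ⟨x, hx⟩ := hs z
    refine ⟨fun k => if hk : k < q then x ⟨k, hk⟩ else 0, ?_⟩
    rw [hsumφ, ← hx]
    exact Finset.sum_congr rfl fun k _ => by rw [dif_pos k.2]
  · rw [hsumφ] at hx
    obtain ⟨n, hn, hn0⟩ := hk (fun k => x k) hx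
    refine ⟨fun k => if hk : k < q then n ⟨k, hk⟩ else 0, fun k hk => ?_, ?_⟩
    · rw [show (fun k => if hk : k < q then n ⟨k, hk⟩ else 0) k = n ⟨k, hk⟩ from dif_pos hk]
      exact hn ⟨k, hk⟩
    · rw [Finset.sum_range, ← hn0]
      exact Finset.sum_congr rfl fun k _ => by rw [dif_pos k.2]

end MarkedBYTree

/-! ### Induced pipes -/

/-- The relation between the pipe `M₀` of a tree, with automorphism `f₀`, and the pipe `M` of the
tree induced from it, with endomorphism `f`. -/
structure IsInducedPipe {M M₀ : Type u} [AddCommGroup M] [AddCommGroup M₀] (f : Module.End ℤ M)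
    (f₀ : M₀ ≃ₗ[ℤ] M₀) (φ : M₀ →ₗ[ℤ] M) (q : ℕ) (y₀ η₀ : M₀) : Prop where
  pos : 0 < q
  pow_apply : ∀ x, (f ^ q) (φ x) = φ (f₀ x)
  apply_y : f (φ y₀) = φ y₀
  fix_y : f₀ y₀ = y₀
  fix_eta : f₀ η₀ = η₀
  zsmul_y : ∀ n : ℤ, n • y₀ = 0 → n = 0
  finite_order : ∃ n, 0 < n ∧ (f₀ : Module.End ℤ M₀) ^ n = 1
  surj : ∀ z, ∃ x : ℕ → M₀, ∑ k ∈ Finset.range q, (f ^ k) (φ (x k)) = z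
  ker : ∀ x : ℕ → M₀, ∑ k ∈ Finset.range q, (f ^ k) (φ (x k)) = 0 →
    ∃ n : ℕ → ℤ, (∀ k < q, x k = n k • y₀) ∧ ∑ k ∈ Finset.range q, n k = 0

namespace IsInducedPipe

variable {M M₀ : Type u} [AddCommGroup M] [AddCommGroup M₀] {f : Module.End ℤ M}
  {f₀ : M₀ ≃ₗ[ℤ] M₀} {φ : M₀ →ₗ[ℤ] M} {q : ℕ} {y₀ η₀ : M₀}

theorem pow_y (h : IsInducedPipe f f₀ φ q y₀ η₀) (k : ℕ) : (f ^ k) (φ y₀) = φ y₀ := by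
  induction k with
  | zero => rfl
  | succ k ih => rw [pow_succ, Module.End.mul_apply, h.apply_y, ih]

/-- A kernel element placed in copy `0` is `n 0 • y₀`; the other multiples of `y₀` vanish, and the
sum condition kills `n 0`. -/
theorem injective (h : IsInducedPipe f f₀ φ q y₀ η₀) : Function.Injective φ := by
  refine (injective_iff_map_eq_zero φ).2 fun x hx => ?_
  obtain ⟨n, hn, hn0⟩ := h.ker (fun k => if k = 0 then x else 0) (by
    refine Finset.sum_eq_zero fun k _ => ?_
    split_ifs with hk
    · rw [hx, map_zero]
    · rw [map_zero, map_zero])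
  have h0 : ∀ k ∈ Finset.range q, k ≠ 0 → n k = 0 := fun k hk hk0 => by
    refine h.zsmul_y _ ?_
    rw [← hn k (Finset.mem_range.1 hk), if_neg hk0]
  rw [Finset.sum_eq_single 0 h0 (fun h' => absurd (Finset.mem_range.2 h.pos) h')] at hn0
  have := hn 0 h.pos
  rwa [if_pos rfl, hn0, zero_smul] at this

/-- An element moved by a multiple of `y₀` is fixed, as the automorphism has finite order. -/
theorem eq_zero_of_sub_eq (h : IsInducedPipe f f₀ φ q y₀ η₀) {x : M₀} {m : ℤ}
    (hx : x - f₀ x = m • y₀) : m = 0 := by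
  obtain ⟨n, hn, hf⟩ := h.finite_order
  -- The displacement accumulates under iteration, yet a positive power is the identity and `y₀` has
  -- infinite order.
  have h1 : ∀ k : ℕ, ((f₀ : Module.End ℤ M₀) ^ k) x = x - (k * m : ℤ) • y₀ := by
    intro k
    induction k with
    | zero => simp
    | succ k ih =>
      rw [pow_succ', Module.End.mul_apply, ih]
      change f₀ _ = _
      rw [map_sub, map_zsmul, h.fix_y, show f₀ x = x - m • y₀ by rw [← hx]; abel, sub_sub,
        ← add_smul]
      congr 2
      push_cast; ring
  have h2 := h1 n
  rw [hf, Module.End.one_apply, eq_comm, sub_eq_self] at h2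
  have h3 := h.zsmul_y _ h2
  have : (n : ℤ) ≠ 0 := by exact_mod_cast hn.ne'
  exact (mul_eq_zero.1 h3).resolve_left this

variable (f φ q) in
/-- The alternating sum of the images of an element in the copies of the pipe. -/
noncomputable def theta : M₀ →ₗ[ℤ] M := ∑ k ∈ Finset.range q, ((-1 : ℤ) ^ k) • ((f ^ k : Module.End ℤ M) ∘ₗ φ)

theorem theta_apply (x : M₀) :
    theta f φ q x = ∑ k ∈ Finset.range q, ((-1 : ℤ) ^ k) • (f ^ k) (φ x) := by
  rw [theta, LinearMap.sum_apply]; rfl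

/-- The alternating sum telescopes; the wrap-around term is evaluated by `pow_apply`. -/
theorem theta_add_apply (h : IsInducedPipe f f₀ φ q y₀ η₀) (x : M₀) :
    theta f φ q x + f (theta f φ q x) = φ x - ((-1 : ℤ) ^ q) • φ (f₀ x) := by
  rw [theta_apply, map_sum, ← Finset.sum_add_distrib]
  have := Finset.sum_range_sub' (fun k => ((-1 : ℤ) ^ k) • (f ^ k) (φ x)) q
  rw [h.pow_apply, pow_zero, pow_zero, one_smul, Module.End.one_apply] at this
  rw [← this]
  refine Finset.sum_congr rfl fun k _ => ?_
  rw [map_zsmul, pow_succ (-1 : ℤ), mul_neg_one, neg_smul, sub_neg_eq_add, pow_succ' f,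
    Module.End.mul_apply]

theorem theta_y (h : IsInducedPipe f f₀ φ q y₀ η₀) :
    theta f φ q y₀ = (∑ k ∈ Finset.range q, (-1 : ℤ) ^ k) • φ y₀ := by
  rw [theta_apply, Finset.sum_smul]
  exact Finset.sum_congr rfl fun k _ => by rw [h.pow_y]

theorem sum_neg_one_pow (q : ℕ) : ∑ k ∈ Finset.range q, (-1 : ℤ) ^ k = if Even q then 0 else 1 :=
  neg_one_geom_sum

/-- Applying `f` to the terms of odd index gives those of even index from `2` on. For even `q` the
index `q` wraps around to `0`; for odd `q` the term of index `0` is missing. -/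
theorem add_apply_sum (h : IsInducedPipe f f₀ φ q y₀ η₀) :
    (∑ k ∈ Finset.range q, (if Even k then (0 : ℤ) else 1) • (f ^ k) (φ η₀)) +
      f (∑ k ∈ Finset.range q, (if Even k then (0 : ℤ) else 1) • (f ^ k) (φ η₀)) =
    ∑ k ∈ Finset.range q, (f ^ k) (φ η₀) - (if Even q then (0 : ℤ) else 1) • φ η₀ := by
  let g : ℕ → M := fun k => (if Even k then (1 : ℤ) else 0) • (f ^ k) (φ η₀)
  have h1 : f (∑ k ∈ Finset.range q, (if Even k then (0 : ℤ) else 1) • (f ^ k) (φ η₀)) =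
      ∑ k ∈ Finset.range q, g (k + 1) := by
    rw [map_sum]
    refine Finset.sum_congr rfl fun k _ => ?_
    simp only [g, Nat.even_add_one, map_zsmul, pow_succ', Module.End.mul_apply]
    split_ifs <;> simp_all
  have h2 : ∑ k ∈ Finset.range q, g (k + 1) = ∑ k ∈ Finset.range q, g k + (g q - g 0) := by
    rw [← Finset.sum_range_sub, ← Finset.sum_add_distrib]
    exact Finset.sum_congr rfl fun k _ => by abel
  rw [h1, h2, ← add_assoc, ← Finset.sum_add_distrib]
  have h3 : g q - g 0 = -((if Even q then (0 : ℤ) else 1) • φ η₀) := by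
    simp only [g, h.pow_apply, h.fix_eta, Even.zero, if_true, pow_zero, Module.End.one_apply]
    split_ifs <;> simp
  rw [h3, ← sub_eq_add_neg]
  congr 1
  refine Finset.sum_congr rfl fun k _ => ?_
  simp only [g]
  split_ifs <;> simp

/-- The elements `z` of the induced pipe for which `(1 + f)z` is a combination of `y` and `η`. -/
theorem exists_of_add_apply_eq (h : IsInducedPipe f f₀ φ q y₀ η₀) {z : M} {a b : ℤ}
    (hz : z + f z = a • φ y₀ + b • ∑ k ∈ Finset.range q, (f ^ k) (φ η₀)) :
    ∃ x₀ : M₀, ∃ c : ℤ,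
      z = theta f φ q x₀ +
        b • (∑ k ∈ Finset.range q, (if Even k then (0 : ℤ) else 1) • (f ^ k) (φ η₀)) + c • φ y₀ ∧
      x₀ - ((-1 : ℤ) ^ q) • f₀ x₀ =
        (b * if Even q then 0 else 1) • η₀ + (a - 2 * c) • y₀ := by
  obtain ⟨x, hx⟩ := h.surj z
  obtain ⟨m, hm⟩ : ∃ m, q = m + 1 := ⟨q - 1, by have := h.pos; omega⟩
  -- These are the coordinates of `z + f z` minus the prescribed value: `f` shifts copies, wrapping
  -- the last one around through `f₀`, and `y` is placed in copy `0`.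
  let x' : ℕ → M₀ := fun k => x k + (if k = 0 then f₀ (x m) else x (k - 1)) - b • η₀ -
    if k = 0 then a • y₀ else 0
  have hx' : ∑ k ∈ Finset.range q, (f ^ k) (φ (x' k)) = 0 := by
    have e1 : ∑ k ∈ Finset.range q, (f ^ k) (φ (if k = 0 then f₀ (x m) else x (k - 1))) = f z := by
      rw [← hx, map_sum, hm, Finset.sum_range_succ', Finset.sum_range_succ]
      congr 1
      · refine Finset.sum_congr rfl fun k _ => ?_
        rw [if_neg (Nat.succ_ne_zero k), Nat.add_sub_cancel, pow_succ', Module.End.mul_apply]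
      · rw [if_pos rfl, ← h.pow_apply, hm, pow_succ', Module.End.mul_apply]; rfl
    have e2 : ∑ k ∈ Finset.range q, (f ^ k) (φ (if k = 0 then a • y₀ else 0)) = a • φ y₀ := by
      rw [Finset.sum_eq_single 0]
      · rw [if_pos rfl, map_zsmul]; rfl
      · intro k _ hk; rw [if_neg hk, map_zero, map_zero]
      · intro h'; exact absurd (Finset.mem_range.2 h.pos) h'
    simp only [x', map_sub, map_add, Finset.sum_sub_distrib, Finset.sum_add_distrib, e1, e2, hx, hz,
      map_zsmul, ← Finset.smul_sum]
    abel
  obtain ⟨n, hn, -⟩ := h.ker x' hx'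
  -- Modulo `y₀`, consecutive coordinates add up to `b η₀`, so all are determined by the first: the
  -- sign alternates and `b η₀` appears at odd indices.
  have hrec : ∀ k, k < q → ∃ c : ℤ, x k = ((-1 : ℤ) ^ k) • x 0 +
      (b * if Even k then (0 : ℤ) else 1) • η₀ + c • y₀ := by
    intro k
    induction k with
    | zero => intro _; exact ⟨0, by simp⟩
    | succ k ih =>
      intro hk
      obtain ⟨c, hc⟩ := ih (by omega)
      have := hn (k + 1) hk
      simp only [x', if_neg (Nat.succ_ne_zero k), Nat.add_sub_cancel, sub_zero] at this
      refine ⟨n (k + 1) - c, ?_⟩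
      have e : x (k + 1) = n (k + 1) • y₀ + b • η₀ - x k := by rw [← this]; abel
      rw [e, hc, pow_succ, sub_smul]
      simp only [Nat.even_add_one]
      split_ifs <;> simp <;> abel
  choose! c hc using hrec
  have hzeq : z = theta f φ q (x 0) +
      b • (∑ k ∈ Finset.range q, (if Even k then (0 : ℤ) else 1) • (f ^ k) (φ η₀)) +
        (∑ k ∈ Finset.range q, c k) • φ y₀ := by
    rw [← hx, theta_apply, Finset.smul_sum, Finset.sum_smul, ← Finset.sum_add_distrib,
      ← Finset.sum_add_distrib]
    refine Finset.sum_congr rfl fun k hk => ?_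
    conv_lhs => rw [hc k (Finset.mem_range.1 hk)]
    simp only [map_add, map_zsmul, h.pow_y, mul_smul]
  -- The condition on `x 0` follows by applying `1 + f` to the resulting formula for `z`, with the
  -- telescoping identities for its parts.
  refine ⟨x 0, ∑ k ∈ Finset.range q, c k, hzeq, h.injective ?_⟩
  generalize (∑ k ∈ Finset.range q, c k) = C at hzeq
  have h1 := h.theta_add_apply (x 0)
  have h2 := h.add_apply_sum
  generalize (∑ k ∈ Finset.range q, (if Even k then (0 : ℤ) else 1) • (f ^ k) (φ η₀)) = O at *
  generalize (∑ k ∈ Finset.range q, (f ^ k) (φ η₀)) = E at *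
  rw [map_sub, map_zsmul, ← h1, map_add, map_zsmul, map_zsmul, mul_smul]
  have h3 : f O = E - (if Even q then (0 : ℤ) else 1) • φ η₀ - O := by rw [← h2]; abel
  have h4 : f (theta f φ q (x 0)) = f z - b • f O - C • φ y₀ := by
    rw [hzeq, map_add, map_add, map_zsmul, map_zsmul, h.apply_y]; abel
  have h5 : f z = a • φ y₀ + b • E - z := by rw [← hz]; abel
  rw [h4, h5, h3]
  rw [hzeq]
  simp only [smul_sub, sub_smul, mul_smul, two_smul]
  abel

/-- For odd `q` the anti-invariants of the induced pipe are those of the original pipe. -/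
theorem exists_equiv_odd (h : IsInducedPipe f f₀ φ q y₀ η₀) (hq : Odd q) {g : M ≃ₗ[ℤ] M}
    (hg : ∀ x, g x = f x) :
    ∃ e : fixedBy (negAut f₀) ≃+ fixedBy (negAut g), ∀ x, (e x : M) = theta f φ q x := by
  have hqe : ¬ Even q := Nat.not_even_iff_odd.2 hq
  have hmem : ∀ x : fixedBy (negAut f₀), theta f φ q x ∈ fixedBy (negAut g) := fun x => by
    rw [mem_fixedBy_negAut, hg, eq_neg_iff_add_eq_zero, add_comm, h.theta_add_apply,
      (mem_fixedBy_negAut f₀ _).1 x.2, hq.neg_one_pow]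
    simp
  let e : fixedBy (negAut f₀) →+ fixedBy (negAut g) :=
    ((theta f φ q).comp (fixedBy (negAut f₀)).subtype).toAddMonoidHom.codRestrict _ hmem
  have he : ∀ x, (e x : M) = theta f φ q x := fun x => rfl
  refine ⟨AddEquiv.ofBijective e ⟨(injective_iff_map_eq_zero e).2 fun x hx => ?_, ?_⟩, he⟩
  · have hx' : theta f φ q x = 0 := by rw [← he, hx]; rfl
    rw [theta_apply] at hx'
    obtain ⟨n, hn, -⟩ := h.ker (fun k => ((-1 : ℤ) ^ k) • (x : M₀)) (by
      rw [← hx']; exact Finset.sum_congr rfl fun k _ => by rw [map_zsmul, map_zsmul])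
    have h0 : (x : M₀) = n 0 • y₀ := by simpa using hn 0 h.pos
    have h1 := (mem_fixedBy_negAut f₀ _).1 x.2
    rw [h0, map_zsmul, h.fix_y, eq_neg_iff_add_eq_zero, ← add_smul] at h1
    have h2 := h.zsmul_y _ h1
    have h3 : n 0 = 0 := by omega
    exact Subtype.ext (by rw [h0, h3, zero_smul]; rfl)
  · rintro ⟨z, hz⟩
    rw [mem_fixedBy_negAut, hg] at hz
    obtain ⟨x₀, c, hz', hx₀⟩ := h.exists_of_add_apply_eq (z := z) (a := 0) (b := 0) (by
      rw [hz]; simp)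
    simp only [hq.neg_one_pow, neg_smul, one_smul, zero_smul, zero_mul, zero_add, zero_sub,
      sub_neg_eq_add, add_zero] at hz' hx₀
    -- Adding `c y₀` cancels `-2c y₀` in `x₀ + f₀ x₀` and accounts for the term `c φ(y₀)` of `z`, as
    -- `theta` sends `y₀` to `φ y₀` for odd `q`.
    refine ⟨⟨x₀ + c • y₀, ?_⟩, Subtype.ext ?_⟩
    · rw [mem_fixedBy_negAut, map_add, map_zsmul, h.fix_y, eq_sub_of_add_eq' hx₀, mul_smul,
        two_smul]
      abel
    · rw [he]
      change theta f φ q (x₀ + c • y₀) = z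
      rw [hz', map_add, map_zsmul, h.theta_y, sum_neg_one_pow, if_neg hqe, one_smul]

/-- For even `q` the anti-invariants of the induced pipe are the quotient of the invariants of the
original pipe by the subgroup generated by `y₀`. -/
theorem exists_equiv_even (h : IsInducedPipe f f₀ φ q y₀ η₀) (hq : Even q) {g : M ≃ₗ[ℤ] M}
    (hg : ∀ x, g x = f x) (Y : fixedBy f₀) (hY : (Y : M₀) = y₀) :
    ∃ e : (fixedBy f₀ ⧸ AddSubgroup.zmultiples Y) ≃+ fixedBy (negAut g),
      ∀ x : fixedBy f₀, (e (QuotientAddGroup.mk x) : M) = theta f φ q x := by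
  have hmem : ∀ x : fixedBy f₀, theta f φ q x ∈ fixedBy (negAut g) := fun x => by
    rw [mem_fixedBy_negAut, hg, eq_neg_iff_add_eq_zero, add_comm, h.theta_add_apply,
      show f₀ x = x from x.2, hq.neg_one_pow]
    simp
  let e' : fixedBy f₀ →+ fixedBy (negAut g) :=
    ((theta f φ q).comp (fixedBy f₀).subtype).toAddMonoidHom.codRestrict _ hmem
  have he' : ∀ x, (e' x : M) = theta f φ q x := fun x => rfl
  let e : (fixedBy f₀ ⧸ AddSubgroup.zmultiples Y) →+ fixedBy (negAut g) :=
    QuotientAddGroup.lift _ e' (by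
      rw [AddSubgroup.zmultiples_le, AddMonoidHom.mem_ker]
      refine Subtype.ext ?_
      rw [he', hY, h.theta_y, sum_neg_one_pow, if_pos hq, zero_smul]; rfl)
  have he : ∀ x : fixedBy f₀, e (QuotientAddGroup.mk x) = e' x := fun x => rfl
  refine ⟨AddEquiv.ofBijective e ⟨(injective_iff_map_eq_zero e).2 fun x hx => ?_, ?_⟩,
    fun x => rfl⟩
  · obtain ⟨x, rfl⟩ := QuotientAddGroup.mk_surjective x
    have hx' : theta f φ q x = 0 := by rw [← he', ← he, hx]; rfl
    rw [theta_apply] at hx'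
    obtain ⟨n, hn, -⟩ := h.ker (fun k => ((-1 : ℤ) ^ k) • (x : M₀)) (by
      rw [← hx']; exact Finset.sum_congr rfl fun k _ => by rw [map_zsmul, map_zsmul])
    have h0 : (x : M₀) = n 0 • y₀ := by simpa using hn 0 h.pos
    rw [QuotientAddGroup.eq_zero_iff, AddSubgroup.mem_zmultiples_iff]
    exact ⟨n 0, Subtype.ext (by rw [h0, ← hY]; rfl)⟩
  · rintro ⟨z, hz⟩
    rw [mem_fixedBy_negAut, hg] at hz
    obtain ⟨x₀, c, hz', hx₀⟩ := h.exists_of_add_apply_eq (z := z) (a := 0) (b := 0) (by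
      rw [hz]; simp)
    simp only [hq.neg_one_pow, one_smul, zero_smul, zero_mul, zero_add, zero_sub, add_zero]
      at hz' hx₀
    -- For even `q` the equation reads `x₀ - f₀ x₀ = -2c y₀`, and finite order forces `c = 0`.
    have h0 := h.eq_zero_of_sub_eq hx₀
    obtain rfl : c = 0 := by omega
    refine ⟨QuotientAddGroup.mk ⟨x₀, ?_⟩, Subtype.ext ?_⟩
    · rw [h0, zero_smul] at hx₀
      exact (sub_eq_zero.1 hx₀).symm
    · rw [he, he']
      change theta f φ q x₀ = z
      rw [hz', zero_smul, add_zero]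

/-- For even `q` the element `η` is of the form `(1 + f)β`. -/
theorem exists_beta_even (h : IsInducedPipe f f₀ φ q y₀ η₀) (hq : Even q) :
    ∃ β, β + f β = ∑ k ∈ Finset.range q, (f ^ k) (φ η₀) ∧ β - f β = theta f φ q η₀ := by
  let O := ∑ k ∈ Finset.range q, (if Even k then (0 : ℤ) else 1) • (f ^ k) (φ η₀)
  have h1 : O + f O = _ := h.add_apply_sum
  rw [if_pos hq, zero_smul, sub_zero] at h1
  have h2 : theta f φ q η₀ = f O - O := by
    have h3 : f O = ∑ k ∈ Finset.range q, (f ^ k) (φ η₀) - O := by rw [← h1]; abel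
    rw [h3, theta_apply, ← Finset.sum_sub_distrib, ← Finset.sum_sub_distrib]
    refine Finset.sum_congr rfl fun k _ => ?_
    by_cases hk : Even k
    · simp [hk]
    · rw [(Nat.not_even_iff_odd.1 hk).neg_one_pow]; simp [hk]
  have h3 : f (f O) = O := by
    have e : f (theta f φ q η₀) = -theta f φ q η₀ := by
      rw [eq_neg_iff_add_eq_zero, add_comm, h.theta_add_apply, h.fix_eta, hq.neg_one_pow, one_smul,
        sub_self]
    rw [h2, map_sub, neg_sub] at e
    exact sub_left_injective e
  -- Both `O` and `f O` solve the equation; `f O`, made of the terms of even index, gives `theta` of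
  -- `η₀` with the positive sign.
  exact ⟨f O, by rw [h3, add_comm, h1], by rw [h3, h2]⟩

/-- For odd `q` solutions `β` of `(1 + f)β = γ` are induced. -/
theorem exists_beta_odd (h : IsInducedPipe f f₀ φ q y₀ η₀) (hq : Odd q) {a b : ℤ} {β₀ : M₀}
    (hβ : β₀ + f₀ β₀ = a • y₀ + b • η₀) :
    ∃ β, β + f β = a • φ y₀ + b • ∑ k ∈ Finset.range q, (f ^ k) (φ η₀) ∧
      β - f β = theta f φ q (β₀ - f₀ β₀) := by
  obtain ⟨m, rfl⟩ := hq
  set q := 2 * m + 1 with hq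
  set B := theta f φ q β₀ with hB
  have h1 : B + f B = a • φ y₀ + b • φ η₀ := by
    rw [hB, h.theta_add_apply, hq, Odd.neg_one_pow ⟨m, rfl⟩, neg_one_smul, sub_neg_eq_add,
      ← map_add, hβ, map_add, map_zsmul, map_zsmul]
  have h2 : (f ^ q) B = theta f φ q (f₀ β₀) := by
    rw [hB, theta_apply, theta_apply, map_sum]
    refine Finset.sum_congr rfl fun k _ => ?_
    rw [map_zsmul, ← h.pow_apply, ← Module.End.mul_apply, ← Module.End.mul_apply, ← pow_add,
      ← pow_add, add_comm]
  have h3 : ∑ k ∈ Finset.range q, (f ^ k) B + f (∑ k ∈ Finset.range q, (f ^ k) B) =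
      (q : ℤ) • a • φ y₀ + b • ∑ k ∈ Finset.range q, (f ^ k) (φ η₀) := by
    rw [map_sum, ← Finset.sum_add_distrib, Finset.smul_sum]
    have : ∀ k ∈ Finset.range q, (f ^ k) B + f ((f ^ k) B) =
        a • φ y₀ + b • (f ^ k) (φ η₀) := fun k _ => by
      rw [← Module.End.mul_apply, ← pow_succ', pow_succ, Module.End.mul_apply, ← map_add, h1,
        map_add, map_zsmul, map_zsmul, h.pow_y]
    rw [Finset.sum_congr rfl this, Finset.sum_add_distrib, Finset.sum_const, Finset.card_range,
      natCast_zsmul]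
  have h4 : ∑ k ∈ Finset.range q, (f ^ k) B - f (∑ k ∈ Finset.range q, (f ^ k) B) =
      B - (f ^ q) B := by
    rw [map_sum, ← Finset.sum_sub_distrib]
    have := Finset.sum_range_sub' (fun k => (f ^ k) B) q
    simp only [pow_zero, Module.End.one_apply] at this
    rw [← this]
    exact Finset.sum_congr rfl fun k _ => by rw [pow_succ', Module.End.mul_apply]
  -- Summing over the copies yields `q a` times `y` instead of `a` times; as `q = 2m + 1`,
  -- subtracting the invariant `m a y` repairs this and leaves `1 - f` unaffected.
  refine ⟨∑ k ∈ Finset.range q, (f ^ k) B - (m * a : ℤ) • φ y₀, ?_, ?_⟩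
  · rw [map_sub, map_zsmul, h.apply_y, sub_add_sub_comm, h3, ← mul_smul, hq]
    push_cast
    rw [add_sub_right_comm, ← add_smul, ← sub_smul]
    congr 2
    ring
  · rw [map_sub, map_zsmul, h.apply_y, sub_sub_sub_cancel_right, h4, h2, hB, map_sub]

end IsInducedPipe

namespace MarkedBYTree

/-! ### Subtrees -/

open Classical in
/-- The marked BY tree formed by a connected set of vertices, a marked vertex and an isometric
automorphism preserving this set. -/
noncomputable def sub (T : MarkedBYTree.{u}) (H : Set T.V) (hH : (T.graph.induce H).Connected)
    (F : T.graph ≃g T.graph) (hlen : ∀ e ∈ T.graph.edgeSet, T.len (e.map F) = T.len e)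
    (hS : ∀ v, F v ∈ T.S ↔ v ∈ T.S) (hFH : ∀ v, F v ∈ H ↔ v ∈ H) (p : T.V) (hp : p ∈ H)
    (hpS : p ∉ T.S) (hFp : F p = p) (hne : ∃ s ∈ T.S, s ∈ H) : MarkedBYTree.{u} where
  V := H
  fintypeV := Fintype.ofFinite H
  graph := T.graph.induce H
  isTree := ⟨hH, T.isTree.2.induce H⟩
  len e := T.len (e.map Subtype.val)
  len_pos e he := by
    induction e with
    | _ u v => exact T.len_pos _ he
  S := {v | v.1 ∈ T.S}
  S_nonempty := by obtain ⟨s, hs, hsH⟩ := hne; exact ⟨⟨s, hsH⟩, hs⟩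
  S_degree_one := by
    rintro ⟨s, hsH⟩ hs
    have hsp : s ≠ p := by rintro rfl; exact hpS hs
    -- The mark is a second vertex, so connectedness keeps a neighbour of `s` in the subtree; its
    -- uniqueness is inherited.
    have : Nontrivial H := ⟨⟨s, hsH⟩, ⟨p, hp⟩, fun h => hsp (congrArg Subtype.val h)⟩
    obtain ⟨w, hw⟩ := hH.preconnected.exists_adj_of_nontrivial ⟨s, hsH⟩
    refine ⟨w, hw, fun w' hw' => Subtype.ext ?_⟩
    exact (T.S_degree_one s hs).unique hw' hw
  F := {
    toFun := fun v => ⟨F v, (hFH v).2 v.2⟩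
    invFun := fun v => ⟨F.symm v, by rw [← hFH, RelIso.apply_symm_apply]; exact v.2⟩
    left_inv := fun v => Subtype.ext (F.symm_apply_apply v.1)
    right_inv := fun v => Subtype.ext (F.apply_symm_apply v.1)
    map_rel_iff' := F.map_adj_iff }
  F_len e he := by
    induction e with
    | _ u v => exact hlen s(u.1, v.1) he
  F_S v := hS v
  pt := ⟨p, hp⟩
  pt_notMem := hpS
  F_pt := Subtype.ext hFp

section Sub

variable {T : MarkedBYTree.{u}} {H : Set T.V} {hH : (T.graph.induce H).Connected}
  {F : T.graph ≃g T.graph} {hlen : ∀ e ∈ T.graph.edgeSet, T.len (e.map F) = T.len e}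
  {hS : ∀ v, F v ∈ T.S ↔ v ∈ T.S} {hFH : ∀ v, F v ∈ H ↔ v ∈ H} {p : T.V} {hp : p ∈ H}
  {hpS : p ∉ T.S} {hFp : F p = p} {hne : ∃ s ∈ T.S, s ∈ H}

variable (T H hH F hlen hS hFH p hp hpS hFp hne) in
/-- The inclusion of a subtree. -/
def subEmb : Emb (T.sub H hH F hlen hS hFH p hp hpS hFp hne) T where
  toEmb := SimpleGraph.Embedding.induce H
  len_eq _ _ := rfl

theorem range_subEmb :
    Set.range (subEmb T H hH F hlen hS hFH p hp hpS hFp hne).toEmb = H :=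
  Subtype.range_coe

theorem image_subEmb (h : ∀ s ∈ T.S, s ∈ H) :
    T.S = (subEmb T H hH F hlen hS hFH p hp hpS hFp hne).toEmb ''
      (T.sub H hH F hlen hS hFH p hp hpS hFp hne).S := by
  ext s
  constructor
  · exact fun hs => ⟨⟨s, h s hs⟩, hs, rfl⟩
  · rintro ⟨v, hv, rfl⟩; exact hv

theorem card_sub_lt {v : T.V} (hv : v ∉ H) :
    Fintype.card (T.sub H hH F hlen hS hFH p hp hpS hFp hne).V < Fintype.card T.V :=
  Fintype.card_lt_of_injective_of_notMem
    (subEmb T H hH F hlen hS hFH p hp hpS hFp hne).toEmb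
    (subEmb T H hH F hlen hS hFH p hp hpS hFp hne).toEmb.injective (b := v)
    (by rwa [range_subEmb])

end Sub

/-! ### Branches at the marked vertex -/

/-- Two vertices are joined by a walk avoiding the marked vertex. -/
def Joined (T : MarkedBYTree.{u}) (a v : T.V) : Prop :=
  ∃ p : T.graph.Walk a v, T.pt ∉ p.support

theorem Joined.refl {T : MarkedBYTree.{u}} {a : T.V} (ha : a ≠ T.pt) : T.Joined a a :=
  ⟨.nil, by simpa using ha.symm⟩

theorem Joined.symm {T : MarkedBYTree.{u}} {a v : T.V} (h : T.Joined a v) : T.Joined v a := by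
  obtain ⟨p, hp⟩ := h
  exact ⟨p.reverse, by simpa using hp⟩

theorem Joined.trans {T : MarkedBYTree.{u}} {a v w : T.V} (h : T.Joined a v) (h' : T.Joined v w) :
    T.Joined a w := by
  obtain ⟨p, hp⟩ := h
  obtain ⟨q, hq⟩ := h'
  exact ⟨p.append q, by rw [SimpleGraph.Walk.mem_support_append_iff]; tauto⟩

theorem Joined.ne_pt {T : MarkedBYTree.{u}} {a v : T.V} (h : T.Joined a v) : v ≠ T.pt := by
  obtain ⟨p, hp⟩ := h
  rintro rfl
  exact hp p.end_mem_support

theorem Joined.of_adj {T : MarkedBYTree.{u}} {v w : T.V} (h : T.graph.Adj v w) (hv : v ≠ T.pt)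
    (hw : w ≠ T.pt) : T.Joined v w :=
  ⟨.cons h .nil, by simp [hv.symm, hw.symm]⟩

theorem Joined.map {T : MarkedBYTree.{u}} {a v : T.V} (h : T.Joined a v) (F : T.graph ≃g T.graph)
    (hF : F T.pt = T.pt) : T.Joined (F a) (F v) := by
  obtain ⟨p, hp⟩ := h
  refine ⟨p.map F.toHom, ?_⟩
  rw [SimpleGraph.Walk.support_map, List.mem_map]
  rintro ⟨x, hx, hxp⟩
  have : x = T.pt := F.injective (hxp.trans hF.symm)
  exact hp (this ▸ hx)

theorem joined_map_iff {T : MarkedBYTree.{u}} {a v : T.V} (F : T.graph ≃g T.graph)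
    (hF : F T.pt = T.pt) : T.Joined (F a) (F v) ↔ T.Joined a v := by
  refine ⟨fun h => ?_, fun h => h.map F hF⟩
  have := h.map F.symm (by rw [RelIso.symm_apply_eq, hF])
  rwa [RelIso.symm_apply_apply, RelIso.symm_apply_apply] at this

theorem exists_joined (T : MarkedBYTree.{u}) {v : T.V} (hv : v ≠ T.pt) :
    ∃ a, T.graph.Adj T.pt a ∧ T.Joined a v := by
  obtain ⟨p, hp, -⟩ := T.isTree.existsUnique_path T.pt v
  cases p with
  | nil => exact absurd rfl hv
  | cons h q => exact ⟨_, h, q, ((SimpleGraph.Walk.cons_isPath_iff _ _).1 hp).2⟩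

/-- Otherwise there would be two paths from the mark to `b`: the edge itself and one through `a`.
Hence the branches correspond to the neighbours of the mark. -/
theorem eq_of_joined (T : MarkedBYTree.{u}) {a b : T.V} (ha : T.graph.Adj T.pt a)
    (hb : T.graph.Adj T.pt b) (h : T.Joined a b) : a = b := by
  classical
  obtain ⟨p, hp⟩ := h
  have h1 : T.pt ∉ p.bypass.support := fun h => hp (p.support_bypass_subset_support h)
  have h2 : (SimpleGraph.Walk.cons ha p.bypass).IsPath :=
    (SimpleGraph.Walk.cons_isPath_iff _ _).2 ⟨p.bypass_isPath, h1⟩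
  have h3 : (SimpleGraph.Walk.cons hb (.nil : T.graph.Walk b b)).IsPath := by
    simp [hb.ne]
  have h4 := congrArg (fun q : T.graph.Path T.pt b => q.1.snd)
    ((T.isTree.2.subsingleton_path T.pt b).elim ⟨_, h2⟩ ⟨_, h3⟩)
  simpa using h4

/-- The marked vertex together with the branches at the marked vertex containing elements of `A`. -/
def branches (T : MarkedBYTree.{u}) (A : Set T.V) : Set T.V :=
  {v | v = T.pt ∨ ∃ a ∈ A, T.Joined a v}

theorem pt_mem_branches (T : MarkedBYTree.{u}) (A : Set T.V) : T.pt ∈ T.branches A := Or.inl rfl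

theorem branches_connected (T : MarkedBYTree.{u}) {A : Set T.V}
    (hA : ∀ a ∈ A, T.graph.Adj T.pt a) : (T.graph.induce (T.branches A)).Connected := by
  classical
  have hpt : T.pt ∈ T.branches A := Or.inl rfl
  rw [SimpleGraph.connected_iff_exists_forall_reachable]
  refine ⟨⟨T.pt, hpt⟩, ?_⟩
  rintro ⟨v, rfl | ⟨a, ha, p, hp⟩⟩
  · exact SimpleGraph.Reachable.refl _
  · have hsupp : ∀ x ∈ (SimpleGraph.Walk.cons (hA a ha) p).support, x ∈ T.branches A := by
      intro x hx
      rw [SimpleGraph.Walk.support_cons, List.mem_cons] at hx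
      rcases hx with rfl | hx
      · exact hpt
      · exact Or.inr ⟨a, ha, p.takeUntil x hx, fun h =>
          hp (p.support_takeUntil_subset_support hx h)⟩
    exact ⟨(SimpleGraph.Walk.cons (hA a ha) p).induce _ hsupp⟩

theorem map_mem_branches (T : MarkedBYTree.{u}) {A : Set T.V} (F : T.graph ≃g T.graph)
    (hF : F T.pt = T.pt) (hA : ∀ a, F a ∈ A ↔ a ∈ A) (v : T.V) :
    F v ∈ T.branches A ↔ v ∈ T.branches A := by
  refine or_congr ?_ ⟨?_, ?_⟩
  · conv_lhs => rw [← hF]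
    exact F.injective.eq_iff
  · rintro ⟨a, ha, h⟩
    obtain ⟨a, rfl⟩ := F.surjective a
    exact ⟨a, (hA a).1 ha, (joined_map_iff F hF).1 h⟩
  · rintro ⟨a, ha, h⟩
    exact ⟨F a, (hA a).2 ha, h.map F hF⟩

theorem notMem_branches (T : MarkedBYTree.{u}) {A : Set T.V} (hA : ∀ a ∈ A, T.graph.Adj T.pt a)
    {b : T.V} (hb : T.graph.Adj T.pt b) (hbA : b ∉ A) : b ∉ T.branches A := by
  rintro (rfl | ⟨a, ha, h⟩)
  · exact T.graph.irrefl hb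
  · exact hbA (T.eq_of_joined (hA a ha) hb h ▸ ha)

/-- Adjacent vertices lie in a common branch. -/
theorem exists_of_adj (T : MarkedBYTree.{u}) {v w : T.V} (h : T.graph.Adj v w) :
    ∃ a, T.graph.Adj T.pt a ∧ v ∈ T.branches {a} ∧ w ∈ T.branches {a} := by
  by_cases hv : v = T.pt
  · subst hv
    exact ⟨w, h, Or.inl rfl, Or.inr ⟨w, rfl, Joined.refl h.ne'⟩⟩
  · obtain ⟨a, ha, hav⟩ := T.exists_joined hv
    refine ⟨a, ha, Or.inr ⟨a, rfl, hav⟩, ?_⟩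
    by_cases hw : w = T.pt
    · exact Or.inl hw
    · exact Or.inr ⟨a, rfl, hav.trans (Joined.of_adj h hv hw)⟩

theorem branches_mono (T : MarkedBYTree.{u}) {A B : Set T.V} (h : A ⊆ B) :
    T.branches A ⊆ T.branches B := by
  rintro v (hv | ⟨a, ha, hv⟩)
  exacts [Or.inl hv, Or.inr ⟨a, h ha, hv⟩]

theorem adj_pt_map (T : MarkedBYTree.{u}) {a : T.V} (F : T.graph ≃g T.graph)
    (hF : F T.pt = T.pt) : T.graph.Adj T.pt (F a) ↔ T.graph.Adj T.pt a := by
  conv_lhs => rw [← hF]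
  exact F.map_adj_iff

/-! ### Generation -/

/-- The iterates of `F` as automorphisms. -/
theorem exists_iterate (T : MarkedBYTree.{u}) (k : ℕ) : ∃ F : T.graph ≃g T.graph,
    (∀ v, F v = T.F^[k] v) ∧ (∀ e ∈ T.graph.edgeSet, T.len (e.map F) = T.len e) ∧
    (∀ v, F v ∈ T.S ↔ v ∈ T.S) ∧ F T.pt = T.pt := by
  induction k with
  | zero => exact ⟨RelIso.refl _, fun _ => rfl, fun e _ => by
      rw [show ⇑(RelIso.refl T.graph.Adj) = id from rfl, Sym2.map_id]; rfl, fun _ => Iff.rfl, rfl⟩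
  | succ k ih =>
    obtain ⟨F, h1, h2, h3, h4⟩ := ih
    refine ⟨F.trans T.F, fun v => ?_, fun e he => ?_, fun v => ?_, ?_⟩
    · rw [Function.iterate_succ_apply', ← h1]; rfl
    · rw [← h2 e he, ← T.F_len (e.map F), Sym2.map_map]
      · rfl
      · induction e with
        | _ a b => exact F.map_adj_iff.2 he
    · exact (T.F_S _).trans (h3 v)
    · change T.F (F T.pt) = _
      rw [h4, T.F_pt]

/-- Discarding the branches without elements of `S` leaves a smaller tree with the same `S`, of
which `T` is an enlargement. -/
theorem generated_of_dead_branch {T : MarkedBYTree.{u}}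
    (ih : ∀ T₀ : MarkedBYTree.{u}, Fintype.card T₀.V < Fintype.card T.V → T₀.Generated)
    {a : T.V} (ha : T.graph.Adj T.pt a) (hdead : ∀ s ∈ T.S, ¬ T.Joined a s) : T.Generated := by
  set A : Set T.V := {b | T.graph.Adj T.pt b ∧ ∃ s ∈ T.S, T.Joined b s} with hA
  have hadj : ∀ b ∈ A, T.graph.Adj T.pt b := fun b hb => hb.1
  have hS : ∀ s ∈ T.S, s ∈ T.branches A := fun s hs => by
    obtain ⟨b, hb, hbs⟩ := T.exists_joined (T.ne_pt hs)
    exact Or.inr ⟨b, ⟨hb, s, hs, hbs⟩, hbs⟩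
  have hFA : ∀ b, T.F b ∈ A ↔ b ∈ A := fun b => by
    refine and_congr (T.adj_pt_map T.F T.F_pt) ⟨?_, ?_⟩
    · rintro ⟨s, hs, h⟩
      obtain ⟨s, rfl⟩ := T.F.surjective s
      exact ⟨s, (T.F_S s).1 hs, (joined_map_iff T.F T.F_pt).1 h⟩
    · rintro ⟨s, hs, h⟩
      exact ⟨T.F s, (T.F_S s).2 hs, h.map T.F T.F_pt⟩
  have hne : ∃ s ∈ T.S, s ∈ T.branches A := T.S_nonempty.imp fun s hs => ⟨hs, hS s hs⟩
  refine .enlarge T (T.sub (T.branches A) (T.branches_connected hadj) T.F T.F_len T.F_S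
    (T.map_mem_branches T.F T.F_pt hFA) T.pt (T.pt_mem_branches _) T.pt_notMem T.F_pt hne)
    ⟨subEmb .., rfl, image_subEmb hS, fun v => rfl⟩ (ih _ (card_sub_lt (v := a) ?_))
  exact T.notMem_branches hadj ha fun h => by
    obtain ⟨-, s, hs, h⟩ := h
    exact hdead s hs h

/-- An `F`-stable set of neighbours and its complement, both non-empty, split the tree at the mark;
`hlive` gives each part an element of `S`. -/
theorem generated_of_wedge {T : MarkedBYTree.{u}}
    (ih : ∀ T₀ : MarkedBYTree.{u}, Fintype.card T₀.V < Fintype.card T.V → T₀.Generated)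
    (hlive : ∀ a, T.graph.Adj T.pt a → ∃ s ∈ T.S, T.Joined a s)
    {A : Set T.V} (hA : ∀ a ∈ A, T.graph.Adj T.pt a) (hFA : ∀ a, T.F a ∈ A ↔ a ∈ A)
    {a b : T.V} (ha : a ∈ A) (hb : T.graph.Adj T.pt b) (hbA : b ∉ A) : T.Generated := by
  set B : Set T.V := {b | T.graph.Adj T.pt b ∧ b ∉ A} with hB
  have hBadj : ∀ b ∈ B, T.graph.Adj T.pt b := fun b hb => hb.1
  have hFB : ∀ b, T.F b ∈ B ↔ b ∈ B := fun b =>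
    and_congr (T.adj_pt_map T.F T.F_pt) (not_congr (hFA b))
  have hne : ∀ {C : Set T.V} {c : T.V}, c ∈ C → (∀ c ∈ C, T.graph.Adj T.pt c) →
      ∃ s ∈ T.S, s ∈ T.branches C := fun hc hC => by
    obtain ⟨s, hs, h⟩ := hlive _ (hC _ hc)
    exact ⟨s, hs, Or.inr ⟨_, hc, h⟩⟩
  have hcov : ∀ v, v ∈ T.branches A ∨ v ∈ T.branches B := fun v => by
    by_cases hv : v = T.pt
    · exact Or.inl (Or.inl hv)
    · obtain ⟨c, hc, hcv⟩ := T.exists_joined hv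
      by_cases hcA : c ∈ A
      · exact Or.inl (Or.inr ⟨c, hcA, hcv⟩)
      · exact Or.inr (Or.inr ⟨c, ⟨hc, hcA⟩, hcv⟩)
  refine .wedge T
    (T.sub (T.branches A) (T.branches_connected hA) T.F T.F_len T.F_S
      (T.map_mem_branches T.F T.F_pt hFA) T.pt (T.pt_mem_branches _) T.pt_notMem T.F_pt (hne ha hA))
    (T.sub (T.branches B) (T.branches_connected hBadj) T.F T.F_len T.F_S
      (T.map_mem_branches T.F T.F_pt hFB) T.pt (T.pt_mem_branches _) T.pt_notMem T.F_pt
      (hne ⟨hb, hbA⟩ hBadj))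
    ⟨subEmb .., subEmb .., rfl, rfl, ?_, ?_, fun v w hvw => ?_, ?_, fun v => rfl, fun v => rfl⟩
    (ih _ (card_sub_lt (v := b) (T.notMem_branches hA hb hbA)))
    (ih _ (card_sub_lt (v := a) (T.notMem_branches hBadj (hA a ha) fun h => h.2 ha)))
  · rw [range_subEmb, range_subEmb]
    exact Set.eq_univ_of_forall hcov
  · rw [range_subEmb, range_subEmb]
    ext v
    constructor
    · rintro ⟨hv | ⟨c, hc, hcv⟩, hv' | ⟨d, hd, hdv⟩⟩
      · exact hv
      · exact hv
      · exact hv'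
      · have := T.eq_of_joined (hA c hc) hd.1 (hcv.trans hdv.symm)
        exact absurd (this ▸ hc) hd.2
    · rintro rfl
      exact ⟨Or.inl rfl, Or.inl rfl⟩
  · rw [range_subEmb, range_subEmb]
    obtain ⟨c, hc, hv, hw⟩ := T.exists_of_adj hvw
    by_cases hcA : c ∈ A
    · have := T.branches_mono (Set.singleton_subset_iff.2 hcA)
      exact Or.inl ⟨this hv, this hw⟩
    · have := T.branches_mono (Set.singleton_subset_iff.2 (show c ∈ B from ⟨hc, hcA⟩))
      exact Or.inr ⟨this hv, this hw⟩
  · ext s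
    constructor
    · intro hs
      rcases hcov s with h | h
      exacts [Or.inl ⟨⟨s, h⟩, hs, rfl⟩, Or.inr ⟨⟨s, h⟩, hs, rfl⟩]
    · rintro (⟨v, hv, rfl⟩ | ⟨v, hv, rfl⟩)
      exacts [hv, hv]

/-- A single orbit of `q` branches is induced from one of them, equipped with the power `F^q` that
preserves it. -/
theorem generated_of_ind {T : MarkedBYTree.{u}}
    (ih : ∀ T₀ : MarkedBYTree.{u}, Fintype.card T₀.V < Fintype.card T.V → T₀.Generated)
    (hlive : ∀ a, T.graph.Adj T.pt a → ∃ s ∈ T.S, T.Joined a s)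
    {a : T.V} (ha : T.graph.Adj T.pt a) {q : ℕ} (hq : 1 < q) (hqa : T.F^[q] a = a)
    (hmin : ∀ k, 0 < k → k < q → T.F^[k] a ≠ a)
    (hall : ∀ b, T.graph.Adj T.pt b → ∃ k < q, b = T.F^[k] a) : T.Generated := by
  have hA : ∀ b ∈ ({a} : Set T.V), T.graph.Adj T.pt b := by rintro b rfl; exact ha
  have hne : ∃ s ∈ T.S, s ∈ T.branches {a} := by
    obtain ⟨s, hs, h⟩ := hlive a ha
    exact ⟨s, hs, Or.inr ⟨a, rfl, h⟩⟩
  obtain ⟨F, hF, hFlen, hFS, hFpt⟩ := T.exists_iterate q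
  have hFA : ∀ b, F b ∈ ({a} : Set T.V) ↔ b ∈ ({a} : Set T.V) := fun b => by
    have : F a = a := by rw [hF, hqa]
    rw [Set.mem_singleton_iff, Set.mem_singleton_iff]
    conv_lhs => rw [← this]
    exact F.injective.eq_iff
  have hlift : ∀ k v, v ∈ T.branches {T.F^[k] a} →
      ∃ w : T.branches {a}, v = T.F^[k] w := by
    intro k v hv
    obtain ⟨G, hG, -, -, hGpt⟩ := T.exists_iterate k
    obtain ⟨w, rfl⟩ := G.surjective v
    refine ⟨⟨w, ?_⟩, hG w⟩
    rcases hv with h | ⟨c, rfl, h⟩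
    · exact Or.inl (G.injective (h.trans hGpt.symm))
    · rw [← hG, joined_map_iff G hGpt] at h
      exact Or.inr ⟨a, rfl, h⟩
  have hFa : T.F a ≠ a := hmin 1 one_pos hq
  refine .ind T (T.sub (T.branches {a}) (T.branches_connected hA) F hFlen hFS
      (T.map_mem_branches F hFpt hFA) T.pt (T.pt_mem_branches _) T.pt_notMem hFpt hne) q
    ⟨by omega, subEmb .., rfl, fun v => ?_, fun k hk hkq v w hvw => ?_, fun v w hvw => ?_,
      fun v => Iff.rfl, fun v => (hF v.1).symm⟩
    (ih _ (card_sub_lt (v := T.F a)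
      (T.notMem_branches hA ((T.adj_pt_map T.F T.F_pt).2 ha) hFa)))
  · by_cases hv : v = T.pt
    · exact ⟨0, by omega, ⟨T.pt, Or.inl rfl⟩, hv⟩
    · obtain ⟨b, hb, hbv⟩ := T.exists_joined hv
      obtain ⟨k, hk, rfl⟩ := hall b hb
      obtain ⟨w, hw⟩ := hlift k v (Or.inr ⟨_, rfl, hbv⟩)
      exact ⟨k, hk, w, hw⟩
  · change T.F^[k] v.1 = w.1 at hvw
    refine Subtype.ext ?_
    change w.1 = T.pt
    obtain ⟨G, hG, -, -, hGpt⟩ := T.exists_iterate k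
    rw [← hG] at hvw
    rcases v.2 with h | ⟨c, rfl, h⟩
    · rw [← hvw, h, hGpt]
    · rcases w.2 with h' | ⟨d, rfl, h'⟩
      · exact h'
      · refine absurd ?_ (hmin k hk hkq)
        rw [← hG]
        have h2 := h.map G hGpt
        rw [hvw] at h2
        exact T.eq_of_joined ((T.adj_pt_map G hGpt).2 ha) ha (h2.trans h'.symm)
  · obtain ⟨b, hb, hv, hw⟩ := T.exists_of_adj hvw
    obtain ⟨k, hk, rfl⟩ := hall b hb
    obtain ⟨v', hv'⟩ := hlift k v hv
    obtain ⟨w', hw'⟩ := hlift k w hw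
    exact ⟨k, hk, v', w', hv', hw'⟩

/-- If the only neighbour `a` of the mark is in `S`, degree one leaves room for nothing else. If
not, `a` is fixed by `F` and may serve as the mark of the tree without the old mark. -/
theorem generated_of_unique {T : MarkedBYTree.{u}}
    (ih : ∀ T₀ : MarkedBYTree.{u}, Fintype.card T₀.V < Fintype.card T.V → T₀.Generated)
    {a : T.V} (ha : T.graph.Adj T.pt a) (hall : ∀ b, T.graph.Adj T.pt b → b = a) :
    T.Generated := by
  have hjoin : ∀ v, v ≠ T.pt → T.Joined a v := fun v hv => by
    obtain ⟨b, hb, h⟩ := T.exists_joined hv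
    rwa [hall b hb] at h
  by_cases haS : a ∈ T.S
  · refine .edge T (T.len s(T.pt, a)) ⟨a, haS, ha, rfl, fun v => ?_⟩
    by_contra! hv
    obtain ⟨p, hp⟩ := hjoin v hv.1
    cases p with
    | nil => exact hv.2 rfl
    | cons h q =>
      have := (T.S_degree_one a haS).unique h ha.symm
      subst this
      exact hp (by simp)
  · have hconn : (T.graph.induce {T.pt}ᶜ).Connected := by
      classical
      rw [SimpleGraph.connected_iff_exists_forall_reachable]
      refine ⟨⟨a, ha.ne'⟩, ?_⟩
      rintro ⟨v, hv⟩
      obtain ⟨p, hp⟩ := hjoin v hv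
      exact ⟨p.induce _ fun x hx => by rintro rfl; exact hp hx⟩
    have hFa : T.F a = a := hall _ ((T.adj_pt_map T.F T.F_pt).2 ha)
    have hF : ∀ v, T.F v ∈ ({T.pt}ᶜ : Set T.V) ↔ v ∈ ({T.pt}ᶜ : Set T.V) := fun v => by
      rw [Set.mem_compl_singleton_iff, Set.mem_compl_singleton_iff]
      conv_lhs => rw [← T.F_pt]
      exact T.F.injective.ne_iff
    have hS : ∀ s ∈ T.S, s ∈ ({T.pt}ᶜ : Set T.V) := fun s hs => T.ne_pt hs
    refine .graft T (T.sub {T.pt}ᶜ hconn T.F T.F_len T.F_S hF a (Set.mem_compl_singleton_iff.2 ha.ne') haS hFa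
      (T.S_nonempty.imp fun s hs => ⟨hs, hS s hs⟩)) (T.len s(T.pt, a))
      ⟨subEmb .., fun v => ?_, ?_, fun w => ⟨hall w, ?_⟩, rfl, image_subEmb hS, fun v => rfl⟩
      (ih _ (card_sub_lt (v := T.pt) (by simp)))
    · rw [range_subEmb, Set.mem_compl_singleton_iff]; exact em _
    · rw [range_subEmb]; simp
    · rintro rfl; exact ha

/-- Every marked BY tree is generated from single edges by the constructions. -/
theorem generated (T : MarkedBYTree.{u}) : T.Generated := by
  induction hn : Fintype.card T.V using Nat.strong_induction_on generalizing T with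
  | _ n ih' =>
    have ih : ∀ T₀ : MarkedBYTree.{u}, Fintype.card T₀.V < Fintype.card T.V → T₀.Generated :=
      fun T₀ h => ih' _ (hn ▸ h) T₀ rfl
    by_cases hlive : ∀ a, T.graph.Adj T.pt a → ∃ s ∈ T.S, T.Joined a s
    swap
    · push Not at hlive
      obtain ⟨a, ha, hd⟩ := hlive
      exact generated_of_dead_branch ih ha hd
    obtain ⟨s, hs⟩ := T.S_nonempty
    obtain ⟨a, ha, -⟩ := T.exists_joined (T.ne_pt hs)
    have hper : a ∈ Function.periodicPts T.F := T.F.injective.mem_periodicPts a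
    set q := Function.minimalPeriod T.F a with hq
    have hqpos : 0 < q := Function.minimalPeriod_pos_of_mem_periodicPts hper
    have hqa : T.F^[q] a = a := Function.iterate_minimalPeriod
    by_cases hall : ∀ b, T.graph.Adj T.pt b → ∃ k < q, b = T.F^[k] a
    · rcases Nat.lt_or_ge 1 q with h1 | h1
      · exact generated_of_ind ih hlive ha h1 hqa
          (fun k hk hkq => Function.not_isPeriodicPt_of_pos_of_lt_minimalPeriod hk.ne' hkq) hall
      · refine generated_of_unique ih ha fun b hb => ?_
        obtain ⟨k, hk, rfl⟩ := hall b hb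
        obtain rfl : k = 0 := by omega
        rfl
    · push Not at hall
      obtain ⟨b, hb, hbA⟩ := hall
      -- A neighbour outside the orbit of `a` exists, so the orbit and its complement split the
      -- tree; stability in both directions uses the period `q` at the ends of the range.
      refine generated_of_wedge ih hlive (A := {c | ∃ k < q, c = T.F^[k] a}) ?_ (fun c => ⟨?_, ?_⟩)
        (a := a) (b := b) ⟨0, hqpos, rfl⟩ hb fun ⟨k, hk, h⟩ => hbA k hk h
      · rintro c ⟨k, -, rfl⟩
        obtain ⟨G, hG, -, -, hGpt⟩ := T.exists_iterate k
        rw [← hG]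
        exact (T.adj_pt_map G hGpt).2 ha
      · rintro ⟨k, hk, h⟩
        cases k with
        | zero =>
          refine ⟨q - 1, by omega, T.F.injective ?_⟩
          rw [h, ← Function.iterate_succ_apply' T.F, Nat.succ_eq_add_one, Nat.sub_add_cancel hqpos,
            hqa]; rfl
        | succ k =>
          refine ⟨k, by omega, T.F.injective ?_⟩
          rw [h, Function.iterate_succ_apply']
      · rintro ⟨k, hk, rfl⟩
        by_cases hkq : k + 1 < q
        · exact ⟨k + 1, hkq, (Function.iterate_succ_apply' T.F k a).symm⟩
        · refine ⟨0, hqpos, ?_⟩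
          rw [← Function.iterate_succ_apply' T.F, show k.succ = q by omega, hqa]; rfl

/-! ### The type -/

/-- The coefficient of `y` in the element `γ` for a given type. -/
def yCoeff : Fin 3 → ℤ := ![1, 0, 1]

/-- The coefficient of `η` in the element `γ` for a given type. -/
def etaCoeff : Fin 3 → ℤ := ![0, 1, 1]

/-- The combinations of `y` and `η` of the form `(1 + F)β` are the multiples modulo 2 of the
element `γ` belonging to `t`. -/
def IsType (T : MarkedBYTree.{u}) (t : Fin 3) : Prop :=
  ∀ a b : ℤ, (∃ β : T.Pipe, β + T.pipeAut β = a • T.yPipe + b • T.etaPipe) ↔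
    Even (etaCoeff t * a + yCoeff t * b)

/-- The pipe is `ℤη` with trivial action and `y = l η`, so `1 + F` is doubling. -/
theorem isType_edge {T : MarkedBYTree.{u}} {l : ℕ} (h : T.IsEdge l) :
    T.IsType (if Odd l then 2 else 0) := by
  obtain ⟨hy, hz⟩ := pipe_edge h
  intro a b
  have h1 : (∃ β : T.Pipe, β + T.pipeAut β = a • T.yPipe + b • T.etaPipe) ↔
      Even (a * l + b) := by
    rw [hy, ← mul_smul, ← add_smul]
    constructor
    · rintro ⟨β, hβ⟩
      obtain ⟨n, rfl⟩ := hz β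
      rw [map_zsmul, T.pipeAut_etaPipe, ← add_smul, ← sub_eq_zero, ← sub_smul] at hβ
      have := T.zsmul_etaPipe_eq_zero hβ
      exact ⟨n, by omega⟩
    · rintro ⟨n, hn⟩
      refine ⟨n • T.etaPipe, ?_⟩
      rw [map_zsmul, T.pipeAut_etaPipe, ← add_smul, hn]
  rw [h1]
  split_ifs with hl
  · have : Odd (l : ℤ) := by exact_mod_cast hl
    have : ¬ Even (l : ℤ) := Int.not_even_iff_odd.2 this
    simp [yCoeff, etaCoeff, Int.even_add, Int.even_mul, this]
  · have : Even (l : ℤ) := by exact_mod_cast Nat.not_odd_iff_even.1 hl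
    simp [yCoeff, etaCoeff, Int.even_add, this]

/-- Rewriting `y` as `y₀ + l η₀` replaces `(a, b)` by `(a, a l + b)`; for odd `l` this exchanges the
roles of `y` and `y + η`. -/
theorem isType_shift {T T₀ : MarkedBYTree.{u}} {l : ℤ} {φ : T₀.Pipe ≃ₗ[ℤ] T.Pipe}
    (hφ : ∀ x, T.pipeAut (φ x) = φ (T₀.pipeAut x)) (hη : φ T₀.etaPipe = T.etaPipe)
    (hy : φ T₀.yPipe + l • T.etaPipe = T.yPipe) {t₀ : Fin 3} (h₀ : T₀.IsType t₀) :
    T.IsType (if Odd l then 2 - t₀ else t₀) := by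
  intro a b
  have h1 : (∃ β : T.Pipe, β + T.pipeAut β = a • T.yPipe + b • T.etaPipe) ↔
      ∃ β, β + T₀.pipeAut β = a • T₀.yPipe + (a * l + b) • T₀.etaPipe := by
    have h2 : a • T.yPipe + b • T.etaPipe =
        φ (a • T₀.yPipe + (a * l + b) • T₀.etaPipe) := by
      rw [map_add, map_zsmul, map_zsmul, hη, ← hy, smul_add, add_smul, mul_smul]; abel
    rw [h2, φ.surjective.exists]
    exact exists_congr fun β => by rw [hφ, ← map_add, φ.injective.eq_iff]
  rw [h1, h₀]
  split_ifs with hl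
  · have : ¬ Even l := Int.not_even_iff_odd.2 hl
    fin_cases t₀ <;> simp [yCoeff, etaCoeff, Int.even_add, Int.even_mul, this]
    tauto
  · have : Even l := Int.not_odd_iff_even.1 hl
    fin_cases t₀ <;> simp [yCoeff, etaCoeff, Int.even_add, this]

theorem isType_wedge {T T₀ T₁ : MarkedBYTree.{u}} (h : T.IsWedge T₀ T₁) {t₀ t₁ : Fin 3}
    (h₀ : T₀.IsType t₀) (h₁ : T₁.IsType t₁) : T.IsType (t₀ * t₁) := by
  obtain ⟨φ₀, φ₁, hF₀, hF₁, hy₀, hy₁, hη, hs, hk⟩ := pipe_wedge h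
  intro a b
  -- In the amalgam a multiple `k y` can be moved between the two summands, so the equation splits
  -- into one for each tree up to the choice of `k`. Only the parity of `k` matters, which leaves a
  -- finite check.
  have key : (∃ β : T.Pipe, β + T.pipeAut β = a • T.yPipe + b • T.etaPipe) ↔
      ∃ k : ℤ, Even (etaCoeff t₀ * (a + k) + yCoeff t₀ * b) ∧
        Even (etaCoeff t₁ * (-k) + yCoeff t₁ * b) := by
    constructor
    · rintro ⟨β, hβ⟩
      obtain ⟨x₀, x₁, rfl⟩ := hs β
      obtain ⟨n, hn₀, hn₁⟩ := hk (x₀ + T₀.pipeAut x₀ - a • T₀.yPipe - b • T₀.etaPipe)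
        (x₁ + T₁.pipeAut x₁ - b • T₁.etaPipe) (by
          rw [map_add, hF₀, hF₁, ← hη] at hβ
          simp only [map_sub, map_add, map_zsmul, hy₀]
          rw [← sub_eq_zero] at hβ
          rw [← hβ, smul_add]
          abel)
      refine ⟨n, (h₀ _ _).1 ⟨x₀, ?_⟩, (h₁ _ _).1 ⟨x₁, ?_⟩⟩
      · rw [add_smul, ← hn₀]; abel
      · rw [neg_smul, ← hn₁]; abel
    · rintro ⟨k, hk₀, hk₁⟩
      obtain ⟨x₀, hx₀⟩ := (h₀ _ _).2 hk₀
      obtain ⟨x₁, hx₁⟩ := (h₁ _ _).2 hk₁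
      refine ⟨φ₀ x₀ + φ₁ x₁, ?_⟩
      rw [map_add, hF₀, hF₁, add_add_add_comm, ← map_add, ← map_add, hx₀, hx₁]
      simp only [map_add, map_neg, map_zsmul, hy₀, hy₁, ← hη, smul_add, add_smul, neg_smul]
      abel
  rw [key]
  by_cases ha : Even a <;> by_cases hb : Even b <;> fin_cases t₀ <;> fin_cases t₁ <;>
    simp [yCoeff, etaCoeff, Int.even_add, ha, hb] <;>
    first
      | (refine ⟨0, ?_⟩; simp; done)
      | (refine ⟨1, ?_⟩; simp)

theorem isInducedPipe {T T₀ : MarkedBYTree.{u}} {q : ℕ} (h : T.IsInd T₀ q) :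
    ∃ φ : T₀.Pipe →ₗ[ℤ] T.Pipe,
      IsInducedPipe T.pipeEnd T₀.pipeAut φ q T₀.yPipe T₀.etaPipe ∧ φ T₀.yPipe = T.yPipe ∧
      ∑ k ∈ Finset.range q, (T.pipeEnd ^ k) (φ T₀.etaPipe) = T.etaPipe := by
  obtain ⟨φ, h1, h2, h3, h4, h5⟩ := pipe_ind h
  exact ⟨φ, ⟨h.1, h1, by rw [h2]; exact T.pipeAut_yPipe, T₀.pipeAut_yPipe, T₀.pipeAut_etaPipe,
    fun _ => T₀.zsmul_yPipe_eq_zero, T₀.exists_pipeEnd_pow_eq_one, h4, h5⟩, h2, h3⟩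

theorem isType_ind_odd {T T₀ : MarkedBYTree.{u}} {q : ℕ} (h : T.IsInd T₀ q) (hq : Odd q)
    {t₀ : Fin 3} (h₀ : T₀.IsType t₀) : T.IsType t₀ := by
  obtain ⟨φ, hφ, hy, hη⟩ := isInducedPipe h
  intro a b
  rw [← hy, ← hη]
  constructor
  · rintro ⟨β, hβ⟩
    obtain ⟨x₀, c, -, hx₀⟩ := hφ.exists_of_add_apply_eq hβ
    rw [hq.neg_one_pow, if_neg (Nat.not_even_iff_odd.2 hq), mul_one, neg_one_smul,
      sub_neg_eq_add, add_comm (b • _)] at hx₀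
    have := (h₀ _ _).1 ⟨x₀, hx₀⟩
    rw [mul_sub, ← add_sub_right_comm, mul_left_comm, Int.even_sub] at this
    exact this.2 (even_two_mul _)
  · intro hab
    obtain ⟨β₀, hβ₀⟩ := (h₀ _ _).2 hab
    obtain ⟨β, hβ, -⟩ := hφ.exists_beta_odd hq hβ₀
    exact ⟨β, hβ⟩

theorem isType_ind_even {T T₀ : MarkedBYTree.{u}} {q : ℕ} (h : T.IsInd T₀ q) (hq : Even q) :
    T.IsType 1 := by
  obtain ⟨φ, hφ, hy, hη⟩ := isInducedPipe h
  intro a b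
  have e : etaCoeff 1 * a + yCoeff 1 * b = a := by simp [etaCoeff, yCoeff]
  rw [← hη, e]
  constructor
  · rintro ⟨β, hβ⟩
    rw [← hy] at hβ
    obtain ⟨x₀, c, -, hx₀⟩ := hφ.exists_of_add_apply_eq hβ
    rw [hq.neg_one_pow, if_pos hq, mul_zero, zero_smul, zero_add, one_smul] at hx₀
    have := hφ.eq_zero_of_sub_eq hx₀
    exact ⟨c, by omega⟩
  · rintro ⟨c, rfl⟩
    obtain ⟨β, hβ, -⟩ := hφ.exists_beta_even hq
    refine ⟨c • T.yPipe + b • β, ?_⟩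
    rw [map_add, map_zsmul, map_zsmul, T.pipeAut_yPipe, add_add_add_comm, ← add_smul, ← smul_add,
      ← hβ]
    rfl

/-- The trichotomy is proved here; knowing all solvable pairs `(a, b)` is what lets the induction
pass through grafts and wedges. -/
theorem exists_isType (T : MarkedBYTree.{u}) : ∃ t, T.IsType t := by
  induction T.generated with
  | edge T l h => exact ⟨_, isType_edge h⟩
  | graft T T₀ l h _ ih =>
    obtain ⟨t, ht⟩ := ih
    obtain ⟨φ, h1, h2, h3⟩ := pipe_graft h
    exact ⟨_, isType_shift h1 h2 h3 ht⟩
  | wedge T T₀ T₁ h _ _ ih ih' =>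
    obtain ⟨t, ht⟩ := ih
    obtain ⟨t', ht'⟩ := ih'
    exact ⟨_, isType_wedge h ht ht'⟩
  | ind T T₀ q h _ ih =>
    obtain ⟨t, ht⟩ := ih
    rcases Nat.even_or_odd q with hq | hq
    · exact ⟨_, isType_ind_even h hq⟩
    · exact ⟨_, isType_ind_odd h hq ht⟩
  | enlarge T T₀ h _ ih =>
    obtain ⟨t, ht⟩ := ih
    obtain ⟨φ, h1, h2, h3⟩ := pipe_enlargement h
    exact ⟨_, isType_shift h1 h2 h3 ht⟩

theorem cls_y_eq_zero_iff {T : MarkedBYTree.{u}} {t : Fin 3} (h : T.IsType t) :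
    T.cls T.y = 0 ↔ t = 0 := by
  rw [cls, starClass_eq_zero_iff]
  have := h 1 0
  rw [one_smul, zero_smul, add_zero] at this
  refine this.trans ?_
  fin_cases t <;> simp [etaCoeff]

theorem cls_eta_eq_zero_iff {T : MarkedBYTree.{u}} {t : Fin 3} (h : T.IsType t) :
    T.cls T.eta = 0 ↔ t = 1 := by
  rw [cls, starClass_eq_zero_iff]
  have := h 0 1
  rw [one_smul, zero_smul, zero_add] at this
  refine this.trans ?_
  fin_cases t <;> simp [yCoeff]

theorem cls_add_eq_zero_iff {T : MarkedBYTree.{u}} {t : Fin 3} (h : T.IsType t) :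
    T.cls (T.y + T.eta) = 0 ↔ t = 2 := by
  rw [cls, starClass_eq_zero_iff]
  have := h 1 1
  rw [one_smul, one_smul] at this
  refine this.trans ?_
  fin_cases t <;> simp [yCoeff, etaCoeff]

theorem type_eq {T : MarkedBYTree.{u}} {t : Fin 3} (h : T.IsType t) : T.type = t := by
  simp only [type, ne_eq, cls_y_eq_zero_iff h, cls_eta_eq_zero_iff h]
  fin_cases t <;> simp

theorem isType_type (T : MarkedBYTree.{u}) : T.IsType T.type := by
  obtain ⟨t, ht⟩ := T.exists_isType
  rwa [type_eq ht]

theorem gam_eq (T : MarkedBYTree.{u}) :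
    (T.gam : T.Pipe) = yCoeff T.type • T.yPipe + etaCoeff T.type • T.etaPipe := by
  rw [gam]
  generalize T.type = t
  fin_cases t
  · simp [yCoeff, etaCoeff, y]
  · simp [yCoeff, etaCoeff, eta]
  · simp [yCoeff, etaCoeff, y, eta]

/-- Only one of the three non-zero combinations modulo 2 is solvable, so one solution identifies the
type. -/
theorem type_eq_of_beta {T : MarkedBYTree.{u}} {t : Fin 3} {β : T.Pipe}
    (hβ : β + T.pipeAut β = yCoeff t • T.yPipe + etaCoeff t • T.etaPipe) : T.type = t := by
  have h := (T.isType_type _ _).1 ⟨β, hβ⟩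
  generalize T.type = s at h
  fin_cases s <;> fin_cases t <;> simp [yCoeff, etaCoeff] at h ⊢

theorem exists_beta (T : MarkedBYTree.{u}) : ∃ β : T.Pipe, β + T.pipeAut β = T.gam := by
  rw [gam_eq, T.isType_type, mul_comm]
  exact ⟨_, rfl⟩

theorem alpha_eq (T : MarkedBYTree.{u}) (β : T.Pipe) (hβ : β + T.pipeAut β = T.gam) :
    T.alpha = modTwo ⟨β - T.pipeAut β, T.sub_mem_piMinus hβ⟩ := by
  have key : ∀ (β' : T.Pipe) (h3 : β' + T.pipeAut β' = T.gam),
      modTwo (⟨β' - T.pipeAut β', T.sub_mem_piMinus h3⟩ : T.piMinus) =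
        modTwo ⟨β - T.pipeAut β, T.sub_mem_piMinus hβ⟩ := by
    intro β' h3
    -- The difference of two solutions is anti-invariant, and `1 - F` doubles it.
    have h4 : T.pipeAut (β - β') = -(β - β') := by
      rw [map_sub, eq_sub_of_add_eq' hβ, eq_sub_of_add_eq' h3]; abel
    rw [modTwo_eq_iff]
    refine ⟨⟨β - β', (mem_fixedBy_negAut _ _).2 h4⟩, Subtype.ext ?_⟩
    change β - T.pipeAut β = β' - T.pipeAut β' + (β - β' + (β - β'))
    rw [eq_sub_of_add_eq' hβ, eq_sub_of_add_eq' h3]; abel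
  have hex : ∃ β : T.Pipe, β + T.pipeAut β = T.gam := ⟨β, hβ⟩
  rw [alpha, dif_pos hex]
  exact key _ hex.choose_spec

/-- Every representative of `α` is of the form `(1 - F)β`. -/
theorem exists_beta_of_modTwo_eq {T : MarkedBYTree.{u}} {a : T.piMinus}
    (ha : modTwo a = T.alpha) : ∃ β : T.Pipe,
      β + T.pipeAut β = yCoeff T.type • T.yPipe + etaCoeff T.type • T.etaPipe ∧
      (a : T.Pipe) = β - T.pipeAut β := by
  obtain ⟨β, hβ⟩ := T.exists_beta
  rw [T.alpha_eq β hβ, eq_comm, modTwo_eq_iff] at ha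
  obtain ⟨c, rfl⟩ := ha
  have hc := (mem_fixedBy_negAut _ _).1 c.2
  refine ⟨β + c, ?_, ?_⟩
  · rw [← gam_eq, ← hβ, map_add, hc]; abel
  · change β - T.pipeAut β + ((c : T.Pipe) + c) = _
    rw [map_add, hc]; abel

/-- One explicit `β` determines both the type and `α`, so each rule reduces to an isomorphism and a
solution. -/
theorem hasTriple_of {T : MarkedBYTree.{u}} {A : Type u} [AddCommGroup A] {a : A} {t : Fin 3}
    {β : T.Pipe} (hβ : β + T.pipeAut β = yCoeff t • T.yPipe + etaCoeff t • T.etaPipe)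
    (e : A ≃+ T.piMinus) (he : (e a : T.Pipe) = β - T.pipeAut β) : T.HasTriple A a t := by
  obtain rfl := type_eq_of_beta hβ
  rw [← gam_eq] at hβ
  refine ⟨⟨e.symm, fun x hx => ?_⟩, rfl⟩
  rw [T.alpha_eq β hβ, show (⟨β - T.pipeAut β, T.sub_mem_piMinus hβ⟩ : T.piMinus) = e a from
    Subtype.ext he.symm, modTwo_eq_iff] at hx
  obtain ⟨c, hc⟩ := hx
  rw [modTwo_eq_iff]
  refine ⟨e.symm c, e.injective ?_⟩
  rw [hc, map_add, map_add, e.apply_symm_apply, e.apply_symm_apply]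

end MarkedBYTree

/-- Turns invariants under `-F` in the Néron component groups into anti-invariants under `F`. -/
theorem dualAut_latticeAut_neg_one {V : Type u} [Fintype V] {G : SimpleGraph V} {A : Set V}
    (F : G ≃g G) (hA : ∀ v, F v ∈ A ↔ v ∈ A) (φ : Module.Dual ℤ (relH1 G A)) :
    dualAut (latticeAut F hA (-1)) φ = -dualAut (latticeAut F hA 1) φ := by
  ext1 c
  change φ ((latticeAut F hA (-1)).symm c) = -φ ((latticeAut F hA 1).symm c)
  rw [← map_neg]
  congr 1
  refine Subtype.ext ?_
  funext u v
  change (((-1 : ℤˣ) : ℤ)) * c.1 _ _ = -(((1 : ℤˣ) : ℤ) * c.1 _ _)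
  simp

/-! ### Amalgamated sums of two modules -/

section Pair

variable {M₀ M₁ N : Type u} [AddCommGroup M₀] [AddCommGroup M₁] [AddCommGroup N]
  {f₀ : M₀ ≃ₗ[ℤ] M₀} {f₁ : M₁ ≃ₗ[ℤ] M₁} {f : N ≃ₗ[ℤ] N} {φ₀ : M₀ →ₗ[ℤ] N} {φ₁ : M₁ →ₗ[ℤ] N}
  {y₀ : M₀} {y₁ : M₁}

theorem prodCongr_eq_neg_iff (f₀ : M₀ ≃ₗ[ℤ] M₀) (f₁ : M₁ ≃ₗ[ℤ] M₁) (x : M₀ × M₁) :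
    f₀.prodCongr f₁ x = -x ↔ ∃ a : fixedBy (negAut f₀) × fixedBy (negAut f₁),
      (fixedBy (negAut f₀)).toAddSubgroup.subtype.prodMap
        (fixedBy (negAut f₁)).toAddSubgroup.subtype a = x := by
  rw [Prod.ext_iff, Prod.exists]
  constructor
  · rintro ⟨h0, h1⟩
    exact ⟨⟨x.1, (mem_fixedBy_negAut _ _).2 h0⟩, ⟨x.2, (mem_fixedBy_negAut _ _).2 h1⟩, rfl⟩
  · rintro ⟨a, b, rfl⟩
    exact ⟨(mem_fixedBy_negAut _ _).1 a.2, (mem_fixedBy_negAut _ _).1 b.2⟩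

theorem negAut_coprod (h₀ : ∀ x, f (φ₀ x) = φ₀ (f₀ x)) (h₁ : ∀ x, f (φ₁ x) = φ₁ (f₁ x))
    (x : M₀ × M₁) : negAut f (φ₀.coprod φ₁ x) = -φ₀.coprod φ₁ (f₀.prodCongr f₁ x) := by
  change -(f (φ₀ x.1 + φ₁ x.2)) = _
  rw [map_add, h₀, h₁]; rfl

theorem prodCongr_pair (hy₀ : f₀ y₀ = y₀) (hy₁ : f₁ y₁ = y₁) :
    f₀.prodCongr f₁ (y₀, -y₁) = (y₀, -y₁) :=
  Prod.ext hy₀ (by change f₁ (-y₁) = -y₁; rw [map_neg, hy₁])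

theorem exists_eq_zsmul_pair
    (hk : ∀ x₀ x₁, φ₀ x₀ + φ₁ x₁ = 0 → ∃ n : ℤ, x₀ = n • y₀ ∧ x₁ = -(n • y₁)) (x : M₀ × M₁)
    (hx : φ₀.coprod φ₁ x = 0) : ∃ n : ℤ, x = n • (y₀, -y₁) := by
  obtain ⟨n, h0, h1⟩ := hk x.1 x.2 hx
  exact ⟨n, Prod.ext h0 (by rw [h1, Prod.smul_snd, smul_neg])⟩

/-- The anti-invariants of an amalgamated sum of two modules along infinite cyclic subgroups. -/
theorem exists_equiv_fixedBy_pair (hy₀ : f₀ y₀ = y₀) (hy₁ : f₁ y₁ = y₁)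
    (hinf : ∀ n : ℤ, n • y₀ = 0 → n = 0) (h₀ : ∀ x, f (φ₀ x) = φ₀ (f₀ x))
    (h₁ : ∀ x, f (φ₁ x) = φ₁ (f₁ x)) (hy : φ₀ y₀ = φ₁ y₁) (hs : ∀ z, ∃ x₀ x₁, φ₀ x₀ + φ₁ x₁ = z)
    (hk : ∀ x₀ x₁, φ₀ x₀ + φ₁ x₁ = 0 → ∃ n : ℤ, x₀ = n • y₀ ∧ x₁ = -(n • y₁))
    (hno : ¬ (∃ β, β + f₀ β = y₀) ∨ ¬ ∃ β, β + f₁ β = y₁) :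
    ∃ e : (fixedBy (negAut f₀) × fixedBy (negAut f₁)) ≃+ fixedBy (negAut f),
      ∀ x₀ x₁, (e (x₀, x₁) : N) = φ₀ x₀ + φ₁ x₁ := by
  -- The amalgam is the direct sum modulo `(y₀, -y₁)`, which is in the image of `1 + f` only if `y₀`
  -- and `y₁` both are.
  obtain ⟨e, he⟩ := exists_equiv_fixedBy_quotient (prodCongr_pair hy₀ hy₁)
    (fun n hn => hinf n (congrArg Prod.fst hn))
    (fun z => (hs z).elim fun x₀ h => h.elim fun x₁ h => ⟨(x₀, x₁), h⟩)
    (by rw [LinearMap.coprod_apply, map_neg, hy, add_neg_cancel]) (exists_eq_zsmul_pair hk)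
    (negAut_coprod h₀ h₁) (Subtype.val_injective.prodMap Subtype.val_injective)
    (prodCongr_eq_neg_iff f₀ f₁) (by
      rintro ⟨⟨b₀, b₁⟩, hb⟩
      have hb₁ : b₁ + f₁ b₁ = -y₁ := congrArg Prod.snd hb
      rcases hno with hno | hno
      · exact hno ⟨b₀, congrArg Prod.fst hb⟩
      · exact hno ⟨-b₁, by rw [map_neg, ← neg_add, hb₁, neg_neg]⟩)
  exact ⟨e, fun x₀ x₁ => he (x₀, x₁)⟩

theorem exists_equiv_fixedBy_pair_adjoinHalf (hy₀ : f₀ y₀ = y₀) (hy₁ : f₁ y₁ = y₁)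
    (hinf : ∀ n : ℤ, n • y₀ = 0 → n = 0) (h₀ : ∀ x, f (φ₀ x) = φ₀ (f₀ x))
    (h₁ : ∀ x, f (φ₁ x) = φ₁ (f₁ x)) (hy : φ₀ y₀ = φ₁ y₁) (hs : ∀ z, ∃ x₀ x₁, φ₀ x₀ + φ₁ x₁ = z)
    (hk : ∀ x₀ x₁, φ₀ x₀ + φ₁ x₁ = 0 → ∃ n : ℤ, x₀ = n • y₀ ∧ x₁ = -(n • y₁))
    {β₀ : M₀} {β₁ : M₁} {a₀ : fixedBy (negAut f₀)} {a₁ : fixedBy (negAut f₁)}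
    (hβ₀ : β₀ + f₀ β₀ = y₀) (hβ₁ : β₁ + f₁ β₁ = y₁) (ha₀ : (a₀ : M₀) = β₀ - f₀ β₀)
    (ha₁ : (a₁ : M₁) = β₁ - f₁ β₁) :
    ∃ e : AdjoinHalf (a₀, -a₁) ≃+ fixedBy (negAut f),
      ∀ x₀ x₁, (e (AdjoinHalf.of (a₀, -a₁) (x₀, x₁)) : N) = φ₀ x₀ + φ₁ x₁ := by
  obtain ⟨e, he⟩ := exists_equiv_fixedBy_quotient_adjoinHalf (β := (β₀, -β₁)) (a := (a₀, -a₁))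
    (prodCongr_pair hy₀ hy₁)
    (fun n hn => hinf n (congrArg Prod.fst hn))
    (fun z => (hs z).elim fun x₀ h => h.elim fun x₁ h => ⟨(x₀, x₁), h⟩)
    (by rw [LinearMap.coprod_apply, map_neg, hy, add_neg_cancel]) (exists_eq_zsmul_pair hk)
    (negAut_coprod h₀ h₁) (Subtype.val_injective.prodMap Subtype.val_injective)
    (prodCongr_eq_neg_iff f₀ f₁)
    (Prod.ext hβ₀ (by
      change -β₁ + f₁ (-β₁) = -y₁
      rw [map_neg, ← neg_add, hβ₁]))
    (Prod.ext ha₀ (by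
      change -(a₁ : M₁) = -β₁ - f₁ (-β₁)
      rw [ha₁, map_neg, neg_sub, sub_neg_eq_add, neg_add_eq_sub]))
  exact ⟨e, fun x₀ x₁ => he (x₀, x₁)⟩

/-- The invariant correction `r y` contributes `2r y` under `1 + f` and nothing under `1 - f`, so
the coefficient of `y` can be adjusted by even numbers at no cost to `α`. -/
theorem add_apply_add_add_zsmul {b₀ b₁ y e₀ e₁ e : N} {m n k r : ℤ}
    (h₀ : b₀ + f b₀ = m • y + e₀) (h₁ : b₁ + f b₁ = n • y + e₁) (he : e₀ + e₁ = e)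
    (hy : f y = y) (hr : k - m - n = r + r) :
    (b₀ + b₁ + r • y) + f (b₀ + b₁ + r • y) = k • y + e := by
  obtain rfl : k = m + n + (r + r) := by omega
  rw [map_add, map_add, map_zsmul, hy, eq_sub_of_add_eq' h₀, eq_sub_of_add_eq' h₁, ← he, add_smul,
    add_smul, add_smul]
  abel

theorem sub_apply_add_add_zsmul {b₀ b₁ y : N} {r : ℤ} (hy : f y = y) :
    (b₀ + b₁ + r • y) - f (b₀ + b₁ + r • y) = b₀ - f b₀ + (b₁ - f b₁) := by
  rw [map_add, map_add, map_zsmul, hy]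
  abel

end Pair

namespace MarkedBYTree

theorem mem_range_piMinus (T : MarkedBYTree.{u}) (x : T.Pipe) :
    T.pipeAut x = -x ↔ ∃ a : T.piMinus, T.piMinus.toAddSubgroup.subtype a = x :=
  ⟨fun h => ⟨⟨x, (mem_fixedBy_negAut _ _).2 h⟩, rfl⟩, by
    rintro ⟨a, rfl⟩
    exact (mem_fixedBy_negAut _ _).1 a.2⟩

theorem exists_y_iff (T : MarkedBYTree.{u}) :
    (∃ β : T.Pipe, β + T.pipeAut β = T.yPipe) ↔ T.type = 0 :=
  (starClass_eq_zero_iff T.pipeAut T.y).symm.trans (cls_y_eq_zero_iff T.isType_type)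

theorem exists_eta_iff (T : MarkedBYTree.{u}) :
    (∃ β : T.Pipe, β + T.pipeAut β = T.etaPipe) ↔ T.type = 1 :=
  (starClass_eq_zero_iff T.pipeAut T.eta).symm.trans (cls_eta_eq_zero_iff T.isType_type)

/-! ### The Néron component groups -/

/-- The projection of the pipe to the geometric Néron component group of `(T, S ∪ {*})`. -/
noncomputable def toWithMark (T : MarkedBYTree.{u}) : T.Pipe →ₗ[ℤ] (T.withMark (-1)).GeomNeron :=
  Submodule.mapQ (T.Sig.map T.pairing) (LinearMap.range T.pairing) LinearMap.id
    LinearMap.map_le_range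

theorem toWithMark_surjective (T : MarkedBYTree.{u}) : Function.Surjective T.toWithMark := by
  intro z
  obtain ⟨φ, rfl⟩ := Submodule.Quotient.mk_surjective _ z
  exact ⟨Submodule.Quotient.mk φ, rfl⟩

theorem toWithMark_y (T : MarkedBYTree.{u}) : T.toWithMark T.yPipe = 0 :=
  (Submodule.Quotient.mk_eq_zero _).2 ⟨T.pathClass, rfl⟩

theorem exists_of_toWithMark_eq_zero (T : MarkedBYTree.{u}) (x : T.Pipe) (h : T.toWithMark x = 0) :
    ∃ n : ℤ, x = n • T.yPipe := by
  obtain ⟨φ, rfl⟩ := Submodule.Quotient.mk_surjective _ x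
  obtain ⟨c, hc⟩ := (Submodule.Quotient.mk_eq_zero _).1 h
  refine ⟨T.coordSum c, ?_⟩
  rw [← mk_pairing]
  exact congrArg _ hc.symm

theorem geomAut_toWithMark (T : MarkedBYTree.{u}) (x : T.Pipe) :
    (T.withMark (-1)).geomAut (T.toWithMark x) = -T.toWithMark (T.pipeAut x) := by
  obtain ⟨φ, rfl⟩ := Submodule.Quotient.mk_surjective _ x
  exact congrArg Submodule.Quotient.mk (dualAut_latticeAut_neg_one T.F T.F_insert φ)

/-- The inclusion of `Σ` in `Λ`. -/
noncomputable def sigIncl (T : MarkedBYTree.{u}) : relH1 T.graph T.S →ₗ[ℤ] T.Lam :=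
  Submodule.inclusion (relH1_mono (Set.subset_insert _ _))

/-- The projection of the pipe to the geometric Néron component group of `(T, S)`. -/
noncomputable def toUnmarked (T : MarkedBYTree.{u}) : T.Pipe →ₗ[ℤ] (T.unmarked (-1)).GeomNeron :=
  Submodule.mapQ (T.Sig.map T.pairing) (LinearMap.range (toDual T.graph T.len T.S))
    T.sigIncl.dualMap (by
      rintro _ ⟨c, hc, rfl⟩
      exact ⟨⟨c.1, hc⟩, rfl⟩)

theorem sub_smul_pathLam_mem (T : MarkedBYTree.{u}) {s : T.V} (hs : s ∈ T.S) (c : T.Lam) :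
    (c - T.coordSum c • T.pathLam s).1 ∈ relH1 T.graph T.S :=
  (T.mem_sig (c - T.coordSum c • T.pathLam s)).2 (by
    rw [map_sub, map_smul, T.coordSum_pathLam hs, smul_eq_mul, mul_one, sub_self])

theorem coordSum_sigIncl (T : MarkedBYTree.{u}) (d : relH1 T.graph T.S) :
    T.coordSum (T.sigIncl d) = 0 :=
  (T.mem_sig (T.sigIncl d)).1 d.2

theorem toUnmarked_surjective (T : MarkedBYTree.{u}) : Function.Surjective T.toUnmarked := by
  obtain ⟨s, hs⟩ := T.S_nonempty
  intro z
  obtain ⟨ψ, rfl⟩ := Submodule.Quotient.mk_surjective _ z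
  -- A fixed path class splits off a rank one complement of `Σ`; the resulting projection extends
  -- functionals from `Σ` to `Λ`.
  let π : T.Lam →ₗ[ℤ] relH1 T.graph T.S :=
    (T.Lam.subtype ∘ₗ (LinearMap.id - T.coordSum.smulRight (T.pathLam s))).codRestrict _
      fun c => T.sub_smul_pathLam_mem hs c
  have hπ : ∀ d, π (T.sigIncl d) = d := fun d => Subtype.ext (by
    change (T.sigIncl d - T.coordSum (T.sigIncl d) • T.pathLam s).1 = d.1
    rw [coordSum_sigIncl, zero_smul, sub_zero]; rfl)
  refine ⟨Submodule.Quotient.mk (ψ ∘ₗ π), congrArg Submodule.Quotient.mk ?_⟩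
  ext1 d
  exact congrArg ψ (hπ d)

theorem toUnmarked_eta (T : MarkedBYTree.{u}) : T.toUnmarked T.etaPipe = 0 := by
  refine (Submodule.Quotient.mk_eq_zero _).2 ⟨0, ?_⟩
  rw [map_zero]
  ext1 c
  exact (T.coordSum_sigIncl c).symm

/-- On `Σ` a representative agrees with the pairing with some `d` in `Σ`, a relation of the pipe.
The difference vanishes on `Σ` and so is a multiple of `coordSum`. -/
theorem exists_of_toUnmarked_eq_zero (T : MarkedBYTree.{u}) (x : T.Pipe) (h : T.toUnmarked x = 0) :
    ∃ n : ℤ, x = n • T.etaPipe := by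
  obtain ⟨s, hs⟩ := T.S_nonempty
  obtain ⟨φ, rfl⟩ := Submodule.Quotient.mk_surjective _ x
  obtain ⟨d, hd⟩ := (Submodule.Quotient.mk_eq_zero _).1 h
  refine ⟨(φ - T.pairing (T.sigIncl d)) (T.pathLam s), ?_⟩
  rw [etaPipe, ← Submodule.Quotient.mk_smul, Submodule.Quotient.eq]
  refine ⟨T.sigIncl d, d.2, ?_⟩
  ext1 c
  obtain ⟨b, hb⟩ : ∃ b, c - T.coordSum c • T.pathLam s = T.sigIncl b :=
    ⟨⟨_, T.sub_smul_pathLam_mem hs c⟩, rfl⟩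
  have h1 : T.pairing (T.sigIncl d) (T.sigIncl b) = φ (T.sigIncl b) := DFunLike.congr_fun hd b
  rw [← hb] at h1
  simp only [map_sub, map_smul, LinearMap.sub_apply, LinearMap.smul_apply, smul_eq_mul] at h1 ⊢
  linarith

theorem geomAut_toUnmarked (T : MarkedBYTree.{u}) (x : T.Pipe) :
    (T.unmarked (-1)).geomAut (T.toUnmarked x) = -T.toUnmarked (T.pipeAut x) := by
  obtain ⟨φ, rfl⟩ := Submodule.Quotient.mk_surjective _ x
  exact congrArg Submodule.Quotient.mk (dualAut_latticeAut_neg_one T.F T.F_S (T.sigIncl.dualMap φ))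

/-- No non-zero anti-invariant is a multiple of `y`, so the anti-invariants embed in the finite
group `Λ^∨ / Λ`. -/
theorem finite_piMinus (T : MarkedBYTree.{u}) : Finite T.piMinus := by
  have := T.finite_dual_quotient_range
  refine Finite.of_injective (β := Module.Dual ℤ T.Lam ⧸ LinearMap.range T.pairing)
    (T.toWithMark ∘ₗ T.piMinus.subtype) ((injective_iff_map_eq_zero _).2 fun a ha => ?_)
  obtain ⟨n, hn⟩ := T.exists_of_toWithMark_eq_zero _ ha
  have h1 := (mem_fixedBy_negAut _ _).1 a.2
  change (a : T.Pipe) = _ at hn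
  rw [hn, map_zsmul, T.pipeAut_yPipe, ← sub_eq_zero, sub_neg_eq_add, ← add_smul] at h1
  have h2 := T.zsmul_yPipe_eq_zero h1
  obtain rfl : n = 0 := by omega
  exact Subtype.ext (by rw [hn, zero_smul]; rfl)

theorem nonempty_unmarked_neron (T : MarkedBYTree.{u}) (h : T.type ≠ 1) :
    Nonempty ((T.unmarked (-1)).Neron ≃+ T.piMinus) :=
  let ⟨e, _⟩ := exists_equiv_fixedBy_quotient T.pipeAut_etaPipe (fun _ => T.zsmul_etaPipe_eq_zero)
    T.toUnmarked_surjective T.toUnmarked_eta T.exists_of_toUnmarked_eq_zero T.geomAut_toUnmarked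
    Subtype.val_injective T.mem_range_piMinus (T.exists_eta_iff.not.2 h)
  ⟨e.symm⟩

theorem nonempty_unmarked_neron_adjoinHalf (T : MarkedBYTree.{u}) (h : T.type = 1)
    (a : T.piMinus) (ha : modTwo a = T.alpha) :
    Nonempty ((T.unmarked (-1)).Neron ≃+ AdjoinHalf a) := by
  obtain ⟨β, hβ, ha⟩ := exists_beta_of_modTwo_eq ha
  rw [h, show yCoeff 1 = 0 from rfl, show etaCoeff 1 = 1 from rfl, zero_smul, zero_add,
    one_smul] at hβ
  obtain ⟨e, -⟩ := exists_equiv_fixedBy_quotient_adjoinHalf T.pipeAut_etaPipe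
    (fun _ => T.zsmul_etaPipe_eq_zero) T.toUnmarked_surjective T.toUnmarked_eta
    T.exists_of_toUnmarked_eq_zero T.geomAut_toUnmarked Subtype.val_injective T.mem_range_piMinus
    hβ ha
  exact ⟨e.symm⟩

theorem nonempty_withMark_neron (T : MarkedBYTree.{u}) (h : T.type ≠ 0) :
    Nonempty ((T.withMark (-1)).Neron ≃+ T.piMinus) :=
  let ⟨e, _⟩ := exists_equiv_fixedBy_quotient T.pipeAut_yPipe (fun _ => T.zsmul_yPipe_eq_zero)
    T.toWithMark_surjective T.toWithMark_y T.exists_of_toWithMark_eq_zero T.geomAut_toWithMark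
    Subtype.val_injective T.mem_range_piMinus (T.exists_y_iff.not.2 h)
  ⟨e.symm⟩

theorem nonempty_withMark_neron_adjoinHalf (T : MarkedBYTree.{u}) (h : T.type = 0)
    (a : T.piMinus) (ha : modTwo a = T.alpha) :
    Nonempty ((T.withMark (-1)).Neron ≃+ AdjoinHalf a) := by
  obtain ⟨β, hβ, ha⟩ := exists_beta_of_modTwo_eq ha
  rw [h, show yCoeff 0 = 1 from rfl, show etaCoeff 0 = 0 from rfl, zero_smul, add_zero,
    one_smul] at hβ
  obtain ⟨e, -⟩ := exists_equiv_fixedBy_quotient_adjoinHalf T.pipeAut_yPipe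
    (fun _ => T.zsmul_yPipe_eq_zero) T.toWithMark_surjective T.toWithMark_y
    T.exists_of_toWithMark_eq_zero T.geomAut_toWithMark Subtype.val_injective T.mem_range_piMinus
    hβ ha
  exact ⟨e.symm⟩

/-! ### The triples of the constructions -/

theorem hasTriple_edge {T : MarkedBYTree.{u}} {l : ℕ} (h : T.IsEdge l) :
    T.HasTriple PUnit 0 (if Odd l then 2 else 0) := by
  obtain ⟨β, hβ⟩ := (isType_edge h _ _).2 (show Even _ by rw [mul_comm]; exact ⟨_, rfl⟩)
  have hF : ∀ x, T.pipeAut x = x := fun x => by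
    obtain ⟨n, rfl⟩ := (pipe_edge h).2 x
    rw [map_zsmul, T.pipeAut_etaPipe]
  have h0 : ∀ x : T.piMinus, x = 0 := fun x => by
    have h1 := (mem_fixedBy_negAut _ _).1 x.2
    obtain ⟨n, hn⟩ := (pipe_edge h).2 x
    rw [hF, hn, ← sub_eq_zero, sub_neg_eq_add, ← add_smul] at h1
    have h2 := T.zsmul_etaPipe_eq_zero h1
    obtain rfl : n = 0 := by omega
    exact Subtype.ext (by rw [hn, zero_smul]; rfl)
  let e : PUnit.{u + 1} ≃+ T.piMinus :=
    { toFun := fun _ => 0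
      invFun := fun _ => 0
      left_inv := fun _ => rfl
      right_inv := fun x => (h0 x).symm
      map_add' := fun _ _ => (add_zero _).symm }
  exact hasTriple_of hβ e (by rw [hF, sub_self]; rfl)

theorem hasTriple_shift {T T₀ : MarkedBYTree.{u}} {l : ℤ} {φ : T₀.Pipe ≃ₗ[ℤ] T.Pipe}
    (hφ : ∀ x, T.pipeAut (φ x) = φ (T₀.pipeAut x)) (hη : φ T₀.etaPipe = T.etaPipe)
    (hy : φ T₀.yPipe + l • T.etaPipe = T.yPipe) {a₀ : T₀.piMinus} (ha : modTwo a₀ = T₀.alpha) :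
    T.HasTriple T₀.piMinus a₀ (if Odd l then 2 - T₀.type else T₀.type) := by
  obtain ⟨β₀, hβ₀, ha⟩ := exists_beta_of_modTwo_eq ha
  generalize T₀.type = t₀ at hβ₀ ⊢
  set t := if Odd l then 2 - t₀ else t₀ with ht
  have h1 : yCoeff t = yCoeff t₀ := by
    rw [ht]
    split_ifs
    · fin_cases t₀ <;> rfl
    · rfl
  -- Passing from `t₀` to `t` keeps the coefficient of `y`; the error in the coefficient of `η` is
  -- even and is absorbed by the invariant `r η`, which does not affect `(1 - F)β`.
  obtain ⟨r, hr⟩ : Even (etaCoeff t - etaCoeff t₀ + l * yCoeff t₀) := by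
    rw [ht]
    split_ifs with hl
    · have : ¬ Even l := Int.not_even_iff_odd.2 hl
      fin_cases t₀ <;> simp [yCoeff, etaCoeff, Int.even_add, this]
    · have : Even l := Int.not_odd_iff_even.1 hl
      simp [this.mul_right]
  have hmem : ∀ x : T₀.piMinus, φ x ∈ T.piMinus := fun x => by
    rw [mem_fixedBy_negAut, hφ, (mem_fixedBy_negAut _ _).1 x.2, map_neg]
  let e : T₀.piMinus →+ T.piMinus :=
    (φ.toLinearMap.comp T₀.piMinus.subtype).toAddMonoidHom.codRestrict _ hmem
  have he : ∀ x, (e x : T.Pipe) = φ x := fun x => rfl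
  refine hasTriple_of (β := φ β₀ + r • T.etaPipe) ?_ (AddEquiv.ofBijective e ⟨?_, ?_⟩) ?_
  · rw [map_add, hφ, map_zsmul, T.pipeAut_etaPipe, add_add_add_comm, ← map_add, hβ₀, ← add_smul,
      ← hr, h1, ← hy, map_add, map_zsmul, map_zsmul, hη]
    module
  · exact (injective_iff_map_eq_zero e).2 fun x hx => Subtype.ext (φ.injective (by
      rw [← he, hx, ZeroMemClass.coe_zero, ZeroMemClass.coe_zero, map_zero]))
  · intro z
    refine ⟨⟨φ.symm z, (mem_fixedBy_negAut _ _).2 (φ.injective ?_)⟩,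
      Subtype.ext (φ.apply_symm_apply _)⟩
    rw [← hφ, φ.apply_symm_apply, map_neg, φ.apply_symm_apply]
    exact (mem_fixedBy_negAut _ _).1 z.2
  · change φ a₀ = _
    rw [ha, map_add, hφ, map_zsmul, T.pipeAut_etaPipe, map_sub]
    abel

-- If one tree has type `0`, its solution for `y` alone solves the equation for `T`, and `α` comes
-- from that tree. Otherwise both elements `γ` contain `η` once, so the two solutions are added and
-- the multiple of `y` is corrected.
set_option maxHeartbeats 800000 in
theorem hasTriple_wedge {T T₀ T₁ : MarkedBYTree.{u}} (h : T.IsWedge T₀ T₁)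
    {a₀ : T₀.piMinus} {a₁ : T₁.piMinus} (ha₀ : modTwo a₀ = T₀.alpha) (ha₁ : modTwo a₁ = T₁.alpha) :
    (T₀.type = 0 → T₁.type = 0 →
      T.HasTriple (AdjoinHalf (a₀, -a₁)) (AdjoinHalf.of (a₀, -a₁) (a₀, 0)) (T₀.type * T₁.type) ∧
      T.HasTriple (AdjoinHalf (a₀, -a₁)) (AdjoinHalf.of (a₀, -a₁) (0, a₁)) (T₀.type * T₁.type)) ∧
    (T₀.type = 0 → T₁.type ≠ 0 →
      T.HasTriple (T₀.piMinus × T₁.piMinus) (a₀, 0) (T₀.type * T₁.type)) ∧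
    (T₀.type ≠ 0 → T₁.type = 0 →
      T.HasTriple (T₀.piMinus × T₁.piMinus) (0, a₁) (T₀.type * T₁.type)) ∧
    (T₀.type ≠ 0 → T₁.type ≠ 0 →
      T.HasTriple (T₀.piMinus × T₁.piMinus) (a₀, a₁) (T₀.type * T₁.type)) := by
  obtain ⟨φ₀, φ₁, hF₀, hF₁, hy₀, hy₁, hη, hs, hk⟩ := pipe_wedge h
  obtain ⟨β₀, hβ₀, ha₀⟩ := exists_beta_of_modTwo_eq ha₀
  obtain ⟨β₁, hβ₁, ha₁⟩ := exists_beta_of_modTwo_eq ha₁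
  have hB₀ : φ₀ β₀ + T.pipeAut (φ₀ β₀) =
      yCoeff T₀.type • T.yPipe + etaCoeff T₀.type • φ₀ T₀.etaPipe := by
    rw [hF₀, ← map_add, hβ₀, map_add, map_zsmul, map_zsmul, hy₀]
  have hB₁ : φ₁ β₁ + T.pipeAut (φ₁ β₁) =
      yCoeff T₁.type • T.yPipe + etaCoeff T₁.type • φ₁ T₁.etaPipe := by
    rw [hF₁, ← map_add, hβ₁, map_add, map_zsmul, map_zsmul, hy₁]
  have hA₀ : φ₀ a₀ = φ₀ β₀ - T.pipeAut (φ₀ β₀) := by rw [ha₀, map_sub, hF₀]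
  have hA₁ : φ₁ a₁ = φ₁ β₁ - T.pipeAut (φ₁ β₁) := by rw [ha₁, map_sub, hF₁]
  have hfix : T₀.type ≠ 0 ∨ T₁.type ≠ 0 →
      ∃ e : (T₀.piMinus × T₁.piMinus) ≃+ T.piMinus,
        ∀ x₀ x₁, (e (x₀, x₁) : T.Pipe) = φ₀ x₀ + φ₁ x₁ := fun ht =>
    exists_equiv_fixedBy_pair T₀.pipeAut_yPipe T₁.pipeAut_yPipe (fun _ => T₀.zsmul_yPipe_eq_zero)
      hF₀ hF₁ (hy₀.trans hy₁.symm) hs hk (by rwa [T₀.exists_y_iff, T₁.exists_y_iff])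
  have hy0 : yCoeff 0 = 1 := rfl
  have he0 : etaCoeff 0 = 0 := rfl
  refine ⟨fun h₀ h₁ => ?_, fun h₀ h₁ => ?_, fun h₀ h₁ => ?_, fun h₀ h₁ => ?_⟩
  · rw [h₀, hy0, he0, one_smul, zero_smul, add_zero] at hβ₀ hB₀
    rw [h₁, hy0, he0, one_smul, zero_smul, add_zero] at hβ₁ hB₁
    obtain ⟨e, he⟩ := exists_equiv_fixedBy_pair_adjoinHalf T₀.pipeAut_yPipe T₁.pipeAut_yPipe
      (fun _ => T₀.zsmul_yPipe_eq_zero) hF₀ hF₁ (hy₀.trans hy₁.symm) hs hk hβ₀ hβ₁ ha₀ ha₁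
    rw [h₀, h₁, zero_mul]
    refine ⟨hasTriple_of (β := φ₀ β₀) ?_ e ?_, hasTriple_of (β := φ₁ β₁) ?_ e ?_⟩
    · rw [hB₀, hy0, he0, one_smul, zero_smul, add_zero]
    · rw [he, ← hA₀, ZeroMemClass.coe_zero, map_zero, add_zero]
    · rw [hB₁, hy0, he0, one_smul, zero_smul, add_zero]
    · rw [he, ← hA₁, ZeroMemClass.coe_zero, map_zero, zero_add]
  · obtain ⟨e, he⟩ := hfix (.inr h₁)
    rw [h₀] at hB₀
    rw [h₀, zero_mul]
    refine hasTriple_of (β := φ₀ β₀) ?_ e ?_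
    · rw [hB₀, he0, zero_smul, zero_smul]
    · rw [he, ← hA₀, ZeroMemClass.coe_zero, map_zero, add_zero]
  · obtain ⟨e, he⟩ := hfix (.inl h₀)
    rw [h₁] at hB₁
    rw [h₁, mul_zero]
    refine hasTriple_of (β := φ₁ β₁) ?_ e ?_
    · rw [hB₁, he0, zero_smul, zero_smul]
    · rw [he, ← hA₁, ZeroMemClass.coe_zero, map_zero, zero_add]
  · obtain ⟨e, he⟩ := hfix (.inl h₀)
    -- On the non-zero types, multiplication modulo 3 is addition of the coefficients of `y` modulo
    -- 2.
    have hcoeff : ∀ t₀ t₁ : Fin 3, t₀ ≠ 0 → t₁ ≠ 0 →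
        Even (yCoeff (t₀ * t₁) - yCoeff t₀ - yCoeff t₁) ∧ etaCoeff t₀ = 1 ∧ etaCoeff t₁ = 1 ∧
          etaCoeff (t₀ * t₁) = 1 := by decide
    generalize T₀.type = t₀ at h₀ hB₀ ⊢
    generalize T₁.type = t₁ at h₁ hB₁ ⊢
    obtain ⟨⟨r, hr⟩, e₀, e₁, e₂⟩ := hcoeff t₀ t₁ h₀ h₁
    rw [e₀, one_smul] at hB₀
    rw [e₁, one_smul] at hB₁
    refine hasTriple_of (β := φ₀ β₀ + φ₁ β₁ + r • T.yPipe) ?_ e ?_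
    · rw [e₂, one_smul]
      exact add_apply_add_add_zsmul hB₀ hB₁ hη T.pipeAut_yPipe hr
    · rw [he, hA₀, hA₁, sub_apply_add_add_zsmul T.pipeAut_yPipe]

theorem hasTriple_ind_odd {T T₀ : MarkedBYTree.{u}} {q : ℕ} (h : T.IsInd T₀ q) (hq : Odd q)
    {a₀ : T₀.piMinus} (ha : modTwo a₀ = T₀.alpha) : T.HasTriple T₀.piMinus a₀ T₀.type := by
  obtain ⟨φ, hφ, hy, hη⟩ := isInducedPipe h
  obtain ⟨β₀, hβ₀, ha⟩ := exists_beta_of_modTwo_eq ha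
  obtain ⟨β, hβ, hβ'⟩ := hφ.exists_beta_odd hq hβ₀
  obtain ⟨e, he⟩ := hφ.exists_equiv_odd hq (g := T.pipeAut) fun _ => rfl
  rw [hy, hη] at hβ
  exact hasTriple_of hβ e (by rw [he, ha, ← hβ']; rfl)

theorem hasTriple_ind_even {T T₀ : MarkedBYTree.{u}} {q : ℕ} (h : T.IsInd T₀ q) (hq : Even q) :
    T.HasTriple (T₀.piPlus ⧸ AddSubgroup.zmultiples T₀.y)
      (QuotientAddGroup.mk' (AddSubgroup.zmultiples T₀.y) T₀.eta) 1 := by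
  obtain ⟨φ, hφ, hy, hη⟩ := isInducedPipe h
  obtain ⟨β, hβ, hβ'⟩ := hφ.exists_beta_even hq
  obtain ⟨e, he⟩ := hφ.exists_equiv_even hq (g := T.pipeAut) (fun _ => rfl) T₀.y rfl
  rw [hη] at hβ
  refine hasTriple_of (β := β) (t := 1) ?_ e ((he T₀.eta).trans hβ'.symm)
  rw [show yCoeff 1 = 0 from rfl, show etaCoeff 1 = 1 from rfl, zero_smul, zero_add, one_smul]
  exact hβ

/-! ### The trichotomy in terms of classes -/

theorem trichotomy (T : MarkedBYTree.{u}) :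
    (T.cls T.y = 0 ∧ T.cls T.eta ≠ 0 ∧ T.cls (T.y + T.eta) ≠ 0) ∨
      (T.cls T.y ≠ 0 ∧ T.cls T.eta = 0 ∧ T.cls (T.y + T.eta) ≠ 0) ∨
      (T.cls T.y ≠ 0 ∧ T.cls T.eta ≠ 0 ∧ T.cls (T.y + T.eta) = 0) := by
  simp only [ne_eq, cls_y_eq_zero_iff T.isType_type, cls_eta_eq_zero_iff T.isType_type,
    cls_add_eq_zero_iff T.isType_type]
  generalize T.type = t
  revert t; decide

theorem type_eq_two_iff (T : MarkedBYTree.{u}) :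
    T.type = 2 ↔ T.cls T.y = T.cls T.eta ∧ T.cls T.eta ≠ 0 := by
  -- Since `2η = (1 + F)η`, the class is its own negative, and equality with `y_*` amounts to a
  -- vanishing sum.
  have h2 : T.cls T.eta + T.cls T.eta = 0 := by
    rw [cls, ← starClass_add, starClass_eq_zero_iff]
    exact ⟨T.etaPipe, by rw [T.pipeAut_etaPipe]; rfl⟩
  have h3 : T.cls T.y = T.cls T.eta ↔ T.cls (T.y + T.eta) = 0 := by
    rw [cls, cls, cls, starClass_add, add_eq_zero_iff_eq_neg, neg_eq_of_add_eq_zero_left h2]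
  rw [h3, cls_add_eq_zero_iff T.isType_type, ne_eq, cls_eta_eq_zero_iff T.isType_type]
  generalize T.type = t
  revert t; decide

end MarkedBYTree

end BYTrees

theorem mainTheorem7 :
    -- the triple: finiteness, trichotomy, the class `α`, and the Néron component groups
    (∀ T : BYTrees.MarkedBYTree.{u},
      Finite T.piMinus ∧
      T.cls (T.y + T.eta) = T.cls T.y + T.cls T.eta ∧
      ((T.cls T.y = 0 ∧ T.cls T.eta ≠ 0 ∧ T.cls (T.y + T.eta) ≠ 0) ∨
        (T.cls T.y ≠ 0 ∧ T.cls T.eta = 0 ∧ T.cls (T.y + T.eta) ≠ 0) ∨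
        (T.cls T.y ≠ 0 ∧ T.cls T.eta ≠ 0 ∧ T.cls (T.y + T.eta) = 0)) ∧
      (T.type = 2 ↔ T.cls T.y = T.cls T.eta ∧ T.cls T.eta ≠ 0) ∧
      (∃ β : T.Pipe, β + T.pipeAut β = T.gam) ∧
      (∀ (β : T.Pipe) (hβ : β + T.pipeAut β = T.gam),
        T.alpha = BYTrees.modTwo ⟨β - T.pipeAut β, T.sub_mem_piMinus hβ⟩) ∧
      (T.type ≠ 1 → Nonempty ((T.unmarked (-1)).Neron ≃+ T.piMinus)) ∧
      (T.type = 1 → ∀ a : T.piMinus, BYTrees.modTwo a = T.alpha →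
        Nonempty ((T.unmarked (-1)).Neron ≃+ BYTrees.AdjoinHalf a)) ∧
      (T.type ≠ 0 → Nonempty ((T.withMark (-1)).Neron ≃+ T.piMinus)) ∧
      (T.type = 0 → ∀ a : T.piMinus, BYTrees.modTwo a = T.alpha →
        Nonempty ((T.withMark (-1)).Neron ≃+ BYTrees.AdjoinHalf a))) ∧
    -- every marked BY tree is reached by the recursion
    (∀ T : BYTrees.MarkedBYTree.{u}, T.Generated) ∧
    -- a single edge
    (∀ (T : BYTrees.MarkedBYTree.{u}) (l : ℕ), T.IsEdge l →
      T.HasTriple PUnit 0 (if Odd l then 2 else 0)) ∧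
    -- grafting an edge
    (∀ (T T₀ : BYTrees.MarkedBYTree.{u}) (l : ℕ), T.IsGraft T₀ l →
      ∀ a₀ : T₀.piMinus, BYTrees.modTwo a₀ = T₀.alpha →
        T.HasTriple T₀.piMinus a₀ (if Odd l then 2 - T₀.type else T₀.type)) ∧
    -- joining two trees
    (∀ T T₀ T₁ : BYTrees.MarkedBYTree.{u}, T.IsWedge T₀ T₁ →
      ∀ (a₀ : T₀.piMinus) (a₁ : T₁.piMinus),
        BYTrees.modTwo a₀ = T₀.alpha → BYTrees.modTwo a₁ = T₁.alpha →
        (T₀.type = 0 → T₁.type = 0 →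
          T.HasTriple (BYTrees.AdjoinHalf (a₀, -a₁))
            (BYTrees.AdjoinHalf.of (a₀, -a₁) (a₀, 0)) (T₀.type * T₁.type) ∧
          T.HasTriple (BYTrees.AdjoinHalf (a₀, -a₁))
            (BYTrees.AdjoinHalf.of (a₀, -a₁) (0, a₁)) (T₀.type * T₁.type)) ∧
        (T₀.type = 0 → T₁.type ≠ 0 →
          T.HasTriple (T₀.piMinus × T₁.piMinus) (a₀, 0) (T₀.type * T₁.type)) ∧
        (T₀.type ≠ 0 → T₁.type = 0 →
          T.HasTriple (T₀.piMinus × T₁.piMinus) (0, a₁) (T₀.type * T₁.type)) ∧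
        (T₀.type ≠ 0 → T₁.type ≠ 0 →
          T.HasTriple (T₀.piMinus × T₁.piMinus) (a₀, a₁) (T₀.type * T₁.type))) ∧
    -- induction with an odd number of copies
    (∀ (T T₀ : BYTrees.MarkedBYTree.{u}) (q : ℕ), T.IsInd T₀ q → Odd q →
      ∀ a₀ : T₀.piMinus, BYTrees.modTwo a₀ = T₀.alpha →
        T.HasTriple T₀.piMinus a₀ T₀.type) ∧
    -- induction with an even number of copies
    (∀ (T T₀ : BYTrees.MarkedBYTree.{u}) (q : ℕ), T.IsInd T₀ q → Even q →
      T.HasTriple (T₀.piPlus ⧸ AddSubgroup.zmultiples T₀.y)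
        (QuotientAddGroup.mk' (AddSubgroup.zmultiples T₀.y) T₀.eta) 1) ∧
    -- trivial enlargements
    (∀ T T₀ : BYTrees.MarkedBYTree.{u}, T.IsEnlargement T₀ →
      ∀ a₀ : T₀.piMinus, BYTrees.modTwo a₀ = T₀.alpha →
        T.HasTriple T₀.piMinus a₀ T₀.type) := by
  refine ⟨fun T => ⟨T.finite_piMinus, BYTrees.starClass_add _ _ _, T.trichotomy,
    T.type_eq_two_iff, T.exists_beta, T.alpha_eq, T.nonempty_unmarked_neron,
    T.nonempty_unmarked_neron_adjoinHalf, T.nonempty_withMark_neron,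
    T.nonempty_withMark_neron_adjoinHalf⟩, fun T => T.generated,
    fun T l h => BYTrees.MarkedBYTree.hasTriple_edge h, fun T T₀ l h a₀ ha => ?_,
    fun T T₀ T₁ h a₀ a₁ ha₀ ha₁ => BYTrees.MarkedBYTree.hasTriple_wedge h ha₀ ha₁,
    fun T T₀ q h hq a₀ ha => BYTrees.MarkedBYTree.hasTriple_ind_odd h hq ha,
    fun T T₀ q h hq => BYTrees.MarkedBYTree.hasTriple_ind_even h hq, fun T T₀ h a₀ ha => ?_⟩
  · obtain ⟨φ, hφ, hη, hy⟩ := BYTrees.MarkedBYTree.pipe_graft h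
    have := BYTrees.MarkedBYTree.hasTriple_shift hφ hη hy ha
    simpa only [Int.odd_coe_nat] using this
  -- An enlargement is the shift with `l = 0`, which is not odd and keeps the type.
  · obtain ⟨φ, hφ, hη, hy⟩ := BYTrees.MarkedBYTree.pipe_enlargement h
    exact BYTrees.MarkedBYTree.hasTriple_shift hφ hη hy ha
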